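/- **Setting.** Let $E$ be a separable real Banach space with dual $E^*$ and open unit ball $B$, and let $\mathbb R_+=[0,\infty)$ carry Lebesgue measure. Let $L:\mathbb R_+\times E\times E\to\mathbb R\cup\{+\infty\}$ be an integrand and $\Gamma:\mathbb R_+\times E\twoheadrightarrow E$ a multifunction. An arc is an element of $W^{1,1}_{\mathrm{loc}}(\mathbb R_+,E)$, i.e. a locally Bochner integrable $x:\mathbb R_+\to E$ which has a strong derivative $\dot x(t)$ for a.e. $t$, with $\dot x$ locally Bochner integrable and $x(t)=x(0)+\int_0^t\dot x(s)\,ds$ for all $t\ge 0$. For $(t,\xi)\in\mathbb R_+\times E$ put $$\mathcal A_{(t,\xi)}=\{x(\cdot)\in W^{1,1}_{\mathrm{loc}}(\mathbb R_+,E)\mid \dot x(s)\in\Gamma(s,x(s))\ \text{a.e. } s\ge t,\ x(t)=\xi\},$$ $$V(t,\xi)=\inf_{x(\cdot)\in\mathcal A_{(t,\xi)}}\int_t^\infty L(s,x(s),\dot x(s))\,ds,$$ where $\int_t^\infty=\lim_{T\to\infty}\int_t^T$, the infimum is over those $x(\cdot)$ for which this is well defined, and $\inf\emptyset=+\infty$.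 A trajectory $x_0(\cdot)\in\mathcal A_{(0,\xi_0)}$ is optimal if $\int_0^\infty L(s,x_0(s),\dot x_0(s))\,ds=V(0,\xi_0)$ with $V(0,\xi_0)$ finite. **Hypotheses.** - (H1) $\mathcal A_{(t,\xi)}\neq\emptyset$ for every $(t,\xi)\in\mathbb R_+\times E$. - (H2) $L(\cdot,x,y)$ is Lebesgue measurable for every $(x,y)\in E\times E$. - (H3) There are integrable $l_0,l_1,l_2:\mathbb R_+\to\mathbb R_+$, with $l_2$ locally bounded, such that for a.e. $t$: $|L(t,0,0)|\le l_0(t)$ and $|L(t,x,y)-L(t,x',y')|\le l_1(t)\|x-x'\|+l_2(t)\|y-y'\|$ for all $x,x',y,y'\in E$. - (H4) $\Gamma$ has nonempty closed values. - (H5') $\Gamma(\cdot,x)$ is lower semicontinuous on $\mathbb R_+$ for every $x\in E$. - (H6) There are locally integrable $\gamma_0,\gamma_1:\mathbb R_+\to\mathbb R_+$ with $\Gamma(t,0)\subset\gamma_0(t)B$ and $\Gamma(t,x)\subset\Gamma(t,x')+\gamma_1(t)\|x-x'\|B$ for all $t\in\mathbb R_+$, $x,x'\in E$. - (H7) $\int_0^\infty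 \exp\left(\int_0^s\gamma_1\,d\tau\right)\left(1+\int_0^s\gamma_0\,d\tau\right)\left(l_1(s)+l_2(s)\gamma_1(s)\right)ds<\infty$ and $\int_0^\infty l_2(s)\gamma_0(s)\,ds<\infty$. **Notation.** For an extended-real function $\varphi$ on $E$ that is finite at $x$, $\varphi^-(x;v)=\liminf_{u\to v,\,\theta\downarrow0}\theta^{-1}(\varphi(x+\theta u)-\varphi(x))$ and $\partial^-\varphi(x)=\{x^*\in E^*\mid\langle x^*,v\rangle\le\varphi^-(x;v)\ \forall v\in E\}$ (Gateaux subdifferential). If $\varphi$ is Lipschitz near $x$, then $\varphi^\circ(x;v)=\limsup_{y\to x,\,\theta\downarrow0}\theta^{-1}(\varphi(y+\theta v)-\varphi(y))$ and $\partial^\circ\varphi(x)=\{x^*\in E^*\mid\langle x^*,v\rangle\le\varphi^\circ(x;v)\ \forall v\in E\}$ (Clarke subdifferential); $\varphi$ is regular at $x$ if the one-sided directional derivative $\lim_{\theta\downarrow0}\theta^{-1}(\varphi(x+\theta v)-\varphi(x))$ exists and equals $\varphi^\circ(x;v)$ for every $v\in E$. The function $\varphi$ is strictly differentiable at $x$ if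 for some $x^*\in E^*$, $\theta^{-1}(\varphi(y+\theta v)-\varphi(y))\to\langle x^*,v\rangle$ as $y\to x$, $\theta\to0$, uniformly in $v\in C$ for every compact $C\subset E$. For a nonempty set $C$ with distance function $d_C$ and $x\in C$, $T_C(x)=\{v\mid d_C^\circ(x;v)=0\}$ and $N_C(x)=\{x^*\in E^*\mid\langle x^*,v\rangle\le0\ \forall v\in T_C(x)\}$ (Clarke tangent and normal cones). Subscripts $x$, $y$ denote partial notions with respect to that variable. **Theorem.** Assume (H1)–(H4), (H5'), (H6), (H7), and let $x_0(\cdot)\in\mathcal A_{(0,\xi_0)}$ be an optimal trajectory starting at time $0$ from $\xi_0\in E$. Then for a.e. $t\in\mathbb R_+$ the following hold. 1. $V^-_x(t,x_0(t);\dot x_0(t)-v)\le L(t,x_0(t),v)-L(t,x_0(t),\dot x_0(t))$ for every $v\in\Gamma(t,x_0(t))$. 2. $-\partial^-_xV(t,x_0(t))\subset\partial^\circ_yL(t,x_0(t),\dot x_0(t))+N_{\Gamma(t,x_0(t))}(\dot x_0(t))$. 3. If $L(t,x_0(t),\cdot)$ is Gateaux differentiable at $\dot x_0(t)$ with Gateaux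 derivative $\nabla_yL(t,x_0(t),\dot x_0(t))\in E^*$, then $-\partial^-_xV(t,x_0(t))\subset\nabla_yL(t,x_0(t),\dot x_0(t))+N_{\Gamma(t,x_0(t))}(\dot x_0(t))$. If, moreover, $\partial^-_xV(t,x_0(t))\neq\emptyset$ and $N_{\Gamma(t,x_0(t))}(\dot x_0(t))=\{0\}$, then $-\partial^-_xV(t,x_0(t))=\{\nabla_yL(t,x_0(t),\dot x_0(t))\}$; in particular $\partial^-_xV(t,x_0(t))$ is a singleton. If, in addition, $V(t,\cdot)$ is regular at $x_0(t)$, then $V(t,\cdot)$ is strictly differentiable at $x_0(t)$. 4. If $E$ is finite dimensional, then $N_{\Gamma(t,x_0(t))}(\dot x_0(t))=\{0\}$ if and only if $\dot x_0(t)\in\mathrm{int}\,\Gamma(t,x_0(t))$. 5. If $V(t,\cdot)$ is convex, then it is regular at $x_0(t)$. -/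

import Mathlib

open MeasureTheory Filter Topology Set
open scoped ENNReal Pointwise

namespace InfHorizon

noncomputable section

/-! ### Nonsmooth analysis of extended-real-valued functions on a Banach space -/

/-- The difference quotient `(φ (x + θ v) - φ x) / θ`, computed in `[-∞, +∞]`. -/
def diffQuot {E : Type*} [NormedAddCommGroup E] [NormedSpace ℝ E]
    (φ : E → EReal) (x : E) (θ : ℝ) (v : E) : EReal :=
  (φ (x + θ • v) - φ x) / (θ : EReal)

/-- Clarke directional derivative `φ°(x; v)`: the upper limit of `(φ (y + θ v) - φ y) / θ` as
`y → x` and `θ ↓ 0`. -/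
def clarkeDeriv {E : Type*} [NormedAddCommGroup E] [NormedSpace ℝ E]
    (φ : E → EReal) (x v : E) : EReal :=
  limsup (fun p : E × ℝ => diffQuot φ p.1 p.2 v) (𝓝 x ×ˢ 𝓝[>] (0 : ℝ))

/-- Clarke subdifferential `∂°φ(x)`. -/
def clarkeSubdiff {E : Type*} [NormedAddCommGroup E] [NormedSpace ℝ E]
    (φ : E → EReal) (x : E) : Set (StrongDual ℝ E) :=
  {p | ∀ v : E, ((p v : ℝ) : EReal) ≤ clarkeDeriv φ x v}

/-- Lower directional derivative `φ⁻(x; v)`: the lower limit of `(φ (x + θ u) - φ x) / θ` as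
`u → v` and `θ ↓ 0`. -/
def lowerDeriv {E : Type*} [NormedAddCommGroup E] [NormedSpace ℝ E]
    (φ : E → EReal) (x v : E) : EReal :=
  liminf (fun p : E × ℝ => diffQuot φ x p.2 p.1) (𝓝 v ×ˢ 𝓝[>] (0 : ℝ))

/-- Gateaux subdifferential `∂⁻φ(x)`. -/
def gateauxSubdiff {E : Type*} [NormedAddCommGroup E] [NormedSpace ℝ E]
    (φ : E → EReal) (x : E) : Set (StrongDual ℝ E) :=
  {p | ∀ v : E, ((p v : ℝ) : EReal) ≤ lowerDeriv φ x v}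

/-- `g` is the Gateaux derivative of `φ` at `x`. -/
def HasGateauxDeriv {E : Type*} [NormedAddCommGroup E] [NormedSpace ℝ E]
    (φ : E → EReal) (g : StrongDual ℝ E) (x : E) : Prop :=
  ∀ v : E, Tendsto (fun θ : ℝ => diffQuot φ x θ v) (𝓝[≠] (0 : ℝ)) (𝓝 ((g v : ℝ) : EReal))

/-- `g` is the strict derivative of `φ` at `x`: `(φ (y + θ v) - φ y) / θ → g v` as
`y → x`, `θ → 0`, uniformly in `v ∈ C` for every compact set `C`. -/
def HasStrictDeriv {E : Type*} [NormedAddCommGroup E] [NormedSpace ℝ E]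
    (φ : E → EReal) (g : StrongDual ℝ E) (x : E) : Prop :=
  ∀ C : Set E, IsCompact C → ∀ ε : ℝ, 0 < ε →
    ∀ᶠ p : E × ℝ in 𝓝 x ×ˢ 𝓝[≠] (0 : ℝ), ∀ v ∈ C,
      ((g v - ε : ℝ) : EReal) < diffQuot φ p.1 p.2 v ∧
        diffQuot φ p.1 p.2 v < ((g v + ε : ℝ) : EReal)

/-- `φ` is regular at `x`: the one-sided directional derivatives exist and equal `φ°(x; ·)`. -/
def IsRegularAt {E : Type*} [NormedAddCommGroup E] [NormedSpace ℝ E]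
    (φ : E → EReal) (x : E) : Prop :=
  ∀ v : E, Tendsto (fun θ : ℝ => diffQuot φ x θ v) (𝓝[>] (0 : ℝ)) (𝓝 (clarkeDeriv φ x v))

/-- Convexity of an extended-real-valued function, through its epigraph. -/
def IsConvexFun {E : Type*} [NormedAddCommGroup E] [NormedSpace ℝ E]
    (φ : E → EReal) : Prop :=
  Convex ℝ {p : E × ℝ | φ p.1 ≤ ((p.2 : ℝ) : EReal)}

/-- Clarke tangent cone `T_C(x) = {v | d_C°(x; v) = 0}`. -/
def clarkeTangentCone {E : Type*} [NormedAddCommGroup E] [NormedSpace ℝ E]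
    (C : Set E) (x : E) : Set E :=
  {v | clarkeDeriv (fun y => ((Metric.infDist y C : ℝ) : EReal)) x v = 0}

/-- Clarke normal cone `N_C(x)`, the polar of the Clarke tangent cone. -/
def clarkeNormalCone {E : Type*} [NormedAddCommGroup E] [NormedSpace ℝ E]
    (C : Set E) (x : E) : Set (StrongDual ℝ E) :=
  {p | ∀ v ∈ clarkeTangentCone C x, p v ≤ 0}

/-! ### The infinite horizon variational problem -/

/-- `x` (restricted to `[0, ∞)`) is an arc, i.e. belongs to `W^{1,1}_loc([0, ∞), E)`.
The values of `x` at negative times are irrelevant. -/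
structure IsArc {E : Type*} [NormedAddCommGroup E] [NormedSpace ℝ E] (x : ℝ → E) : Prop where
  locallyIntegrable : LocallyIntegrableOn x (Ici 0)
  differentiable : ∀ᵐ t ∂volume.restrict (Ioi (0 : ℝ)), DifferentiableAt ℝ x t
  deriv_locallyIntegrable : LocallyIntegrableOn (deriv x) (Ici 0)
  eq_integral : ∀ t : ℝ, 0 ≤ t → x t = (∫ s in (0 : ℝ)..t, deriv x s) + x 0

/-- The admissible trajectories `𝒜_(t,ξ)`. -/
def admissible {E : Type*} [NormedAddCommGroup E] [NormedSpace ℝ E]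
    (Γ : ℝ → E → Set E) (t : ℝ) (ξ : E) : Set (ℝ → E) :=
  {x | IsArc x ∧ (∀ᵐ s ∂volume.restrict (Ici t), deriv x s ∈ Γ s (x s)) ∧ x t = ξ}

/-- The integral of an extended-real-valued function: integral of the positive part minus
integral of the negative part. -/
def erealIntegral (f : ℝ → EReal) (μ : Measure ℝ) : EReal :=
  ((∫⁻ s, (f s).toENNReal ∂μ : ℝ≥0∞) : EReal) - ((∫⁻ s, (-f s).toENNReal ∂μ : ℝ≥0∞) : EReal)

/-- The integral of `f` is well defined: `f` is Lebesgue measurable, and its positive and negative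
parts do not both have infinite integral. -/
def HasErealIntegral (f : ℝ → EReal) (μ : Measure ℝ) : Prop :=
  AEMeasurable f μ ∧
    (∫⁻ s, (f s).toENNReal ∂μ ≠ ⊤ ∨ ∫⁻ s, (-f s).toENNReal ∂μ ≠ ⊤)

/-- The improper integral of `f` over `[t, ∞)` is well defined and equals `I`. -/
def HasImproperIntegral (f : ℝ → EReal) (t : ℝ) (I : EReal) : Prop :=
  (∀ T : ℝ, t ≤ T → HasErealIntegral f (volume.restrict (Icc t T))) ∧
    Tendsto (fun T : ℝ => erealIntegral f (volume.restrict (Icc t T))) atTop (𝓝 I)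

/-- The cost `∫_t^∞ L(s, x(s), x'(s)) ds` of `x` is well defined and equals `I`. -/
def HasCost {E : Type*} [NormedAddCommGroup E] [NormedSpace ℝ E]
    (L : ℝ → E → E → EReal) (x : ℝ → E) (t : ℝ) (I : EReal) : Prop :=
  HasImproperIntegral (fun s => L s (x s) (deriv x s)) t I

/-- The value function (with `inf ∅ = +∞`). -/
def valueFn {E : Type*} [NormedAddCommGroup E] [NormedSpace ℝ E]
    (L : ℝ → E → E → EReal) (Γ : ℝ → E → Set E) (t : ℝ) (ξ : E) : EReal :=
  sInf {I : EReal | ∃ x ∈ admissible Γ t ξ, HasCost L x t I}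

/-- `x` is an optimal trajectory starting at time `t` from `ξ`. -/
def IsOptimal {E : Type*} [NormedAddCommGroup E] [NormedSpace ℝ E]
    (L : ℝ → E → E → EReal) (Γ : ℝ → E → Set E) (t : ℝ) (ξ : E) (x : ℝ → E) : Prop :=
  x ∈ admissible Γ t ξ ∧ valueFn L Γ t ξ ≠ ⊤ ∧ valueFn L Γ t ξ ≠ ⊥ ∧
    HasCost L x t (valueFn L Γ t ξ)

end

end InfHorizon

open InfHorizon

/-! The proof is dynamic programming with one competing trajectory. At a time t where the optimal
arc x₀ has derivative y₀, take v in Γ(t, x₀(t)), start at x₀(t) + θ(y₀ - v) and move for time θ with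
velocity close to v. The endpoint is x₀(t) + θy₀ up to o(θ), hence x₀(t+θ) up to o(θ). Since V(t+θ,
·) is Lipschitz with a constant independent of time, the value at the endpoint differs from V(t+θ,
x₀(t+θ)) by o(θ). The dynamic programming inequality along the competitor (`realValue_le_add`) and
the corresponding equality along x₀ (`realValue_optimal_split`) leave only the two running costs
over [t, t+θ]. Dividing by θ at a Lebesgue point gives inequality 1 (`realValue_sub_le`,
`eventually_quot_realValue_le`).

Two facts support this argument. Filippov's theorem (`IsVelocityField.filippov`) turns an
approximate trajectory into a genuine one with exponential estimates. It yields both the competitor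
(`exists_admissible_near_line`) and, through the integrability in (H7), the uniform Lipschitz
constant of V (`exists_cost_le`, `lipschitzWith_realValue`). Lower semicontinuity of Γ in time makes
v almost admissible on a short interval to the right of t; because it holds at every t, the
exceptional null set does not depend on v.

The remaining statements are nonsmooth analysis at a fixed time. If p is a Gateaux subgradient of
V(t, ·), inequality 1 says that y₀ minimizes L(t, x₀(t), ·) + p over Γ(t, x₀(t)). Exact penalization
by a multiple of the distance function removes the constraint, and a Hahn–Banach splitting of a
functional dominated by a sum of two sublinear ones gives the inclusion in ∂° + N
(`neg_mem_add_of_isMin`). With a Gateaux derivative no splitting is needed. Regularity turns Clarke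
functionals into Gateaux subgradients, so a singleton subdifferential forces the Clarke derivative
to be linear, which for a Lipschitz function is strict differentiability. The interior criterion and
the convex case rest on the same calculus of Clarke derivatives.

The extended-real data are first reduced to a real problem: (H3) makes L finite for almost every t,
and (H7) makes every admissible cost absolutely convergent. -/

namespace InfHorizon

open scoped NNReal

section Nonsmooth

variable {E : Type*} [NormedAddCommGroup E] [NormedSpace ℝ E]

/-! ### Sublinear functionals -/

/-- A linear functional dominated by a norm-bounded functional is continuous. -/
theorem exists_strongDual_of_le {N : E → ℝ} {K : ℝ} (hN : ∀ v, N v ≤ K * ‖v‖) (g : E →ₗ[ℝ] ℝ)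
    (hg : ∀ v, g v ≤ N v) : ∃ p : StrongDual ℝ E, ∀ v, p v = g v := by
  refine ⟨g.mkContinuous K fun v => ?_, fun v => rfl⟩
  rw [Real.norm_eq_abs, abs_le]
  have h1 := (hg v).trans (hN v)
  have h2 := (hg (-v)).trans (hN (-v))
  rw [map_neg, norm_neg] at h2
  constructor <;> linarith

/-- Hahn–Banach extension of c • v₀ ↦ c * N v₀ from the line through v₀. Domination for negative c
comes from subadditivity and N 0 = 0. The case v₀ = 0 is separate because the functional on the line
requires v₀ ≠ 0. -/
theorem exists_support_functional {N : E → ℝ} {K : ℝ} (hN : ∀ v, N v ≤ K * ‖v‖)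
    (hom : ∀ c : ℝ, 0 < c → ∀ v, N (c • v) = c * N v) (add : ∀ v w, N (v + w) ≤ N v + N w)
    (v₀ : E) : ∃ p : StrongDual ℝ E, (∀ v, p v ≤ N v) ∧ p v₀ = N v₀ := by
  have N0 : N 0 = 0 := by
    have := hom 2 two_pos 0
    rw [smul_zero] at this; linarith
  rcases eq_or_ne v₀ 0 with rfl | hv
  · obtain ⟨g, -, hg⟩ := exists_extension_of_le_sublinear (⊥ : E →ₗ.[ℝ] ℝ) N hom add (by
      rintro ⟨x, hx⟩
      have hx' : x = 0 := (Submodule.mem_bot ℝ).1 hx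
      subst hx'
      have : (⊥ : E →ₗ.[ℝ] ℝ) ⟨0, hx⟩ = 0 := LinearPMap.map_zero _
      rw [this]; exact N0.ge)
    obtain ⟨p, hp⟩ := exists_strongDual_of_le hN g hg
    exact ⟨p, fun v => (hp v).trans_le (hg v), by rw [map_zero, N0]⟩
  · obtain ⟨g, hg1, hg⟩ := exists_extension_of_le_sublinear
      (LinearPMap.mkSpanSingleton (σ := RingHom.id ℝ) v₀ (N v₀) hv) N hom add (by
      rintro ⟨x, hx⟩
      obtain ⟨c, rfl⟩ := Submodule.mem_span_singleton.1 hx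
      have hval : (LinearPMap.mkSpanSingleton (σ := RingHom.id ℝ) v₀ (N v₀) hv) ⟨c • v₀, hx⟩ =
          c * N v₀ := LinearPMap.mkSpanSingleton'_apply _ _ _ _ _
      rw [hval]
      change c * N v₀ ≤ N (c • v₀)
      rcases lt_trichotomy c 0 with hc | hc | hc
      · have h1 := hom (-c) (by linarith) v₀
        have h2 := add (c • v₀) ((-c) • v₀)
        rw [← add_smul, add_neg_cancel, zero_smul, N0, h1] at h2
        linarith
      · subst hc; simp [N0]
      · exact (hom c hc v₀).ge)
    obtain ⟨p, hp⟩ := exists_strongDual_of_le hN g hg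
    refine ⟨p, fun v => (hp v).trans_le (hg v), ?_⟩
    have := hg1 ⟨v₀, Submodule.mem_span_singleton_self v₀⟩
    rw [hp]
    exact this.trans (LinearPMap.mkSpanSingleton_apply ℝ ℝ hv (N v₀))

/-- Decomposition of a functional dominated by a sum of sublinear functionals. -/
theorem exists_add_functional {N₁ N₂ : E → ℝ} {K₁ K₂ : ℝ}
    (hN₁ : ∀ v, N₁ v ≤ K₁ * ‖v‖) (hN₂ : ∀ v, N₂ v ≤ K₂ * ‖v‖)
    (hom₁ : ∀ c : ℝ, 0 < c → ∀ v, N₁ (c • v) = c * N₁ v)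
    (hom₂ : ∀ c : ℝ, 0 < c → ∀ v, N₂ (c • v) = c * N₂ v)
    (add₁ : ∀ v w, N₁ (v + w) ≤ N₁ v + N₁ w) (add₂ : ∀ v w, N₂ (v + w) ≤ N₂ v + N₂ w)
    (p : StrongDual ℝ E) (hp : ∀ v, p v ≤ N₁ v + N₂ v) :
    ∃ a b : StrongDual ℝ E, (∀ v, a v ≤ N₁ v) ∧ (∀ v, b v ≤ N₂ v) ∧ a + b = p := by
  have z₁ : N₁ 0 = 0 := by
    have := hom₁ 2 two_pos 0
    rw [smul_zero] at this; linarith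
  have z₂ : N₂ 0 = 0 := by
    have := hom₂ 2 two_pos 0
    rw [smul_zero] at this; linarith
  -- The functional p is placed on the diagonal of E × E, where it is dominated by N₁ + N₂. A
  -- dominated extension to the whole product, restricted to the two axes, gives the two summands.
  let D : E × E →ₗ.[ℝ] ℝ :=
    ⟨LinearMap.range (LinearMap.prod (LinearMap.id : E →ₗ[ℝ] E) LinearMap.id),
      (p.toLinearMap ∘ₗ LinearMap.fst ℝ E E) ∘ₗ Submodule.subtype _⟩
  obtain ⟨g, hg1, hg⟩ := exists_extension_of_le_sublinear D (fun z => N₁ z.1 + N₂ z.2)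
    (fun c hc z => by simp only [Prod.smul_fst, Prod.smul_snd, hom₁ c hc, hom₂ c hc]; ring)
    (fun z w => by
      have := add₁ z.1 w.1
      have := add₂ z.2 w.2
      simp only [Prod.fst_add, Prod.snd_add]; linarith)
    (by
      rintro ⟨x, ⟨v, rfl⟩⟩
      exact hp v)
  obtain ⟨a, ha⟩ := exists_strongDual_of_le hN₁ (g ∘ₗ LinearMap.inl ℝ E E) (fun v => by
    simpa [z₂] using hg (v, 0))
  obtain ⟨b, hb⟩ := exists_strongDual_of_le hN₂ (g ∘ₗ LinearMap.inr ℝ E E) (fun v => by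
    simpa [z₁] using hg (0, v))
  refine ⟨a, b, fun v => ?_, fun v => ?_, ?_⟩
  · rw [ha]; simpa [z₂] using hg (v, 0)
  · rw [hb]; simpa [z₁] using hg (0, v)
  · ext v
    have h := hg1 ⟨(v, v), ⟨v, rfl⟩⟩
    have h' : D ⟨(v, v), ⟨v, rfl⟩⟩ = p v := rfl
    rw [add_apply, ha, hb, ← h', ← h]
    simp only [LinearMap.comp_apply, ← map_add]
    simp

/-! ### Clarke derivatives of real-valued Lipschitz functions -/

theorem diffQuot_coe (f : E → ℝ) (x : E) (θ : ℝ) (v : E) :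
    diffQuot (fun y => (f y : EReal)) x θ v = (((f (x + θ • v) - f x) / θ : ℝ) : EReal) := by
  simp [diffQuot, EReal.coe_div, EReal.coe_sub]

theorem abs_quot_le {f : E → ℝ} {K : ℝ≥0} (hf : LipschitzWith K f) (x : E) {θ : ℝ} (hθ : θ ≠ 0)
    (v : E) : |(f (x + θ • v) - f x) / θ| ≤ K * ‖v‖ := by
  have h := hf.dist_le_mul (x + θ • v) x
  rw [Real.dist_eq, dist_eq_norm, add_sub_cancel_left, norm_smul, Real.norm_eq_abs] at h
  rw [abs_div, div_le_iff₀ (abs_pos.2 hθ)]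
  linarith

omit [NormedSpace ℝ E] in
theorem eventually_snd_pos (x : E) : ∀ᶠ p : E × ℝ in 𝓝 x ×ˢ 𝓝[>] (0 : ℝ), 0 < p.2 :=
  (tendsto_snd (f := 𝓝 x)).eventually self_mem_nhdsWithin

/-- The real value of the Clarke derivative of a real-valued function. -/
noncomputable def clarkeReal (f : E → ℝ) (x v : E) : ℝ :=
  (clarkeDeriv (fun y => (f y : EReal)) x v).toReal

section Lipschitz

variable {f : E → ℝ} {K : ℝ≥0}

theorem clarkeDeriv_le_of_eventually {x v : E} {a : ℝ}
    (h : ∀ᶠ p : E × ℝ in 𝓝 x ×ˢ 𝓝[>] (0 : ℝ), (f (p.1 + p.2 • v) - f p.1) / p.2 ≤ a) :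
    clarkeDeriv (fun y => (f y : EReal)) x v ≤ a := by
  refine limsup_le_of_le (by isBoundedDefault) ?_
  filter_upwards [h] with p hp
  rw [diffQuot_coe]
  exact_mod_cast hp

theorem le_clarkeDeriv_of_frequently {x v : E} {a : ℝ}
    (h : ∃ᶠ p : E × ℝ in 𝓝 x ×ˢ 𝓝[>] (0 : ℝ), a ≤ (f (p.1 + p.2 • v) - f p.1) / p.2) :
    (a : EReal) ≤ clarkeDeriv (fun y => (f y : EReal)) x v := by
  refine le_limsup_of_frequently_le (h.mono fun p hp => ?_) (by isBoundedDefault)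
  rw [diffQuot_coe]
  exact_mod_cast hp

/-- The quotients stay within ±K‖v‖, so the upper limit is finite and `toReal` loses nothing. -/
theorem coe_clarkeReal (hf : LipschitzWith K f) (x v : E) :
    (clarkeReal f x v : EReal) = clarkeDeriv (fun y => (f y : EReal)) x v := by
  have h1 : clarkeDeriv (fun y => (f y : EReal)) x v ≤ ((K * ‖v‖ : ℝ) : EReal) :=
    clarkeDeriv_le_of_eventually (by
      filter_upwards [eventually_snd_pos x] with p hp
      exact (abs_le.1 (abs_quot_le hf p.1 hp.ne' v)).2)
  have h2 : ((-(K * ‖v‖) : ℝ) : EReal) ≤ clarkeDeriv (fun y => (f y : EReal)) x v :=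
    le_clarkeDeriv_of_frequently (Eventually.frequently (by
      filter_upwards [eventually_snd_pos x] with p hp
      exact (abs_le.1 (abs_quot_le hf p.1 hp.ne' v)).1))
  refine EReal.coe_toReal ?_ ?_
  · exact ne_top_of_le_ne_top (EReal.coe_ne_top _) h1
  · exact ne_bot_of_le_ne_bot (EReal.coe_ne_bot _) h2

theorem clarkeReal_le_of_eventually (hf : LipschitzWith K f) {x v : E} {a : ℝ}
    (h : ∀ᶠ p : E × ℝ in 𝓝 x ×ˢ 𝓝[>] (0 : ℝ), (f (p.1 + p.2 • v) - f p.1) / p.2 ≤ a) :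
    clarkeReal f x v ≤ a := by
  have := clarkeDeriv_le_of_eventually h
  rw [← coe_clarkeReal hf] at this
  exact_mod_cast this

theorem le_clarkeReal_of_frequently (hf : LipschitzWith K f) {x v : E} {a : ℝ}
    (h : ∃ᶠ p : E × ℝ in 𝓝 x ×ˢ 𝓝[>] (0 : ℝ), a ≤ (f (p.1 + p.2 • v) - f p.1) / p.2) :
    a ≤ clarkeReal f x v := by
  have := le_clarkeDeriv_of_frequently h
  rw [← coe_clarkeReal hf] at this
  exact_mod_cast this

theorem eventually_lt_of_clarkeReal_lt (hf : LipschitzWith K f) {x v : E} {a : ℝ}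
    (h : clarkeReal f x v < a) :
    ∀ᶠ p : E × ℝ in 𝓝 x ×ˢ 𝓝[>] (0 : ℝ), (f (p.1 + p.2 • v) - f p.1) / p.2 < a := by
  have h' : clarkeDeriv (fun y => (f y : EReal)) x v < (a : EReal) := by
    rw [← coe_clarkeReal hf]; exact_mod_cast h
  filter_upwards [eventually_lt_of_limsup_lt h' (by isBoundedDefault)] with p hp
  rw [diffQuot_coe] at hp
  exact_mod_cast hp

theorem clarkeReal_le_norm (hf : LipschitzWith K f) (x v : E) : clarkeReal f x v ≤ K * ‖v‖ :=
  clarkeReal_le_of_eventually hf (by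
    filter_upwards [eventually_snd_pos x] with p hp
    exact (abs_le.1 (abs_quot_le hf p.1 hp.ne' v)).2)

/-- The Clarke limit lets the base point move. This shift is what permits splitting an increment at
an intermediate point, or reading it backwards from its endpoint. -/
theorem tendsto_shift (x w : E) : Tendsto (fun p : E × ℝ => (p.1 + p.2 • w, p.2))
    (𝓝 x ×ˢ 𝓝[>] (0 : ℝ)) (𝓝 x ×ˢ 𝓝[>] (0 : ℝ)) := by
  refine Tendsto.prodMk ?_ tendsto_snd
  have h : Tendsto (fun p : E × ℝ => p.1 + p.2 • w) (𝓝 x ×ˢ 𝓝 (0 : ℝ)) (𝓝 (x + (0 : ℝ) • w)) := by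
    rw [← nhds_prod_eq]
    exact (by fun_prop : Continuous fun p : E × ℝ => p.1 + p.2 • w).tendsto (x, 0)
  rw [zero_smul, add_zero] at h
  exact h.mono_left (prod_mono le_rfl nhdsWithin_le_nhds)

theorem clarkeReal_add_le (hf : LipschitzWith K f) (x v w : E) :
    clarkeReal f x (v + w) ≤ clarkeReal f x v + clarkeReal f x w := by
  refine le_of_forall_pos_le_add fun ε hε => ?_
  have h1 := eventually_lt_of_clarkeReal_lt hf (x := x) (v := v)
    (lt_add_of_pos_right _ (half_pos hε))
  have h2 := eventually_lt_of_clarkeReal_lt hf (x := x) (v := w)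
    (lt_add_of_pos_right _ (half_pos hε))
  refine clarkeReal_le_of_eventually hf ?_
  filter_upwards [(tendsto_shift x w).eventually h1, h2] with p hp1 hp2
  -- The increment along v + w is split at the intermediate point, which serves as a shifted base
  -- point for v.
  have e : p.1 + p.2 • (v + w) = p.1 + p.2 • w + p.2 • v := by rw [smul_add]; abel
  rw [e]
  have : (f (p.1 + p.2 • w + p.2 • v) - f p.1) / p.2 =
      (f (p.1 + p.2 • w + p.2 • v) - f (p.1 + p.2 • w)) / p.2 +
      (f (p.1 + p.2 • w) - f p.1) / p.2 := by ring
  linarith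

theorem clarkeReal_smul_le (hf : LipschitzWith K f) (x v : E) {c : ℝ} (hc : 0 < c) :
    clarkeReal f x (c • v) ≤ c * clarkeReal f x v := by
  refine le_of_forall_pos_le_add fun ε hε => ?_
  have h1 := eventually_lt_of_clarkeReal_lt hf (x := x) (v := v)
    (lt_add_of_pos_right _ (div_pos hε hc))
  have ht : Tendsto (fun p : E × ℝ => (p.1, c * p.2))
      (𝓝 x ×ˢ 𝓝[>] (0 : ℝ)) (𝓝 x ×ˢ 𝓝[>] (0 : ℝ)) := by
    refine Tendsto.prodMk tendsto_fst ?_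
    have : Tendsto (fun θ : ℝ => c * θ) (𝓝[>] (0 : ℝ)) (𝓝[>] (0 : ℝ)) := by
      refine tendsto_nhdsWithin_iff.2 ⟨?_, ?_⟩
      · have := ((continuous_const_mul c).tendsto (0 : ℝ)).mono_left
          (nhdsWithin_le_nhds (s := Ioi (0 : ℝ)))
        simpa using this
      · filter_upwards [self_mem_nhdsWithin] with θ hθ using mul_pos hc hθ
    exact this.comp tendsto_snd
  refine clarkeReal_le_of_eventually hf ?_
  filter_upwards [ht.eventually h1, eventually_snd_pos x] with p hp1 hp
  have e : p.1 + p.2 • c • v = p.1 + (c * p.2) • v := by rw [smul_smul, mul_comm]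
  rw [e]
  have h2 := mul_lt_mul_of_pos_left hp1 hc
  have h3 : c * ((f (p.1 + (c * p.2) • v) - f p.1) / (c * p.2)) =
      (f (p.1 + (c * p.2) • v) - f p.1) / p.2 := by
    field_simp
  have h4 : c * (clarkeReal f x v + ε / c) = c * clarkeReal f x v + ε := by
    field_simp
  simp only [h3, h4] at h2
  exact h2.le

theorem clarkeReal_smul (hf : LipschitzWith K f) (x : E) (c : ℝ) (hc : 0 < c) (v : E) :
    clarkeReal f x (c • v) = c * clarkeReal f x v := by
  refine le_antisymm (clarkeReal_smul_le hf x v hc) ?_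
  have h := clarkeReal_smul_le hf x (c • v) (inv_pos.2 hc)
  rw [smul_smul, inv_mul_cancel₀ hc.ne', one_smul] at h
  have := mul_le_mul_of_nonneg_left h hc.le
  rwa [← mul_assoc, mul_inv_cancel₀ hc.ne', one_mul] at this

theorem mem_clarkeSubdiff_iff (hf : LipschitzWith K f) {x : E} {p : StrongDual ℝ E} :
    p ∈ clarkeSubdiff (fun y => (f y : EReal)) x ↔ ∀ v, p v ≤ clarkeReal f x v := by
  refine forall_congr' fun v => ?_
  rw [← coe_clarkeReal hf, EReal.coe_le_coe_iff]

theorem exists_clarke_support (hf : LipschitzWith K f) (x v₀ : E) :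
    ∃ p : StrongDual ℝ E, (∀ v, p v ≤ clarkeReal f x v) ∧ p v₀ = clarkeReal f x v₀ :=
  exists_support_functional (clarkeReal_le_norm hf x) (clarkeReal_smul hf x)
    (clarkeReal_add_le hf x) v₀

end Lipschitz

end Nonsmooth

/-! ### Strict differentiability, regularity and convexity -/

section Nonsmooth

variable {E : Type*} [NormedAddCommGroup E] [NormedSpace ℝ E]

section Lipschitz

variable {f : E → ℝ} {K : ℝ≥0}

omit [NormedSpace ℝ E] in
theorem tendsto_base (x : E) : Tendsto (fun θ : ℝ => (x, θ)) (𝓝[>] (0 : ℝ))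
    (𝓝 x ×ˢ 𝓝[>] (0 : ℝ)) :=
  tendsto_const_nhds.prodMk tendsto_id

/-- An upper limit controls quotients from one side only. The lower bound comes from direction -v
based at the shifted point y + θv, where the quotient is the negative of the original one; linearity
of the Clarke derivative makes the two bounds match. -/
theorem eventually_abs_quot_sub_lt (hf : LipschitzWith K f) {x : E} {g : StrongDual ℝ E}
    (hg : ∀ v, clarkeReal f x v = g v) (v : E) {ε : ℝ} (hε : 0 < ε) :
    ∀ᶠ p : E × ℝ in 𝓝 x ×ˢ 𝓝[>] (0 : ℝ), |(f (p.1 + p.2 • v) - f p.1) / p.2 - g v| < ε := by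
  have h1 := eventually_lt_of_clarkeReal_lt hf (x := x) (v := v) (a := g v + ε)
    (by rw [hg]; linarith)
  have h2 := eventually_lt_of_clarkeReal_lt hf (x := x) (v := -v) (a := g (-v) + ε)
    (by rw [hg]; linarith)
  filter_upwards [h1, (tendsto_shift x v).eventually h2] with p hp1 hp2
  have e : p.1 + p.2 • v + p.2 • (-v) = p.1 := by rw [smul_neg]; abel
  rw [e, map_neg] at hp2
  have e2 : (f p.1 - f (p.1 + p.2 • v)) / p.2 = -((f (p.1 + p.2 • v) - f p.1) / p.2) := by ring
  rw [e2] at hp2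
  rw [abs_lt]
  constructor <;> linarith

theorem eventually_forall_abs_quot_sub_lt (hf : LipschitzWith K f) {x : E} {g : StrongDual ℝ E}
    (hg : ∀ v, clarkeReal f x v = g v) {C : Set E} (hC : IsCompact C) {ε : ℝ} (hε : 0 < ε) :
    ∀ᶠ p : E × ℝ in 𝓝 x ×ˢ 𝓝[>] (0 : ℝ), ∀ v ∈ C,
      |(f (p.1 + p.2 • v) - f p.1) / p.2 - g v| < ε := by
  -- As functions of v, the quotients are K-Lipschitz and g is ‖g‖-Lipschitz. A finite net of radius
  -- ε / (2M), with error ε/2 at its points, therefore gives error below ε on all of C.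
  set M : ℝ := K + ‖g‖ + 1 with hM
  have hMpos : 0 < M := by positivity
  obtain ⟨t, -, htfin, htC⟩ := hC.finite_cover_balls (e := ε / (2 * M)) (by positivity)
  have h := (eventually_all_finite htfin).2 fun w _ =>
    eventually_abs_quot_sub_lt hf hg w (half_pos hε)
  filter_upwards [h, eventually_snd_pos x] with p hp hpos v hv
  obtain ⟨w, hw, hvw⟩ := mem_iUnion₂.1 (htC hv)
  rw [Metric.mem_ball, dist_eq_norm] at hvw
  have h1 := hp w hw
  have h2 := abs_quot_le hf (p.1 + p.2 • w) hpos.ne' (v - w)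
  have e : p.1 + p.2 • w + p.2 • (v - w) = p.1 + p.2 • v := by rw [smul_sub]; abel
  rw [e] at h2
  have h3 : |g (v - w)| ≤ ‖g‖ * ‖v - w‖ := g.le_opNorm _
  have e2 : (f (p.1 + p.2 • v) - f p.1) / p.2 - g v =
      (f (p.1 + p.2 • v) - f (p.1 + p.2 • w)) / p.2 +
      ((f (p.1 + p.2 • w) - f p.1) / p.2 - g w) - g (v - w) := by
    rw [map_sub]; ring
  rw [e2]
  have h4 : M * ‖v - w‖ < ε / 2 := by
    have := mul_lt_mul_of_pos_left hvw hMpos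
    have e3 : M * (ε / (2 * M)) = ε / 2 := by field_simp
    linarith
  have h5 : (K + ‖g‖) * ‖v - w‖ ≤ M * ‖v - w‖ := by
    gcongr; linarith
  have h6 := abs_sub ((f (p.1 + p.2 • v) - f (p.1 + p.2 • w)) / p.2 +
      ((f (p.1 + p.2 • w) - f p.1) / p.2 - g w)) (g (v - w))
  have h7 := abs_add_le ((f (p.1 + p.2 • v) - f (p.1 + p.2 • w)) / p.2)
      ((f (p.1 + p.2 • w) - f p.1) / p.2 - g w)
  linarith

theorem hasStrictDeriv_of_clarkeReal_eq (hf : LipschitzWith K f) {x : E} {g : StrongDual ℝ E}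
    (hg : ∀ v, clarkeReal f x v = g v) : HasStrictDeriv (fun y => (f y : EReal)) g x := by
  intro C hC ε hε
  have h1 := eventually_forall_abs_quot_sub_lt hf hg hC hε
  have h2 := eventually_forall_abs_quot_sub_lt hf hg hC.neg hε
  -- Negative θ reduces to positive θ by replacing v with -v, that is, C with -C.
  have ht : Tendsto (fun p : E × ℝ => (p.1, -p.2))
      (𝓝 x ×ˢ 𝓝[<] (0 : ℝ)) (𝓝 x ×ˢ 𝓝[>] (0 : ℝ)) := by
    refine Tendsto.prodMk tendsto_fst (Tendsto.comp ?_ tendsto_snd)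
    simpa using tendsto_neg_nhdsLT (a := (0 : ℝ))
  rw [← Iio_union_Ioi, nhdsWithin_union, prod_sup, eventually_sup]
  constructor
  · filter_upwards [ht.eventually h2] with p hp v hv
    have h := hp (-v) (by simpa using hv)
    rw [diffQuot_coe, EReal.coe_lt_coe_iff, EReal.coe_lt_coe_iff]
    rw [neg_smul_neg, map_neg, div_neg] at h
    have := abs_lt.1 h
    constructor <;> linarith
  · filter_upwards [h1] with p hp v hv
    rw [diffQuot_coe, EReal.coe_lt_coe_iff, EReal.coe_lt_coe_iff]
    have := abs_lt.1 (hp v hv)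
    constructor <;> linarith

/-- Perturbing the direction from v to u changes the quotient by at most K‖u - v‖, so the liminf
over u → v is no smaller than the limit along the fixed direction. -/
theorem le_lowerDeriv_of_tendsto (hf : LipschitzWith K f) {x v : E} {c : ℝ}
    (h : Tendsto (fun θ : ℝ => diffQuot (fun y => (f y : EReal)) x θ v) (𝓝[>] 0)
      (𝓝 (c : EReal))) : (c : EReal) ≤ lowerDeriv (fun y => (f y : EReal)) x v := by
  by_contra! hlt
  obtain ⟨a, ha1, ha2⟩ := EReal.lt_iff_exists_real_btwn.1 hlt
  have hac : a < c := by exact_mod_cast ha2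
  refine absurd ha1 (not_lt.2 ?_)
  refine le_liminf_of_le (by isBoundedDefault) ?_
  have hb : ((a + c) / 2 : ℝ) < (c : EReal) := by
    exact_mod_cast (by linarith : (a + c) / 2 < c)
  have h1 := (tendsto_snd (f := 𝓝 v)).eventually (h.eventually (lt_mem_nhds hb))
  have h2 : ∀ᶠ p : E × ℝ in 𝓝 v ×ˢ 𝓝[>] (0 : ℝ), K * ‖p.1 - v‖ < (c - a) / 2 := by
    have : Tendsto (fun u : E => K * ‖u - v‖) (𝓝 v) (𝓝 (K * ‖v - v‖)) :=
      (by fun_prop : Continuous fun u : E => K * ‖u - v‖).tendsto v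
    rw [sub_self, norm_zero, mul_zero] at this
    exact (tendsto_fst (g := 𝓝[>] (0 : ℝ))).eventually
      (this.eventually (gt_mem_nhds (by linarith)))
  filter_upwards [h1, h2, eventually_snd_pos v] with p hp1 hp2 hpos
  rw [diffQuot_coe] at hp1 ⊢
  have hp1' : (a + c) / 2 < (f (x + p.2 • v) - f x) / p.2 := by exact_mod_cast hp1
  have h3 := abs_quot_le hf (x + p.2 • v) hpos.ne' (p.1 - v)
  have e : x + p.2 • v + p.2 • (p.1 - v) = x + p.2 • p.1 := by rw [smul_sub]; abel
  rw [e] at h3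
  have e2 : (f (x + p.2 • p.1) - f x) / p.2 = (f (x + p.2 • p.1) - f (x + p.2 • v)) / p.2 +
      (f (x + p.2 • v) - f x) / p.2 := by ring
  have := (abs_le.1 h3).1
  rw [EReal.coe_le_coe_iff, e2]
  linarith

theorem mem_gateauxSubdiff_of_le_clarkeReal (hf : LipschitzWith K f) {x : E}
    (hreg : IsRegularAt (fun y => (f y : EReal)) x) {p : StrongDual ℝ E}
    (hp : ∀ v, p v ≤ clarkeReal f x v) : p ∈ gateauxSubdiff (fun y => (f y : EReal)) x := by
  intro v
  have h := hreg v
  rw [← coe_clarkeReal hf] at h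
  exact le_trans (by exact_mod_cast hp v) (le_lowerDeriv_of_tendsto hf h)

/-- By Hahn–Banach each value of the Clarke derivative is attained by a dominated functional, which
under regularity is a Gateaux subgradient, hence equal to p. So the Clarke derivative is p itself.
-/
theorem exists_hasStrictDeriv_of_isRegularAt (hf : LipschitzWith K f) {x : E}
    (hreg : IsRegularAt (fun y => (f y : EReal)) x) {p : StrongDual ℝ E}
    (hp : gateauxSubdiff (fun y => (f y : EReal)) x = {p}) :
    HasStrictDeriv (fun y => (f y : EReal)) p x := by
  refine hasStrictDeriv_of_clarkeReal_eq hf fun v => ?_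
  obtain ⟨q, hq, hqv⟩ := exists_clarke_support hf x v
  have : q ∈ gateauxSubdiff (fun y => (f y : EReal)) x :=
    mem_gateauxSubdiff_of_le_clarkeReal hf hreg hq
  rw [hp, mem_singleton_iff] at this
  rw [← hqv, this]

/-- Convexity makes quotients nondecreasing in the step. The quotient at a fixed step l is
continuous in the base point and bounds the nearby shorter quotients, so every quotient at x
dominates the Clarke derivative; the definition of the latter gives the opposite bound in the limit.
-/
theorem isRegularAt_of_isConvexFun (hf : LipschitzWith K f)
    (hconv : IsConvexFun (fun y => (f y : EReal))) (x : E) :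
    IsRegularAt (fun y => (f y : EReal)) x := by
  intro v
  have hc : ∀ y z : E, ∀ a b : ℝ, 0 ≤ a → 0 ≤ b → a + b = 1 →
      f (a • y + b • z) ≤ a * f y + b * f z := by
    intro y z a b ha hb hab
    have := hconv (x := (y, f y)) (by simp) (y := (z, f z)) (by simp) ha hb hab
    have h2 : ((f (a • y + b • z) : ℝ) : EReal) ≤ ((a * f y + b * f z : ℝ) : EReal) := this
    exact_mod_cast h2
  have hquot : ∀ (y : E) (θ l : ℝ), 0 < θ → θ ≤ l →
      (f (y + θ • v) - f y) / θ ≤ (f (y + l • v) - f y) / l := by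
    intro y θ l hθ hl
    have hl0 : 0 < l := hθ.trans_le hl
    have h := hc y (y + l • v) (1 - θ / l) (θ / l)
      (by rw [sub_nonneg, div_le_one hl0]; exact hl) (by positivity) (by ring)
    have e : (1 - θ / l) • y + (θ / l) • (y + l • v) = y + θ • v := by
      rw [smul_add, smul_smul, div_mul_cancel₀ _ hl0.ne', sub_smul, one_smul]; abel
    rw [e] at h
    rw [div_le_div_iff₀ hθ hl0]
    have e2 : (1 - θ / l) * f y + θ / l * f (y + l • v) =
      f y + θ * (f (y + l • v) - f y) / l := by ring
    rw [e2] at h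
    have h3 : f (y + θ • v) - f y ≤ θ * (f (y + l • v) - f y) / l := by linarith
    rw [le_div_iff₀ hl0] at h3
    linarith
  have hle : ∀ l : ℝ, 0 < l → clarkeReal f x v ≤ (f (x + l • v) - f x) / l := by
    intro l hl
    refine le_of_forall_pos_le_add fun ε hε => clarkeReal_le_of_eventually hf ?_
    have h1 : ∀ᶠ p : E × ℝ in 𝓝 x ×ˢ 𝓝[>] (0 : ℝ),
        (f (p.1 + l • v) - f p.1) / l < (f (x + l • v) - f x) / l + ε := by
      have hcont : Continuous fun y => (f (y + l • v) - f y) / l := by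
        have := hf.continuous
        fun_prop
      exact (tendsto_fst (g := 𝓝[>] (0 : ℝ))).eventually
        ((hcont.tendsto x).eventually (gt_mem_nhds (by linarith)))
    have h2 : ∀ᶠ p : E × ℝ in 𝓝 x ×ˢ 𝓝[>] (0 : ℝ), p.2 < l :=
      (tendsto_snd (f := 𝓝 x)).eventually (nhdsWithin_le_nhds (gt_mem_nhds hl))
    filter_upwards [h1, h2, eventually_snd_pos x] with p hp1 hp2 hpos
    exact (hquot p.1 p.2 l hpos hp2.le).trans hp1.le
  rw [← coe_clarkeReal hf]
  simp only [diffQuot_coe]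
  refine (continuous_coe_real_ereal.tendsto _).comp (tendsto_order.2 ⟨fun a ha => ?_, fun a ha => ?_⟩)
  · filter_upwards [self_mem_nhdsWithin] with θ hθ using ha.trans_le (hle θ hθ)
  · exact (tendsto_base x).eventually (eventually_lt_of_clarkeReal_lt hf ha)

end Lipschitz

/-! ### Minimization over a set -/

section Minimum

variable {φ : E → ℝ} {k : ℝ≥0} {C : Set E} {y₀ : E} {p : StrongDual ℝ E}

omit [NormedSpace ℝ E] in
theorem lipschitzWith_infDist (C : Set E) : LipschitzWith 1 fun y => Metric.infDist y C :=
  Metric.lipschitz_infDist_pt C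

/-- Exact penalization: φ + p has Lipschitz constant k + ‖p‖, so adding a larger multiple of the
distance to C makes y₀ an unconstrained minimizer. The extra 1 keeps the multiplier positive. -/
theorem zero_le_quot_add_infDist (hφ : LipschitzWith k φ) (hy₀ : y₀ ∈ C)
    (hmin : ∀ v ∈ C, φ y₀ + p y₀ ≤ φ v + p v) (v : E) {θ : ℝ} (hθ : 0 < θ) :
    0 ≤ (φ (y₀ + θ • v) - φ y₀) / θ + p v +
      (k + ‖p‖ + 1) * ((Metric.infDist (y₀ + θ • v) C - Metric.infDist y₀ C) / θ) := by
  have hpos : 0 < k + ‖p‖ + 1 := by positivity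
  have h : (φ y₀ - φ (y₀ + θ • v) - θ * p v) / (k + ‖p‖ + 1) ≤
      Metric.infDist (y₀ + θ • v) C := by
    refine (Metric.le_infDist ⟨y₀, hy₀⟩).2 fun c hc => ?_
    rw [div_le_iff₀ hpos]
    have h1 := hmin c hc
    have h3 : p (c - (y₀ + θ • v)) ≤ ‖p‖ * ‖c - (y₀ + θ • v)‖ :=
      (le_abs_self _).trans (p.le_opNorm _)
    rw [← dist_eq_norm, map_sub, map_add, map_smul, smul_eq_mul] at h3
    have h4 := (abs_le.1 (hφ.dist_le_mul c (y₀ + θ • v))).2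
    have h5 : φ c - φ (y₀ + θ • v) ≤ k * dist c (y₀ + θ • v) :=
      (le_abs_self _).trans (hφ.dist_le_mul c (y₀ + θ • v))
    rw [dist_comm c] at h3 h5
    have h6 : 0 ≤ dist (y₀ + θ • v) c := dist_nonneg
    nlinarith
  rw [div_le_iff₀ hpos] at h
  rw [Metric.infDist_zero_of_mem hy₀]
  have e : (φ (y₀ + θ • v) - φ y₀) / θ + p v +
      (k + ‖p‖ + 1) * ((Metric.infDist (y₀ + θ • v) C - 0) / θ) =
      (φ (y₀ + θ • v) - φ y₀ + θ * p v + Metric.infDist (y₀ + θ • v) C * (k + ‖p‖ + 1)) / θ := by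
    field_simp; ring
  rw [e]
  exact div_nonneg (by linarith) hθ.le

theorem clarkeReal_infDist_eq_zero {v : E} (hv : v ∈ clarkeTangentCone C y₀) :
    clarkeReal (fun y => Metric.infDist y C) y₀ v = 0 := by
  have h : clarkeDeriv (fun y => ((Metric.infDist y C : ℝ) : EReal)) y₀ v = 0 := hv
  rw [clarkeReal, h, EReal.toReal_zero]

theorem mem_tangentCone_of_clarkeReal_eq_zero {v : E}
    (hv : clarkeReal (fun y => Metric.infDist y C) y₀ v = 0) : v ∈ clarkeTangentCone C y₀ := by
  have h := coe_clarkeReal (lipschitzWith_infDist C) y₀ v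
  rw [hv] at h
  exact h.symm

/-- Penalization bounds -p by the Clarke derivative of φ plus M times that of the distance. In the
resulting splitting, the second summand is nonpositive on the tangent cone because the derivative of
the distance vanishes there. -/
theorem neg_mem_add_of_isMin (hφ : LipschitzWith k φ) (hy₀ : y₀ ∈ C)
    (hmin : ∀ v ∈ C, φ y₀ + p y₀ ≤ φ v + p v) :
    -p ∈ clarkeSubdiff (fun y => (φ y : EReal)) y₀ + clarkeNormalCone C y₀ := by
  have hd := lipschitzWith_infDist C
  set M : ℝ := k + ‖p‖ + 1 with hM
  have hpos : 0 < M := by positivity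
  have key : ∀ v, (-p) v ≤ clarkeReal φ y₀ v +
      M * clarkeReal (fun y => Metric.infDist y C) y₀ v := by
    intro v
    rw [neg_apply]
    refine le_of_forall_pos_le_add fun ε hε => ?_
    have h1 := (tendsto_base y₀).eventually (eventually_lt_of_clarkeReal_lt hφ (x := y₀) (v := v)
      (lt_add_of_pos_right _ (half_pos hε)))
    have h2 := (tendsto_base y₀).eventually (eventually_lt_of_clarkeReal_lt hd (x := y₀) (v := v)
      (lt_add_of_pos_right _ (div_pos (half_pos hε) hpos)))
    obtain ⟨θ, hθ1, hθ2, hθ⟩ := (h1.and (h2.and self_mem_nhdsWithin)).exists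
    have h3 := zero_le_quot_add_infDist hφ hy₀ hmin v hθ
    rw [← hM] at h3
    have h4 := mul_lt_mul_of_pos_left hθ2 hpos
    rw [mul_add, mul_div_cancel₀ _ hpos.ne'] at h4
    simp only at hθ1 h4
    linarith
  obtain ⟨a, b, ha, hb, hab⟩ := exists_add_functional (K₁ := k) (K₂ := M)
    (N₁ := clarkeReal φ y₀) (N₂ := fun v => M * clarkeReal (fun y => Metric.infDist y C) y₀ v)
    (clarkeReal_le_norm hφ y₀)
    (fun v => by
      have := clarkeReal_le_norm hd y₀ v
      rw [NNReal.coe_one, one_mul] at this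
      exact mul_le_mul_of_nonneg_left this hpos.le)
    (clarkeReal_smul hφ y₀)
    (fun c hc v => by rw [clarkeReal_smul hd y₀ c hc]; ring)
    (clarkeReal_add_le hφ y₀)
    (fun v w => by
      rw [← mul_add]
      exact mul_le_mul_of_nonneg_left (clarkeReal_add_le hd y₀ v w) hpos.le)
    (-p) key
  refine ⟨a, (mem_clarkeSubdiff_iff hφ).2 ha, b, fun v hv => ?_, hab⟩
  have := hb v
  rwa [clarkeReal_infDist_eq_zero hv, mul_zero] at this

/-- The penalized inequality is needed only along rays from y₀, where the Gateaux derivative is the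
limit of the quotients of φ. The remainder -p - g can thus be tested directly on tangent directions,
without splitting. -/
theorem neg_mem_singleton_add_of_isMin (hφ : LipschitzWith k φ) (hy₀ : y₀ ∈ C)
    (hmin : ∀ v ∈ C, φ y₀ + p y₀ ≤ φ v + p v) {g : StrongDual ℝ E}
    (hg : HasGateauxDeriv (fun y => (φ y : EReal)) g y₀) :
    -p ∈ {g} + clarkeNormalCone C y₀ := by
  refine ⟨g, rfl, -p - g, fun v hv => ?_, add_sub_cancel _ _⟩
  have hd := lipschitzWith_infDist C
  set M : ℝ := k + ‖p‖ + 1 with hM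
  have hpos : 0 < M := by positivity
  rw [sub_apply, neg_apply]
  refine le_of_forall_pos_le_add fun ε hε => ?_
  have h1 : ∀ᶠ θ : ℝ in 𝓝[>] 0, (φ (y₀ + θ • v) - φ y₀) / θ < g v + ε / 2 := by
    have hlt : ((g v : ℝ) : EReal) < ((g v + ε / 2 : ℝ) : EReal) := by
      exact_mod_cast (by linarith : g v < g v + ε / 2)
    have := ((hg v).mono_left (nhdsWithin_mono 0 fun θ (hθ : 0 < θ) => hθ.ne')).eventually
      (gt_mem_nhds hlt)
    filter_upwards [this] with θ hθ
    rw [diffQuot_coe] at hθ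
    exact_mod_cast hθ
  have h2 := (tendsto_base y₀).eventually (eventually_lt_of_clarkeReal_lt hd (x := y₀) (v := v)
    (a := ε / 2 / M) (by rw [clarkeReal_infDist_eq_zero hv]; positivity))
  obtain ⟨θ, hθ1, hθ2, hθ⟩ := (h1.and (h2.and self_mem_nhdsWithin)).exists
  have h3 := zero_le_quot_add_infDist hφ hy₀ hmin v hθ
  rw [← hM] at h3
  have h4 := mul_lt_mul_of_pos_left hθ2 hpos
  rw [mul_div_cancel₀ _ hpos.ne'] at h4
  simp only at h4
  linarith

/-- Functionals dominated by the Clarke derivative of the distance are normal. If zero is the only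
normal, that derivative vanishes and the distance has strict derivative 0, uniformly over the unit
ball, which is compact here. Moving from an almost nearest point of C towards a nearby y outside C
would produce a quotient above 2/3. Conversely, the distance is locally zero at an interior point,
so all directions are tangent. -/
theorem normalCone_eq_zero_iff_mem_interior [FiniteDimensional ℝ E] (hC : IsClosed C)
    (hy₀ : y₀ ∈ C) : clarkeNormalCone C y₀ = {0} ↔ y₀ ∈ interior C := by
  have hd := lipschitzWith_infDist C
  constructor
  · intro hN
    have h0 : ∀ v, clarkeReal (fun y => Metric.infDist y C) y₀ v = (0 : StrongDual ℝ E) v := by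
      intro v
      obtain ⟨q, hq, hqv⟩ := exists_clarke_support hd y₀ v
      have : q ∈ clarkeNormalCone C y₀ := fun w hw =>
        (hq w).trans_eq (clarkeReal_infDist_eq_zero hw)
      rw [hN, mem_singleton_iff] at this
      rw [← hqv, this]
    have hev := eventually_forall_abs_quot_sub_lt hd h0
      (isCompact_closedBall (0 : E) 1) (ε := 1 / 2) (by norm_num)
    obtain ⟨U, hU, W, hW, hUW⟩ := mem_prod_iff.1 hev
    obtain ⟨r, hr, hrW⟩ := mem_nhdsGT_iff_exists_Ioo_subset.1 hW
    obtain ⟨δ, hδ, hδU⟩ := Metric.mem_nhds_iff.1 hU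
    rw [mem_interior_iff_mem_nhds, Metric.mem_nhds_iff]
    have hr' : 0 < r := hr
    refine ⟨min (δ / 4) (r / 4), by positivity, fun y hy => ?_⟩
    by_contra hyC
    have hdpos : 0 < Metric.infDist y C :=
      (hC.notMem_iff_infDist_pos ⟨y₀, hy₀⟩).1 hyC
    -- The factor 3/2 is below 2, so a quotient less than 1/2 would give d(y) < (3/4) d(y). The
    -- quarter radii leave room for c to lie in the δ-ball and the step in (0, r).
    obtain ⟨c, hcC, hc⟩ := (Metric.infDist_lt_iff (x := y) (r := 3 / 2 * Metric.infDist y C)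
      ⟨y₀, hy₀⟩).1 (by linarith)
    have hyy : Metric.infDist y C ≤ dist y y₀ := Metric.infDist_le_dist_of_mem hy₀
    have hyδ : dist y y₀ < δ / 4 := (Metric.mem_ball.1 hy).trans_le (min_le_left _ _)
    have hyr : dist y y₀ < r / 4 := (Metric.mem_ball.1 hy).trans_le (min_le_right _ _)
    have hne : 0 < dist y c := hdpos.trans_le (Metric.infDist_le_dist_of_mem hcC)
    have hcU : c ∈ U := hδU (by
      rw [Metric.mem_ball]
      have := dist_triangle c y y₀
      rw [dist_comm c y] at this
      linarith)
    have hW' : dist y c ∈ W := hrW ⟨hne, by linarith⟩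
    have hv : (dist y c)⁻¹ • (y - c) ∈ Metric.closedBall (0 : E) 1 := by
      rw [mem_closedBall_zero_iff, norm_smul, ← dist_eq_norm, Real.norm_eq_abs, abs_inv,
        abs_of_pos hne, inv_mul_cancel₀ hne.ne']
    have h := hUW (mk_mem_prod hcU hW') _ hv
    rw [smul_smul, mul_inv_cancel₀ hne.ne', one_smul, add_sub_cancel,
      Metric.infDist_zero_of_mem hcC, zero_apply, sub_zero, sub_zero,
      abs_of_pos (by positivity), div_lt_iff₀ hne] at h
    linarith
  · intro hint
    refine Subset.antisymm (fun p hp => ?_) (by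
      rintro _ rfl
      intro v _
      exact le_rfl)
    have hT : ∀ v, v ∈ clarkeTangentCone C y₀ := by
      intro v
      refine mem_tangentCone_of_clarkeReal_eq_zero ?_
      have hev : ∀ᶠ q : E × ℝ in 𝓝 y₀ ×ˢ 𝓝[>] (0 : ℝ),
          (Metric.infDist (q.1 + q.2 • v) C - Metric.infDist q.1 C) / q.2 = 0 := by
        have h1 : ∀ᶠ y in 𝓝 y₀, y ∈ C := mem_interior_iff_mem_nhds.1 hint
        have h2 : ∀ᶠ q : E × ℝ in 𝓝 y₀ ×ˢ 𝓝[>] (0 : ℝ), q.1 ∈ C :=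
          tendsto_fst.eventually h1
        filter_upwards [h2, (tendsto_shift y₀ v).eventually h2] with q hq1 hq2
        rw [Metric.infDist_zero_of_mem hq1, Metric.infDist_zero_of_mem hq2, sub_zero, zero_div]
      exact le_antisymm (clarkeReal_le_of_eventually hd (hev.mono fun q hq => hq.le))
        (le_clarkeReal_of_frequently hd (hev.mono fun q hq => hq.ge).frequently)
    rw [mem_singleton_iff]
    ext v
    have h1 := hp v (hT v)
    have h2 := hp (-v) (hT (-v))
    rw [map_neg] at h2
    rw [zero_apply]
    linarith

end Minimum

/-- Consequences of the inequality `f⁻(x; y₀ - v) ≤ φ v - φ y₀`, `v ∈ C`. -/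
theorem subdiff_of_lowerDeriv_le {f φ : E → ℝ} {K k : ℝ≥0} (hf : LipschitzWith K f)
    (hφ : LipschitzWith k φ) {C : Set E} (hC : IsClosed C) {x y₀ : E} (hy₀ : y₀ ∈ C)
    (h : ∀ v ∈ C, lowerDeriv (fun y => (f y : EReal)) x (y₀ - v) ≤ (φ v : EReal) - (φ y₀ : EReal)) :
    -gateauxSubdiff (fun y => (f y : EReal)) x ⊆
        clarkeSubdiff (fun y => (φ y : EReal)) y₀ + clarkeNormalCone C y₀ ∧
      (∀ g : StrongDual ℝ E, HasGateauxDeriv (fun y => (φ y : EReal)) g y₀ →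
        -gateauxSubdiff (fun y => (f y : EReal)) x ⊆ {g} + clarkeNormalCone C y₀ ∧
        ((gateauxSubdiff (fun y => (f y : EReal)) x).Nonempty →
          clarkeNormalCone C y₀ = {0} →
            -gateauxSubdiff (fun y => (f y : EReal)) x = {g} ∧
            (∃ p, gateauxSubdiff (fun y => (f y : EReal)) x = {p}) ∧
            (IsRegularAt (fun y => (f y : EReal)) x →
              ∃ p, HasStrictDeriv (fun y => (f y : EReal)) p x))) ∧
      (FiniteDimensional ℝ E → (clarkeNormalCone C y₀ = {0} ↔ y₀ ∈ interior C)) ∧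
      (IsConvexFun (fun y => (f y : EReal)) → IsRegularAt (fun y => (f y : EReal)) x) := by
  -- Testing the subgradient p in direction y₀ - v turns the hypothesis into minimality of y₀ for φ
  -- + p over C.
  have hmin : ∀ p ∈ gateauxSubdiff (fun y => (f y : EReal)) x,
      ∀ v ∈ C, φ y₀ + p y₀ ≤ φ v + p v := by
    intro p hp v hv
    have h1 := (hp (y₀ - v)).trans (h v hv)
    rw [← EReal.coe_sub, EReal.coe_le_coe_iff, map_sub] at h1
    linarith
  refine ⟨fun q hq => ?_, fun g hg => ?_, fun _ => normalCone_eq_zero_iff_mem_interior hC hy₀,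
    fun hconv => isRegularAt_of_isConvexFun hf hconv x⟩
  · have := neg_mem_add_of_isMin hφ hy₀ (hmin _ (mem_neg.1 hq))
    rwa [neg_neg] at this
  · have hsub : -gateauxSubdiff (fun y => (f y : EReal)) x ⊆ {g} + clarkeNormalCone C y₀ := by
      intro q hq
      have := neg_mem_singleton_add_of_isMin hφ hy₀ (hmin _ (mem_neg.1 hq)) hg
      rwa [neg_neg] at this
    refine ⟨hsub, fun hne hN => ?_⟩
    have heq : -gateauxSubdiff (fun y => (f y : EReal)) x = {g} := by
      rw [hN, singleton_add_singleton, add_zero] at hsub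
      exact (subset_singleton_iff_eq.1 hsub).resolve_left (nonempty_neg.2 hne).ne_empty
    have hsing : gateauxSubdiff (fun y => (f y : EReal)) x = {-g} := by
      rw [← neg_neg (gateauxSubdiff (fun y => (f y : EReal)) x), heq, neg_singleton]
    exact ⟨heq, ⟨_, hsing⟩, fun hreg => ⟨_, exists_hasStrictDeriv_of_isRegularAt hf hreg hsing⟩⟩

end Nonsmooth

/-! ### Integral inequalities -/

/-- Integrability on all bounded intervals. -/
abbrev LocInt {F : Type*} [NormedAddCommGroup F] (f : ℝ → F) : Prop :=
  ∀ a b : ℝ, IntervalIntegrable f volume a b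

theorem LocInt.locallyIntegrable {F : Type*} [NormedAddCommGroup F] {f : ℝ → F} (hf : LocInt f) :
    LocallyIntegrable f := by
  intro x
  refine ⟨Ioo (x - 1) (x + 1), Ioo_mem_nhds (by linarith) (by linarith), ?_⟩
  have := (intervalIntegrable_iff_integrableOn_Ioc_of_le (by linarith)).1 (hf (x - 1) (x + 1))
  exact this.mono_set Ioo_subset_Ioc_self

theorem LocInt.continuous_primitive {F : Type*} [NormedAddCommGroup F] [NormedSpace ℝ F]
    {f : ℝ → F} (hf : LocInt f) (a : ℝ) : Continuous fun s => ∫ τ in a..s, f τ :=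
  intervalIntegral.continuous_primitive hf a

theorem locInt_of_abs_le {F : Type*} [NormedAddCommGroup F] {f : ℝ → F} {g : ℝ → ℝ}
    (hf : AEStronglyMeasurable f) (hg : LocInt g) (h : ∀ᵐ s, ‖f s‖ ≤ g s) : LocInt f := by
  intro a b
  refine (hg a b).mono_fun hf.restrict (ae_restrict_of_ae ?_)
  filter_upwards [h] with s hs using hs.trans (le_abs_self _)

theorem monotoneOn_primitive {q : ℝ → ℝ} (hq : LocInt q) (hq0 : ∀ s, 0 ≤ q s) (a : ℝ) :
    Monotone fun s => ∫ τ in a..s, q τ := by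
  intro s t hst
  have h1 := intervalIntegral.integral_add_adjacent_intervals (hq a s) (hq s t)
  have h2 := intervalIntegral.integral_nonneg (μ := volume) hst fun u _ => hq0 u
  simp only
  linarith

/-- The right-hand side M, as a function of the endpoint, satisfies M' ≥ γM + q almost everywhere,
since the exponential factor on q is at least 1. Monotonicity of M already gives that the integral
of M' is at most its increment, so absolute continuity is not needed. The inequality serves both
Gronwall's lemma and the induction in Filippov's theorem. -/
theorem exp_mul_primitive_supersolution {γ q : ℝ → ℝ} (hγ : LocInt γ) (hq : LocInt q)
    (hγ0 : ∀ s, 0 ≤ γ s) (hq0 : ∀ s, 0 ≤ q s) {δ : ℝ} (hδ : 0 ≤ δ) {a b : ℝ} (hab : a ≤ b) :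
    δ + ∫ s in a..b, (γ s * (Real.exp (∫ τ in a..s, γ τ) * (δ + ∫ τ in a..s, q τ)) + q s) ≤
      Real.exp (∫ τ in a..b, γ τ) * (δ + ∫ τ in a..b, q τ) := by
  set G : ℝ → ℝ := fun s => ∫ τ in a..s, γ τ with hG
  set P : ℝ → ℝ := fun s => ∫ τ in a..s, q τ with hP
  have hGm : Monotone G := monotoneOn_primitive hγ hγ0 a
  have hPm : Monotone P := monotoneOn_primitive hq hq0 a
  have hGa : G a = 0 := intervalIntegral.integral_same
  have hPa : P a = 0 := intervalIntegral.integral_same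
  have hGc : Continuous G := hγ.continuous_primitive a
  have hPc : Continuous P := hq.continuous_primitive a
  set M : ℝ → ℝ := fun s => Real.exp (G s) * (δ + P s) with hM
  have hP0 : ∀ s ∈ Icc a b, 0 ≤ P s := fun s hs => hPa ▸ hPm hs.1
  have hG0 : ∀ s ∈ Icc a b, 0 ≤ G s := fun s hs => hGa ▸ hGm hs.1
  have hMm : MonotoneOn M (uIcc a b) := by
    rw [uIcc_of_le hab]
    intro s hs t ht hst
    have h1 := hP0 s hs
    have h2 := hPm hst
    exact mul_le_mul (Real.exp_le_exp.2 (hGm hst)) (by linarith) (by linarith) (Real.exp_pos _).le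
  have h1 : ∫ s in a..b, deriv M s ≤ M b - M a := by
    have := hMm.intervalIntegral_deriv_mem_uIcc
    rw [uIcc_of_le (sub_nonneg.2 (hMm left_mem_uIcc right_mem_uIcc hab))] at this
    exact this.2
  have hMa : M a = δ := by simp [hM, hGa, hPa]
  have hMc : Continuous M := by fun_prop
  have h2 : ∫ s in a..b, (γ s * M s + q s) ≤ ∫ s in a..b, deriv M s := by
    refine intervalIntegral.integral_mono_ae_restrict hab
      (((hγ a b).mul_continuousOn hMc.continuousOn).add (hq a b)) hMm.intervalIntegrable_deriv ?_
    rw [EventuallyLE, ae_restrict_iff' measurableSet_Icc]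
    filter_upwards [_root_.LocallyIntegrable.ae_hasDerivAt_integral hγ.locallyIntegrable,
      _root_.LocallyIntegrable.ae_hasDerivAt_integral hq.locallyIntegrable] with s hs1 hs2 hs
    have hd : HasDerivAt M (Real.exp (G s) * γ s * (δ + P s) + Real.exp (G s) * q s) s :=
      ((hs1 a).exp).mul ((hs2 a).const_add δ)
    rw [hd.deriv]
    have h3 : 1 ≤ Real.exp (G s) := Real.one_le_exp (hG0 s hs)
    have h4 := mul_le_mul_of_nonneg_right h3 (hq0 s)
    have e : γ s * M s = Real.exp (G s) * γ s * (δ + P s) := by simp only [hM]; ring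
    linarith
  change δ + ∫ s in a..b, (γ s * M s + q s) ≤ M b
  linarith

/-- Subtracting the supersolution M leaves φ = u - M with φ(s) ≤ ∫ γφ. A maximum argument with an
exponential weight then forces φ ≤ 0. -/
theorem gronwall_integral {γ q u : ℝ → ℝ} (hγ : LocInt γ) (hq : LocInt q)
    (hγ0 : ∀ s, 0 ≤ γ s) (hq0 : ∀ s, 0 ≤ q s) {δ : ℝ} (hδ : 0 ≤ δ) {a b : ℝ} (hab : a ≤ b)
    (hu : Continuous u) (h : ∀ s ∈ Icc a b, u s ≤ δ + ∫ τ in a..s, (γ τ * u τ + q τ)) :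
    u b ≤ Real.exp (∫ τ in a..b, γ τ) * (δ + ∫ τ in a..b, q τ) := by
  set G : ℝ → ℝ := fun s => ∫ τ in a..s, γ τ with hG
  set M : ℝ → ℝ := fun s => Real.exp (G s) * (δ + ∫ τ in a..s, q τ) with hM
  have hGc : Continuous G := hγ.continuous_primitive a
  have hMc : Continuous M := by
    have := hq.continuous_primitive a
    fun_prop
  set φ : ℝ → ℝ := fun s => u s - M s with hφ
  have hφc : Continuous φ := hu.sub hMc
  have hφle : ∀ s ∈ Icc a b, φ s ≤ ∫ τ in a..s, γ τ * φ τ := by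
    intro s hs
    have h1 := h s hs
    have h2 : δ + ∫ τ in a..s, (γ τ * M τ + q τ) ≤ M s :=
      exp_mul_primitive_supersolution hγ hq hγ0 hq0 hδ hs.1
    have h3 : ∫ τ in a..s, γ τ * φ τ =
        (∫ τ in a..s, (γ τ * u τ + q τ)) - ∫ τ in a..s, (γ τ * M τ + q τ) := by
      rw [← intervalIntegral.integral_sub
        (((hγ a s).mul_continuousOn hu.continuousOn).add (hq a s))
        (((hγ a s).mul_continuousOn hMc.continuousOn).add (hq a s))]
      refine intervalIntegral.integral_congr fun τ _ => ?_
      simp only [hφ]; ring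
    rw [h3]; simp only [hφ]; linarith
  -- The factor 2 gains a contraction: at a positive maximum z the integral inequality would give
  -- ψ(z) exp(2G(z)) ≤ (ψ(z)/2)(exp(2G(z)) - 1), which is impossible.
  set ψ : ℝ → ℝ := fun s => φ s * Real.exp (-(2 * G s)) with hψ
  have hψc : Continuous ψ := by fun_prop
  obtain ⟨z, hz, hmax⟩ := isCompact_Icc.exists_isMaxOn (nonempty_Icc.2 hab) hψc.continuousOn
  have hφψ : ∀ s, φ s = ψ s * Real.exp (2 * G s) := by
    intro s
    simp only [hψ]
    rw [mul_assoc, ← Real.exp_add, neg_add_cancel, Real.exp_zero, mul_one]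
  have hm : ψ z ≤ 0 := by
    by_contra! hpos
    have hγ2 : LocInt fun s => 2 * γ s := fun a b => (hγ a b).const_mul 2
    have h0 : LocInt fun _ : ℝ => (0 : ℝ) := fun a b => intervalIntegrable_const
    have h1 := exp_mul_primitive_supersolution hγ2 h0 (fun s => by have := hγ0 s; positivity)
      (fun _ => le_rfl) zero_le_one hz.1
    simp only [intervalIntegral.integral_const_mul, intervalIntegral.integral_zero, add_zero,
      mul_one] at h1
    have h2 : ∫ τ in a..z, γ τ * φ τ ≤ ∫ τ in a..z, ψ z / 2 * (2 * γ τ * Real.exp (2 * G τ)) := by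
      refine intervalIntegral.integral_mono_on hz.1 ((hγ a z).mul_continuousOn hφc.continuousOn)
        (((hγ2 a z).mul_continuousOn (by fun_prop)).const_mul _) fun τ hτ => ?_
      have h3 : ψ τ ≤ ψ z := hmax ⟨hτ.1, hτ.2.trans hz.2⟩
      rw [hφψ τ]
      have h4 := mul_le_mul_of_nonneg_left h3 (mul_nonneg (hγ0 τ) (Real.exp_pos (2 * G τ)).le)
      linarith
    rw [intervalIntegral.integral_const_mul] at h2
    have h5 := hφle z hz
    rw [hφψ z] at h5
    have h6 : ψ z / 2 * ∫ τ in a..z, 2 * γ τ * Real.exp (2 * G τ) ≤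
        ψ z / 2 * (Real.exp (2 * G z) - 1) :=
      mul_le_mul_of_nonneg_left (by simp only [hG]; linarith) (by linarith)
    have h7 := Real.exp_pos (2 * G z)
    nlinarith
  have h1 : ψ b ≤ 0 := (hmax ⟨hab, le_rfl⟩ : ψ b ≤ ψ z).trans hm
  have h2 : φ b ≤ 0 := by
    rw [hφψ b]
    exact mul_nonpos_of_nonpos_of_nonneg h1 (Real.exp_pos _).le
  exact sub_nonpos.1 h2

/-! ### Measurable selections -/

section Selection

variable {E : Type*} [NormedAddCommGroup E] [MeasurableSpace E] [BorelSpace E]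
  [SecondCountableTopology E] {Ω : Type*} [MeasurableSpace Ω] {F : Ω → Set E}

theorem measurable_infDist_comp (hF : ∀ y, Measurable fun ω => Metric.infDist y (F ω)) {w : Ω → E}
    (hw : Measurable w) : Measurable fun ω => Metric.infDist (w ω) (F ω) := by
  have h : Measurable (Function.uncurry fun (y : E) (ω : Ω) => Metric.infDist y (F ω)) :=
    measurable_uncurry_of_continuous_of_measurable (fun ω => Metric.continuous_infDist_pt _) hF
  have h2 : Measurable fun ω => (w ω, ω) := hw.prodMk measurable_id
  have h3 := h.comp h2
  simpa only [Function.comp_def, Function.uncurry_apply_pair] using h3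

/-- A countable dense set approximates an almost nearest point of F ω; choosing the first index that
works keeps the choice measurable. -/
theorem exists_measurable_near_step (hne : ∀ ω, (F ω).Nonempty)
    (hF : ∀ y, Measurable fun ω => Metric.infDist y (F ω)) {w : Ω → E} (hw : Measurable w)
    {r : Ω → ℝ} (hr : Measurable r) (hr0 : ∀ ω, 0 < r ω) :
    ∃ w' : Ω → E, Measurable w' ∧ ∀ ω,
      dist (w ω) (w' ω) < Metric.infDist (w ω) (F ω) + r ω ∧
        Metric.infDist (w' ω) (F ω) < r ω := by
  classical
  let e : ℕ → E := TopologicalSpace.denseSeq E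
  let p : ℕ → Ω → Prop := fun n ω => dist (w ω) (e n) < Metric.infDist (w ω) (F ω) + r ω ∧
        Metric.infDist (e n) (F ω) < r ω
  have hex : ∀ ω, ∃ n, p n ω := by
    intro ω
    obtain ⟨f, hf, hdf⟩ := (Metric.infDist_lt_iff (x := w ω)
      (r := Metric.infDist (w ω) (F ω) + r ω / 2) (hne ω)).1 (by linarith [hr0 ω])
    obtain ⟨n, hn⟩ := (TopologicalSpace.denseRange_denseSeq E).exists_dist_lt f
      (half_pos (hr0 ω))
    refine ⟨n, ?_, ?_⟩
    · have := dist_triangle (w ω) f (e n)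
      linarith
    · have := Metric.infDist_le_dist_of_mem (x := e n) hf
      rw [dist_comm] at this
      linarith [hr0 ω]
  have hmeas : ∀ n, MeasurableSet {ω | p n ω} := fun n =>
    (measurableSet_lt (hw.dist measurable_const) ((measurable_infDist_comp hF hw).add hr)).inter
      (measurableSet_lt (hF _) hr)
  exact ⟨fun ω => e (Nat.find (hex ω)), Measurable.find (f := fun n _ => e n)
    (fun n => measurable_const) hmeas hex, fun ω => Nat.find_spec (hex ω)⟩

/-- A measurable closed-valued multifunction has a measurable selection which is almost nearest
to a given measurable function. -/
theorem exists_measurable_selection [CompleteSpace E] (hne : ∀ ω, (F ω).Nonempty)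
    (hcl : ∀ ω, IsClosed (F ω)) (hF : ∀ y, Measurable fun ω => Metric.infDist y (F ω))
    {w : Ω → E} (hw : Measurable w) {ε : Ω → ℝ} (hε : Measurable ε) (hε0 : ∀ ω, 0 < ε ω) :
    ∃ u : Ω → E, Measurable u ∧ ∀ ω, u ω ∈ F ω ∧
      ‖u ω - w ω‖ ≤ Metric.infDist (w ω) (F ω) + ε ω := by
  -- With tolerances ε / 2^(n+3), the first move costs the distance plus ε/8 and all later moves
  -- together at most 3ε/8, below the allowed ε.
  have hstep : ∀ (n : ℕ) (v : {v : Ω → E // Measurable v}), ∃ v' : {v : Ω → E // Measurable v},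
      ∀ ω, dist (v.1 ω) (v'.1 ω) < Metric.infDist (v.1 ω) (F ω) + ε ω * (1 / 2) ^ (n + 3) ∧
        Metric.infDist (v'.1 ω) (F ω) < ε ω * (1 / 2) ^ (n + 3) := by
    intro n v
    obtain ⟨v', hv', h⟩ := exists_measurable_near_step hne hF v.2
      (hε.mul_const ((1 / 2) ^ (n + 3))) fun ω => by have := hε0 ω; positivity
    exact ⟨⟨v', hv'⟩, h⟩
  choose S hS using hstep
  let W : ℕ → {v : Ω → E // Measurable v} := fun n => Nat.rec (S 0 ⟨w, hw⟩) (fun n v => S (n + 1) v) n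
  have hW0 : W 0 = S 0 ⟨w, hw⟩ := rfl
  have hWs : ∀ n, W (n + 1) = S (n + 1) (W n) := fun n => rfl
  have hnear : ∀ n ω, Metric.infDist ((W n).1 ω) (F ω) < ε ω * (1 / 2) ^ (n + 3) := by
    intro n ω
    cases n with
    | zero => exact (hS 0 _ ω).2
    | succ n => rw [hWs]; exact (hS (n + 1) _ ω).2
  have hdist : ∀ ω n, dist ((W n).1 ω) ((W (n + 1)).1 ω) ≤ (3 / 8 * ε ω) / 2 / 2 ^ n := by
    intro ω n
    have h1 := (hS (n + 1) (W n) ω).1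
    rw [← hWs] at h1
    have h2 := hnear n ω
    have e1 : ε ω * (1 / 2) ^ (n + 3) + ε ω * (1 / 2) ^ (n + 1 + 3) = (3 / 8 * ε ω) / 2 / 2 ^ n := by
      rw [one_div, inv_pow, inv_pow]; field_simp; ring
    linarith
  have hcau : ∀ ω, CauchySeq fun n => (W n).1 ω := fun ω => cauchySeq_of_le_geometric_two (hdist ω)
  choose u hu using fun ω => cauchySeq_tendsto_of_complete (hcau ω)
  refine ⟨u, measurable_of_tendsto_metrizable (fun n => (W n).2) (tendsto_pi_nhds.2 hu),
    fun ω => ⟨?_, ?_⟩⟩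
  · rw [(hcl ω).mem_iff_infDist_zero (hne ω)]
    have h1 : Tendsto (fun n => Metric.infDist ((W n).1 ω) (F ω)) atTop
        (𝓝 (Metric.infDist (u ω) (F ω))) :=
      ((Metric.continuous_infDist_pt _).tendsto _).comp (hu ω)
    have h2 : Tendsto (fun n : ℕ => ε ω * (1 / 2) ^ (n + 3)) atTop (𝓝 (ε ω * 0)) :=
      ((tendsto_add_atTop_iff_nat 3).2
        (tendsto_pow_atTop_nhds_zero_of_lt_one (by norm_num) (by norm_num))).const_mul _
    rw [mul_zero] at h2
    exact le_antisymm (le_of_tendsto_of_tendsto' h1 h2 fun n => (hnear n ω).le)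
      Metric.infDist_nonneg
  · have h1 := dist_le_of_le_geometric_two_of_tendsto₀ (hdist ω) (hu ω)
    have h2 := (hS 0 ⟨w, hw⟩ ω).1
    rw [← hW0] at h2
    simp only at h2
    have h3 := dist_triangle (w ω) ((W 0).1 ω) (u ω)
    rw [dist_comm (w ω) (u ω), dist_eq_norm] at h3
    have := hε0 ω
    norm_num at h2
    linarith

end Selection

/-! ### Arcs -/

section Arcs

theorem LocInt.indicator {F : Type*} [NormedAddCommGroup F] {f : ℝ → F} (hf : LocInt f)
    {s : Set ℝ} (hs : MeasurableSet s) : LocInt (s.indicator f) :=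
  fun a b => ⟨(hf a b).1.indicator hs, (hf a b).2.indicator hs⟩

theorem locInt_indicator_Ici {F : Type*} [NormedAddCommGroup F] {f : ℝ → F}
    (hf : LocallyIntegrableOn f (Ici (0 : ℝ))) : LocInt ((Ici (0 : ℝ)).indicator f) := by
  intro a b
  have h : IntegrableOn f (uIcc a b ∩ Ici 0) :=
    hf.integrableOn_compact_subset inter_subset_right (isCompact_uIcc.inter_right isClosed_Ici)
  refine intervalIntegrable_iff.2 ?_
  rw [IntegrableOn, integrable_indicator_iff measurableSet_Ici, IntegrableOn,
    Measure.restrict_restrict measurableSet_Ici]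
  exact h.mono_set fun s hs => ⟨uIoc_subset_uIcc hs.2, hs.1⟩

variable {E : Type*} [NormedAddCommGroup E] [NormedSpace ℝ E]

/-- The derivative of an arc, extended by zero to negative times. -/
noncomputable def velocity (x : ℝ → E) : ℝ → E := (Ici (0 : ℝ)).indicator (deriv x)

theorem velocity_of_nonneg (x : ℝ → E) {s : ℝ} (hs : 0 ≤ s) : velocity x s = deriv x s :=
  indicator_of_mem (mem_Ici.2 hs) _

theorem IsArc.locInt_velocity {x : ℝ → E} (hx : IsArc x) : LocInt (velocity x) :=
  locInt_indicator_Ici hx.deriv_locallyIntegrable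

theorem IsArc.eq_add_integral {x : ℝ → E} (hx : IsArc x) {a s : ℝ} (ha : 0 ≤ a) (hs : 0 ≤ s) :
    x s = x a + ∫ τ in a..s, velocity x τ := by
  have h : ∀ t, 0 ≤ t → x t = (∫ τ in (0 : ℝ)..t, velocity x τ) + x 0 := by
    intro t ht
    rw [hx.eq_integral t ht]
    congr 1
    refine intervalIntegral.integral_congr fun τ hτ => ?_
    rw [uIcc_of_le ht] at hτ
    exact (velocity_of_nonneg x hτ.1).symm
  have hv := hx.locInt_velocity
  rw [h s hs, h a ha, ← intervalIntegral.integral_add_adjacent_intervals (hv 0 a) (hv a s)]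
  abel

/-- Lebesgue differentiation of the primitive. As y is prescribed only for s ≥ 0, the derivative is
identified at s > 0; the endpoint is null. -/
theorem isArc_of_primitive [CompleteSpace E] {u : ℝ → E} (hu : LocInt u) {y : ℝ → E} {a : ℝ}
    {ξ : E} (hy : ∀ s, 0 ≤ s → y s = ξ + ∫ τ in a..s, u τ) :
    IsArc y ∧ ∀ᵐ s ∂volume.restrict (Ici (0 : ℝ)), deriv y s = u s := by
  have hd : ∀ᵐ s ∂volume.restrict (Ioi (0 : ℝ)), HasDerivAt y (u s) s := by
    rw [ae_restrict_iff' measurableSet_Ioi]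
    filter_upwards [_root_.LocallyIntegrable.ae_hasDerivAt_integral hu.locallyIntegrable]
      with s hs hs0
    refine ((hs a).const_add ξ).congr_of_eventuallyEq ?_
    filter_upwards [Ioi_mem_nhds hs0] with τ hτ using hy τ (le_of_lt hτ)
  have hd' : ∀ᵐ s ∂volume.restrict (Ici (0 : ℝ)), deriv y s = u s := by
    rw [restrict_Ioi_eq_restrict_Ici.symm]
    filter_upwards [hd] with s hs using hs.deriv
  have hcont : ContinuousOn y (Ici 0) :=
    ((continuous_const.add (hu.continuous_primitive a)).continuousOn).congr hy
  refine ⟨⟨hcont.locallyIntegrableOn measurableSet_Ici, ?_, ?_, ?_⟩, hd'⟩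
  · filter_upwards [hd] with s hs using hs.differentiableAt
  · rw [locallyIntegrableOn_iff isClosed_Ici.isLocallyClosed]
    intro k hk hkc
    refine (hu.locallyIntegrable.integrableOn_isCompact hkc).congr_fun_ae ?_
    filter_upwards [ae_restrict_of_ae_restrict_of_subset hk hd'] with s hs using hs.symm
  · intro t ht
    have h1 : ∫ s in (0 : ℝ)..t, deriv y s = ∫ s in (0 : ℝ)..t, u s := by
      refine intervalIntegral.integral_congr_ae ?_
      rw [ae_restrict_iff' measurableSet_Ici] at hd'
      filter_upwards [hd'] with s hs hst
      rw [uIoc_of_le ht] at hst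
      exact hs hst.1.le
    rw [h1, hy t ht, hy 0 le_rfl,
      ← intervalIntegral.integral_add_adjacent_intervals (hu a 0) (hu 0 t)]
    abel

/-- Concatenation of two arcs. -/
theorem IsArc.concat [CompleteSpace E] {x z : ℝ → E} (hx : IsArc x) (hz : IsArc z) {r : ℝ}
    (hr : 0 ≤ r) (hxz : x r = z r) :
    IsArc (fun s => if s ≤ r then x s else z s) ∧
    ∀ᵐ s ∂volume.restrict (Ici (0 : ℝ)), deriv (fun s => if s ≤ r then x s else z s) s =
      if s ≤ r then deriv x s else deriv z s := by
  have hvx := hx.locInt_velocity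
  have hvz := hz.locInt_velocity
  -- The concatenation is the primitive, based at r, of the glued velocities.
  set u : ℝ → E := fun s => (Iic r).indicator (velocity x) s + (Ioi r).indicator (velocity z) s
    with hu
  have huL : LocInt u := fun a b =>
    (hvx.indicator measurableSet_Iic a b).add (hvz.indicator measurableSet_Ioi a b)
  have hux : ∀ s, s ≤ r → u s = velocity x s := by
    intro s hs
    simp [hu, hs]
  have huz : ∀ s, r < s → u s = velocity z s := by
    intro s hs
    simp [hu, hs]
  obtain ⟨h1, h2⟩ := isArc_of_primitive (y := fun s => if s ≤ r then x s else z s) (ξ := x r) huL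
    (by
      intro s hs
      by_cases hsr : s ≤ r
      · simp only [hsr, if_true]
        rw [hx.eq_add_integral hr hs]
        congr 1
        refine intervalIntegral.integral_congr_ae (Eventually.of_forall fun τ hτ => (hux τ ?_).symm)
        rw [uIoc_of_ge hsr] at hτ
        exact hτ.2
      · simp only [hsr, if_false]
        push Not at hsr
        rw [hz.eq_add_integral hr hs, hxz]
        congr 1
        refine intervalIntegral.integral_congr_ae (Eventually.of_forall fun τ hτ => (huz τ ?_).symm)
        rw [uIoc_of_le hsr.le] at hτ
        exact hτ.1)
  refine ⟨h1, ?_⟩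
  filter_upwards [h2, ae_restrict_mem measurableSet_Ici] with s hs hs0
  rw [hs]
  split_ifs with hsr
  · rw [hux s hsr, velocity_of_nonneg x hs0]
  · rw [huz s (not_le.1 hsr), velocity_of_nonneg z hs0]

end Arcs

/-! ### Differential inclusions -/

section Inclusion

variable {E : Type*} [NormedAddCommGroup E]

/-- A measurable multifunction with closed values, Lipschitz in the state, of linear growth. -/
structure IsVelocityField (F : ℝ → E → Set E) (γ₀ γ₁ : ℝ → ℝ) : Prop where
  nonempty : ∀ s x, (F s x).Nonempty
  closed : ∀ s x, IsClosed (F s x)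
  measurable : ∀ x y, Measurable fun s => Metric.infDist y (F s x)
  nonneg₀ : ∀ s, 0 ≤ γ₀ s
  nonneg₁ : ∀ s, 0 ≤ γ₁ s
  locInt₀ : LocInt γ₀
  locInt₁ : LocInt γ₁
  bound : ∀ s, ∀ v ∈ F s 0, ‖v‖ ≤ γ₀ s
  lip : ∀ s x x', ∀ v ∈ F s x, Metric.infDist v (F s x') ≤ γ₁ s * ‖x - x'‖

namespace IsVelocityField

variable {F : ℝ → E → Set E} {γ₀ γ₁ : ℝ → ℝ} (h : IsVelocityField F γ₀ γ₁)

include h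

theorem norm_le {s : ℝ} {x v : E} (hv : v ∈ F s x) : ‖v‖ ≤ γ₀ s + γ₁ s * ‖x‖ := by
  refine le_of_forall_pos_le_add fun ε hε => ?_
  obtain ⟨w, hw, hd⟩ := (Metric.infDist_lt_iff (x := v) (r := γ₁ s * ‖x - 0‖ + ε)
    (h.nonempty s 0)).1 ((h.lip s x 0 v hv).trans_lt (by linarith))
  have h1 := h.bound s w hw
  have h2 := norm_le_norm_add_norm_sub' v w
  rw [dist_eq_norm, sub_zero] at hd
  linarith

theorem infDist_le (s : ℝ) (x x' y : E) :
    Metric.infDist y (F s x) ≤ Metric.infDist y (F s x') + γ₁ s * ‖x - x'‖ := by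
  refine le_of_forall_pos_le_add fun ε hε => ?_
  obtain ⟨w, hw, hd⟩ := (Metric.infDist_lt_iff (x := y) (r := Metric.infDist y (F s x') + ε)
    (h.nonempty s x')).1 (by linarith)
  have h1 := h.lip s x' x w hw
  have h2 := Metric.infDist_le_infDist_add_dist (s := F s x) (x := y) (y := w)
  rw [norm_sub_rev] at h1
  linarith

theorem continuous_infDist (s : ℝ) (y : E) : Continuous fun x => Metric.infDist y (F s x) := by
  refine (LipschitzWith.of_dist_le_mul (K := ⟨γ₁ s, h.nonneg₁ s⟩) fun x x' => ?_).continuous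
  have h1 := h.infDist_le s x x' y
  have h2 := h.infDist_le s x' x y
  rw [norm_sub_rev] at h2
  rw [Real.dist_eq, abs_le, dist_eq_norm]
  change -(γ₁ s * ‖x - x'‖) ≤ _ ∧ _ ≤ γ₁ s * ‖x - x'‖
  constructor <;> linarith

theorem measurable_infDist_along [MeasurableSpace E] [BorelSpace E] [SecondCountableTopology E]
    {x : ℝ → E} (hx : Measurable x) (y : E) :
    Measurable fun s => Metric.infDist y (F s (x s)) := by
  have h1 : Measurable (Function.uncurry fun (z : E) (s : ℝ) => Metric.infDist y (F s z)) :=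
    measurable_uncurry_of_continuous_of_measurable (fun s => h.continuous_infDist s y)
      fun z => h.measurable z y
  have h2 := h1.comp (hx.prodMk measurable_id)
  simpa only [Function.comp_def, Function.uncurry_apply_pair, id_eq] using h2

end IsVelocityField

end Inclusion

/-! ### Filippov's existence theorem -/

section Filippov

variable {E : Type*} [NormedAddCommGroup E] [NormedSpace ℝ E] [CompleteSpace E]
  [MeasurableSpace E] [BorelSpace E] [SecondCountableTopology E]
  {F : ℝ → E → Set E} {γ₀ γ₁ : ℝ → ℝ}

/-- One step of the iteration in Filippov's theorem. -/
theorem IsVelocityField.exists_next (h : IsVelocityField F γ₀ γ₁) {u : ℝ → E} (hu : LocInt u)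
    (a : ℝ) (c : E) {ε : ℝ → ℝ} (hε : Measurable ε) (hε0 : ∀ s, 0 < ε s) (hum : Measurable u) :
    ∃ u' : ℝ → E, Measurable u' ∧ LocInt u' ∧
      ∀ s, a ≤ s → u' s ∈ F s (c + ∫ τ in a..s, u τ) ∧
        ‖u' s - u s‖ ≤ Metric.infDist (u s) (F s (c + ∫ τ in a..s, u τ)) + ε s := by
  have hX : Continuous fun s => c + ∫ τ in a..s, u τ :=
    continuous_const.add (hu.continuous_primitive a)
  obtain ⟨w, hwm, hw⟩ := exists_measurable_selection
    (F := fun s => F s (c + ∫ τ in a..s, u τ)) (fun s => h.nonempty _ _) (fun s => h.closed _ _)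
    (fun y => h.measurable_infDist_along hX.measurable y) hum hε hε0
  refine ⟨(Ici a).indicator w, hwm.indicator measurableSet_Ici, ?_, fun s hs => ?_⟩
  · refine locInt_of_abs_le (g := fun s => γ₀ s + γ₁ s * ‖c + ∫ τ in a..s, u τ‖)
      (hwm.indicator measurableSet_Ici).aestronglyMeasurable
      (fun b d => (h.locInt₀ b d).add ((h.locInt₁ b d).mul_continuousOn hX.norm.continuousOn))
      (Eventually.of_forall fun s => ?_)
    have h0 := h.nonneg₀ s
    have h1 := h.nonneg₁ s
    by_cases hs : s ∈ Ici a
    · rw [indicator_of_mem hs]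
      exact h.norm_le (hw s).1
    · rw [indicator_of_notMem hs, norm_zero]
      positivity
  · rw [indicator_of_mem (mem_Ici.2 hs)]
    exact hw s

/-- **Filippov's theorem**: near any arc there is a trajectory of the differential inclusion, with
the usual exponential estimates. -/
theorem IsVelocityField.filippov (h : IsVelocityField F γ₀ γ₁) {u₀ : ℝ → E} (hu₀ : LocInt u₀)
    (hu₀m : Measurable u₀) (a : ℝ) (η ξ : E) {ρ ε : ℝ → ℝ} (hρ : LocInt ρ) (hρ0 : ∀ s, 0 ≤ ρ s)
    (hε : Measurable ε) (hε0 : ∀ s, 0 < ε s)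
    (hd : ∀ᵐ s, a ≤ s → Metric.infDist (u₀ s) (F s (η + ∫ τ in a..s, u₀ τ)) + ε s ≤ ρ s) :
    ∃ u : ℝ → E, LocInt u ∧ (∀ s, a ≤ s → u s ∈ F s (ξ + ∫ τ in a..s, u τ)) ∧
      (∀ s, a ≤ s → ‖(ξ + ∫ τ in a..s, u τ) - (η + ∫ τ in a..s, u₀ τ)‖ ≤
        Real.exp (∫ τ in a..s, γ₁ τ) * (‖ξ - η‖ + ∫ τ in a..s, ρ τ)) ∧
      ∀ᵐ s, a ≤ s → ‖u s - u₀ s‖ ≤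
        ρ s + γ₁ s * (Real.exp (∫ τ in a..s, γ₁ τ) * (‖ξ - η‖ + ∫ τ in a..s, ρ τ)) := by
  -- Stage 0 keeps the initial point η, so the iteration begins at the reference arc; every later
  -- stage starts from ξ. The jump ‖ξ - η‖ thus enters exactly once in the sum of increments.
  let c : ℕ → E := fun n => if n = 0 then η else ξ
  have hstep : ∀ (n : ℕ) (v : {v : ℝ → E // Measurable v ∧ LocInt v}),
      ∃ v' : {v : ℝ → E // Measurable v ∧ LocInt v}, ∀ s, a ≤ s →
        v'.1 s ∈ F s (c n + ∫ τ in a..s, v.1 τ) ∧ ‖v'.1 s - v.1 s‖ ≤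
          Metric.infDist (v.1 s) (F s (c n + ∫ τ in a..s, v.1 τ)) + ε s * (1 / 2) ^ (n + 1) := by
    intro n v
    obtain ⟨u', h1, h2, h3⟩ := h.exists_next v.2.2 a (c n)
      (ε := fun s => ε s * (1 / 2) ^ (n + 1)) (hε.mul_const _)
      (fun s => by have := hε0 s; positivity) v.2.1
    exact ⟨⟨u', h1, h2⟩, h3⟩
  choose S hS using hstep
  let W₀ : ℕ → {v : ℝ → E // Measurable v ∧ LocInt v} :=
    fun n => Nat.rec ⟨u₀, hu₀m, hu₀⟩ S n
  let U : ℕ → ℝ → E := fun n => (W₀ n).1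
  have hUm : ∀ n, Measurable (U n) := fun n => (W₀ n).2.1
  have hUL : ∀ n, LocInt (U n) := fun n => (W₀ n).2.2
  let X : ℕ → ℝ → E := fun n s => c n + ∫ τ in a..s, U n τ
  have hU0 : U 0 = u₀ := rfl
  have hUF : ∀ n s, a ≤ s → U (n + 1) s ∈ F s (X n s) := fun n s hs => (hS n (W₀ n) s hs).1
  have hUd : ∀ n s, a ≤ s → ‖U (n + 1) s - U n s‖ ≤
      Metric.infDist (U n s) (F s (X n s)) + ε s * (1 / 2) ^ (n + 1) :=
    fun n s hs => (hS n (W₀ n) s hs).2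
  let D : ℕ → ℝ → ℝ := fun n s => ‖X (n + 1) s - X n s‖
  let V : ℕ → ℝ → ℝ := fun n s => ‖U (n + 1) s - U n s‖
  have hVL : ∀ n, LocInt (V n) := fun n b d => ((hUL (n + 1) b d).sub (hUL n b d)).norm
  let ρ' : ℝ → ℝ := fun s => Metric.infDist (u₀ s) (F s (η + ∫ τ in a..s, u₀ τ)) + ε s
  -- After the first step, U (k+1) lies in F at X k, so its distance to F at X (k+1) is at most γ₁ D
  -- k. The halving tolerances sum to at most ε.
  have hV : ∀ n s, a ≤ s → ∑ k ∈ Finset.range (n + 1), V k s ≤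
      ρ' s + γ₁ s * ∑ k ∈ Finset.range n, D k s := by
    intro n s hs
    have hgeo : ∀ m : ℕ, ∑ k ∈ Finset.range m, ε s * (1 / 2 : ℝ) ^ (k + 1) ≤ ε s := by
      intro m
      have : ∑ k ∈ Finset.range m, ε s * (1 / 2 : ℝ) ^ (k + 1) = ε s * (1 - (1 / 2) ^ m) := by
        induction m with
        | zero => simp
        | succ m ih => rw [Finset.sum_range_succ, ih]; ring
      rw [this]
      have h1 : (0 : ℝ) < (1 / 2) ^ m := by positivity
      nlinarith [hε0 s]
    have h1 : ∀ k, V (k + 1) s ≤ γ₁ s * D k s + ε s * (1 / 2) ^ (k + 1 + 1) := by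
      intro k
      refine (hUd (k + 1) s hs).trans (add_le_add ?_ le_rfl)
      have := h.lip s (X k s) (X (k + 1) s) _ (hUF k s hs)
      rwa [norm_sub_rev] at this
    rw [Finset.sum_range_succ', Finset.mul_sum]
    have h2 : ∑ k ∈ Finset.range n, V (k + 1) s ≤
        ∑ k ∈ Finset.range n, (γ₁ s * D k s + ε s * (1 / 2) ^ (k + 1 + 1)) :=
      Finset.sum_le_sum fun k _ => h1 k
    rw [Finset.sum_add_distrib] at h2
    have h3 := hUd 0 s hs
    have h4 := hgeo (n + 1)
    rw [Finset.sum_range_succ'] at h4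
    have h5 : V 0 s ≤ Metric.infDist (u₀ s) (F s (η + ∫ τ in a..s, u₀ τ)) +
      ε s * (1 / 2) ^ (0 + 1) := h3
    simp only [ρ']
    linarith
  set δ : ℝ := ‖ξ - η‖ with hδ
  have hδ0 : 0 ≤ δ := norm_nonneg _
  set M : ℝ → ℝ := fun s => Real.exp (∫ τ in a..s, γ₁ τ) * (δ + ∫ τ in a..s, ρ τ) with hM
  have hMc : Continuous M := by
    have h1 := h.locInt₁.continuous_primitive a
    have h2 := hρ.continuous_primitive a
    fun_prop
  have hρP0 : ∀ s, a ≤ s → 0 ≤ ∫ τ in a..s, ρ τ := fun s hs =>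
    intervalIntegral.integral_nonneg hs fun τ _ => hρ0 τ
  have hM0 : ∀ s, a ≤ s → 0 ≤ M s := fun s hs => by
    have := hρP0 s hs
    simp only [hM]; positivity
  -- The induction is on partial sums rather than single increments: it closes because M is a
  -- supersolution of the linear integral inequality, so no factorial estimates of iterated
  -- integrals occur.
  have hD : ∀ n s, a ≤ s → ∑ k ∈ Finset.range n, D k s ≤ M s := by
    intro n
    induction n with
    | zero => intro s hs; simpa using hM0 s hs
    | succ n ih =>
      intro s hs
      have hcsum : ∑ k ∈ Finset.range (n + 1), ‖c (k + 1) - c k‖ = δ := by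
        rw [Finset.sum_range_succ']
        simp [c, hδ]
      have h1 : ∀ k, D k s ≤ ‖c (k + 1) - c k‖ + ∫ τ in a..s, V k τ := by
        intro k
        have e : X (k + 1) s - X k s = (c (k + 1) - c k) +
            ∫ τ in a..s, (U (k + 1) τ - U k τ) := by
          rw [intervalIntegral.integral_sub (hUL (k + 1) a s) (hUL k a s)]
          simp only [X]; abel
        simp only [D]
        rw [e]
        exact (norm_add_le _ _).trans
          (add_le_add le_rfl (intervalIntegral.norm_integral_le_integral_norm hs))
      have hVsum : LocInt fun τ => ∑ k ∈ Finset.range (n + 1), V k τ := fun b d => by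
        have := IntervalIntegrable.sum (Finset.range (n + 1)) (f := V) fun k _ => hVL k b d
        simpa only [Finset.sum_fn] using this
      have hMint : IntervalIntegrable (fun τ => γ₁ τ * M τ + ρ τ) volume a s :=
        ((h.locInt₁ a s).mul_continuousOn hMc.continuousOn).add (hρ a s)
      calc ∑ k ∈ Finset.range (n + 1), D k s
          ≤ ∑ k ∈ Finset.range (n + 1), (‖c (k + 1) - c k‖ + ∫ τ in a..s, V k τ) :=
            Finset.sum_le_sum fun k _ => h1 k
        _ = δ + ∫ τ in a..s, ∑ k ∈ Finset.range (n + 1), V k τ := by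
            rw [Finset.sum_add_distrib, hcsum, intervalIntegral.integral_finsetSum]
            intro k _; exact hVL k a s
        _ ≤ δ + ∫ τ in a..s, (γ₁ τ * M τ + ρ τ) := by
            refine add_le_add le_rfl
              (intervalIntegral.integral_mono_ae_restrict hs (hVsum a s) hMint ?_)
            rw [EventuallyLE, ae_restrict_iff' measurableSet_Icc]
            filter_upwards [hd] with τ hτ hτm
            have h2 := hV n τ hτm.1
            have h3 := mul_le_mul_of_nonneg_left (ih τ hτm.1) (h.nonneg₁ τ)
            have h4 := hτ hτm.1
            simp only [ρ'] at h2
            linarith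
        _ ≤ M s := exp_mul_primitive_supersolution h.locInt₁ hρ h.nonneg₁ hρ0 hδ0 hs
  have hVle : ∀ n s, a ≤ s → ∑ k ∈ Finset.range n, V k s ≤ ρ' s + γ₁ s * M s := by
    intro n s hs
    have h1 : ∑ k ∈ Finset.range n, V k s ≤ ∑ k ∈ Finset.range (n + 1), V k s := by
      rw [Finset.sum_range_succ]
      have : 0 ≤ V n s := norm_nonneg _
      linarith
    have h2 := hV n s hs
    have h3 := mul_le_mul_of_nonneg_left (hD n s hs) (h.nonneg₁ s)
    linarith
  have hVsummable : ∀ s, a ≤ s → Summable fun k => V k s := fun s hs =>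
    summable_of_sum_range_le (fun k => norm_nonneg _) fun n => hVle n s hs
  have hUlim : ∀ s, ∃ l, (a ≤ s → Tendsto (fun n => U n s) atTop (𝓝 l)) ∧ (s < a → l = 0) := by
    intro s
    rcases le_or_gt a s with hs | hs
    · obtain ⟨l, hl⟩ := cauchySeq_tendsto_of_complete (cauchySeq_of_summable_dist
        (f := fun n => U n s) (by
          refine (hVsummable s hs).congr fun k => ?_
          rw [dist_comm, dist_eq_norm]))
      exact ⟨l, fun _ => hl, fun h' => absurd hs (not_le.2 h')⟩
    · exact ⟨0, fun h' => absurd h' (not_le.2 hs), fun _ => rfl⟩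
  choose u hul hu0 using hUlim
  have hum : Measurable u := by
    refine measurable_of_tendsto_metrizable (f := fun n => (Ici a).indicator (U n))
      (fun n => (hUm n).indicator measurableSet_Ici) (tendsto_pi_nhds.2 fun s => ?_)
    rcases le_or_gt a s with hs | hs
    · simpa only [indicator_of_mem (mem_Ici.2 hs)] using hul s hs
    · simp only [indicator_of_notMem (notMem_Ici.2 hs), hu0 s hs]
      exact tendsto_const_nhds
  have hUU : ∀ n s, ‖U n s - u₀ s‖ ≤ ∑ k ∈ Finset.range n, V k s := by
    intro n s
    have : U n s - u₀ s = ∑ k ∈ Finset.range n, (U (k + 1) s - U k s) := by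
      rw [Finset.sum_range_sub (fun k => U k s), hU0]
    rw [this]
    exact norm_sum_le _ _
  have hXX : ∀ n s, ‖X n s - (η + ∫ τ in a..s, u₀ τ)‖ ≤ ∑ k ∈ Finset.range n, D k s := by
    intro n s
    have : X n s - (η + ∫ τ in a..s, u₀ τ) = ∑ k ∈ Finset.range n, (X (k + 1) s - X k s) := by
      rw [Finset.sum_range_sub (fun k => X k s)]
      rfl
    rw [this]
    exact norm_sum_le _ _
  have hUb : ∀ᵐ s, a ≤ s → ∀ n, ‖U n s - u₀ s‖ ≤ ρ s + γ₁ s * M s := by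
    filter_upwards [hd] with s hs has n
    have h1 := hs has
    have h2 := hVle n s has
    simp only [ρ'] at h2
    have h3 := hUU n s
    linarith
  have hub : ∀ᵐ s, a ≤ s → ‖u s - u₀ s‖ ≤ ρ s + γ₁ s * M s := by
    filter_upwards [hUb] with s hs has
    exact le_of_tendsto' ((hul s has).sub_const _).norm (hs has)
  -- Dominating function for the limit. The absolute value keeps it nonnegative before time a, where
  -- M may be negative.
  let g : ℝ → ℝ := fun s => ‖u₀ s‖ + (ρ s + γ₁ s * |M s|)
  have hgL : LocInt g := fun b d => (hu₀ b d).norm.add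
    ((hρ b d).add ((h.locInt₁ b d).mul_continuousOn hMc.abs.continuousOn))
  have hgle : ∀ s (v : E), a ≤ s → ‖v - u₀ s‖ ≤ ρ s + γ₁ s * M s → ‖v‖ ≤ g s := by
    intro s v hs hv
    have h1 := norm_le_norm_add_norm_sub' v (u₀ s)
    simp only [g]
    rw [abs_of_nonneg (hM0 s hs)]
    linarith
  have huL : LocInt u := by
    refine locInt_of_abs_le hum.aestronglyMeasurable hgL ?_
    filter_upwards [hub] with s hs
    rcases le_or_gt a s with has | has
    · exact hgle s _ has (hs has)
    · rw [hu0 s has, norm_zero]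
      have h1 := h.nonneg₁ s
      have h2 := hρ0 s
      simp only [g]; positivity
  have hXlim : ∀ s, a ≤ s → Tendsto (fun n => X n s) atTop (𝓝 (ξ + ∫ τ in a..s, u τ)) := by
    intro s hs
    have h1 : Tendsto (fun n => ∫ τ in a..s, U n τ) atTop (𝓝 (∫ τ in a..s, u τ)) := by
      refine intervalIntegral.tendsto_integral_filter_of_dominated_convergence g
        (Eventually.of_forall fun n => (hUm n).aestronglyMeasurable) ?_ (hgL a s) ?_
      · refine Eventually.of_forall fun n => ?_
        filter_upwards [hUb] with τ hτ hτm
        rw [uIoc_of_le hs] at hτm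
        exact hgle τ _ hτm.1.le (hτ hτm.1.le n)
      · refine Eventually.of_forall fun τ hτm => ?_
        rw [uIoc_of_le hs] at hτm
        exact hul τ hτm.1.le
    have h2 : Tendsto c atTop (𝓝 ξ) := by
      refine tendsto_const_nhds.congr' ?_
      filter_upwards [eventually_ne_atTop 0] with n hn
      simp [c, hn]
    exact h2.add h1
  refine ⟨u, huL, fun s hs => ?_, fun s hs => ?_, hub⟩
  · rw [(h.closed _ _).mem_iff_infDist_zero (h.nonempty _ _)]
    have h1 : Tendsto (fun n => Metric.infDist (U (n + 1) s) (F s (ξ + ∫ τ in a..s, u τ))) atTop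
        (𝓝 (Metric.infDist (u s) (F s (ξ + ∫ τ in a..s, u τ)))) :=
      ((Metric.continuous_infDist_pt _).tendsto _).comp
        ((tendsto_add_atTop_iff_nat 1).2 (hul s hs))
    have h2 : Tendsto (fun n => γ₁ s * ‖X n s - (ξ + ∫ τ in a..s, u τ)‖) atTop
        (𝓝 (γ₁ s * ‖(ξ + ∫ τ in a..s, u τ) - (ξ + ∫ τ in a..s, u τ)‖)) :=
      ((hXlim s hs).sub_const _).norm.const_mul _
    rw [sub_self, norm_zero, mul_zero] at h2
    exact le_antisymm (le_of_tendsto_of_tendsto' h1 h2 fun n => h.lip s _ _ _ (hUF n s hs))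
      Metric.infDist_nonneg
  · exact le_of_tendsto' ((hXlim s hs).sub_const _).norm fun n => (hXX n s).trans (hD n s hs)

end Filippov

/-! ### The real-valued problem and its value function -/

section Value

/-- A Carathéodory integrand, Lipschitz in the state and the velocity. -/
structure IsCostIntegrand {E : Type*} [NormedAddCommGroup E] (l : ℝ → E → E → ℝ)
    (l₀ l₁ l₂ : ℝ → ℝ) : Prop where
  measurable_cost : ∀ x y, Measurable fun s => l s x y
  cost_bound : ∀ s, |l s 0 0| ≤ l₀ s
  cost_lip : ∀ s x y x' y', |l s x y - l s x' y'| ≤ l₁ s * ‖x - x'‖ + l₂ s * ‖y - y'‖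
  l₁_nonneg : ∀ s, 0 ≤ l₁ s
  l₂_nonneg : ∀ s, 0 ≤ l₂ s
  l₀_integrable : Integrable l₀
  l₁_integrable : Integrable l₁
  l₂_integrable : Integrable l₂
  l₂_bdd : ∀ T, ∃ M, ∀ s ≤ T, l₂ s ≤ M

/-- The growth factor of trajectories. -/
noncomputable def growth (γ₀ γ₁ : ℝ → ℝ) (s : ℝ) : ℝ :=
  Real.exp (∫ τ in (0 : ℝ)..s, γ₁ τ) * (1 + ∫ τ in (0 : ℝ)..s, γ₀ τ)

/-- The standing assumptions on the infinite horizon problem, for a real-valued integrand. -/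
structure IsHorizonProblem {E : Type*} [NormedAddCommGroup E] [NormedSpace ℝ E]
    (F : ℝ → E → Set E) (l : ℝ → E → E → ℝ) (γ₀ γ₁ l₀ l₁ l₂ : ℝ → ℝ) : Prop
    extends IsVelocityField F γ₀ γ₁, IsCostIntegrand l l₀ l₁ l₂ where
  growth_integrable : IntegrableOn (fun s => growth γ₀ γ₁ s * (l₁ s + l₂ s * γ₁ s)) (Ici 0)
  cost_integrable : IntegrableOn (fun s => l₂ s * γ₀ s) (Ici 0)
  exists_admissible : ∀ t, 0 ≤ t → ∀ ξ, (admissible F t ξ).Nonempty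

/-- The cost of an arc on `[t, ∞)`. -/
noncomputable def cost {E : Type*} [NormedAddCommGroup E] [NormedSpace ℝ E]
    (l : ℝ → E → E → ℝ) (t : ℝ) (x : ℝ → E) : ℝ :=
  ∫ s in Ioi t, l s (x s) (deriv x s)

/-- The value function of a problem with finite costs. -/
noncomputable def realValue {E : Type*} [NormedAddCommGroup E] [NormedSpace ℝ E]
    (F : ℝ → E → Set E) (l : ℝ → E → E → ℝ) (t : ℝ) (ξ : E) : ℝ :=
  sInf (cost l t '' admissible F t ξ)

variable {E : Type*} [NormedAddCommGroup E] [NormedSpace ℝ E]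
  {F : ℝ → E → Set E} {l : ℝ → E → E → ℝ} {γ₀ γ₁ l₀ l₁ l₂ : ℝ → ℝ}

omit [NormedSpace ℝ E] in
theorem continuous_of_abs_sub_le {f : E → E → ℝ} {a b : ℝ}
    (h : ∀ x y x' y', |f x y - f x' y'| ≤ a * ‖x - x'‖ + b * ‖y - y'‖) :
    Continuous fun z : E × E => f z.1 z.2 := by
  refine continuous_iff_continuousAt.2 fun z => ?_
  rw [ContinuousAt, tendsto_iff_dist_tendsto_zero]
  have h1 : Tendsto (fun z' : E × E => a * ‖z'.1 - z.1‖ + b * ‖z'.2 - z.2‖) (𝓝 z)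
      (𝓝 (a * ‖z.1 - z.1‖ + b * ‖z.2 - z.2‖)) :=
    (by fun_prop : Continuous fun z' : E × E => a * ‖z'.1 - z.1‖ + b * ‖z'.2 - z.2‖).tendsto z
  rw [sub_self, sub_self, norm_zero, mul_zero, mul_zero, add_zero] at h1
  exact squeeze_zero (fun _ => dist_nonneg) (fun z' => h z'.1 z'.2 z.1 z.2) h1

omit [NormedSpace ℝ E] in
theorem measurable_uncurry_cost [MeasurableSpace E] [BorelSpace E] [SecondCountableTopology E]
    (h : IsCostIntegrand l l₀ l₁ l₂) :
    Measurable (Function.uncurry fun (z : E × E) (s : ℝ) => l s z.1 z.2) :=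
  measurable_uncurry_of_continuous_of_measurable
    (fun s => continuous_of_abs_sub_le (h.cost_lip s)) fun z => h.measurable_cost z.1 z.2

omit [NormedSpace ℝ E] in
theorem aemeasurable_cost_along [MeasurableSpace E] [BorelSpace E] [SecondCountableTopology E]
    (h : IsCostIntegrand l l₀ l₁ l₂) {μ : Measure ℝ} {x y : ℝ → E} (hx : AEMeasurable x μ)
    (hy : AEMeasurable y μ) : AEMeasurable (fun s => l s (x s) (y s)) μ := by
  have h1 := (measurable_uncurry_cost h).comp_aemeasurable ((hx.prodMk hy).prodMk aemeasurable_id)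
  simpa only [Function.comp_def, Function.uncurry_apply_pair, id_eq] using h1

omit [NormedSpace ℝ E] in
theorem IsCostIntegrand.abs_le (h : IsCostIntegrand l l₀ l₁ l₂) (s : ℝ) (x y : E) :
    |l s x y| ≤ l₀ s + l₁ s * ‖x‖ + l₂ s * ‖y‖ := by
  have h1 := h.cost_lip s x y 0 0
  have h2 := h.cost_bound s
  rw [sub_zero, sub_zero] at h1
  have h3 := abs_add_le (l s x y - l s 0 0) (l s 0 0)
  rw [sub_add_cancel] at h3
  linarith

omit [NormedSpace ℝ E] in
theorem growth_nonneg (h : IsVelocityField F γ₀ γ₁) {s : ℝ} (hs : 0 ≤ s) : 0 ≤ growth γ₀ γ₁ s := by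
  have : 0 ≤ ∫ τ in (0 : ℝ)..s, γ₀ τ :=
    intervalIntegral.integral_nonneg hs fun τ _ => h.nonneg₀ τ
  unfold growth; positivity

omit [NormedSpace ℝ E] in
theorem exp_integral_le (h : IsVelocityField F γ₀ γ₁) {t : ℝ} (ht : 0 ≤ t) (s : ℝ) :
    Real.exp (∫ τ in t..s, γ₁ τ) ≤ Real.exp (∫ τ in (0 : ℝ)..s, γ₁ τ) := by
  have h1 := intervalIntegral.integral_add_adjacent_intervals (h.locInt₁ 0 t) (h.locInt₁ t s)
  have h2 : 0 ≤ ∫ τ in (0 : ℝ)..t, γ₁ τ :=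
    intervalIntegral.integral_nonneg ht fun τ _ => h.nonneg₁ τ
  exact Real.exp_le_exp.2 (by linarith)

-- Estimates from any starting time t are absorbed into the single weight from time 0 that (H7)
-- makes integrable. This is why later constants do not depend on t.
omit [NormedSpace ℝ E] in
theorem exp_integral_mul_le_growth (h : IsVelocityField F γ₀ γ₁) {t s : ℝ} (ht : 0 ≤ t)
    (hs : t ≤ s) {c : ℝ} (hc : 0 ≤ c) :
    Real.exp (∫ τ in t..s, γ₁ τ) * (c + ∫ τ in t..s, γ₀ τ) ≤ growth γ₀ γ₁ s * (1 + c) := by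
  have h1 := intervalIntegral.integral_add_adjacent_intervals (h.locInt₀ 0 t) (h.locInt₀ t s)
  have h2 : 0 ≤ ∫ τ in (0 : ℝ)..t, γ₀ τ :=
    intervalIntegral.integral_nonneg ht fun τ _ => h.nonneg₀ τ
  have h3 : 0 ≤ ∫ τ in t..s, γ₀ τ :=
    intervalIntegral.integral_nonneg hs fun τ _ => h.nonneg₀ τ
  unfold growth
  rw [mul_assoc]
  refine mul_le_mul (exp_integral_le h ht s) ?_ (by positivity) (Real.exp_pos _).le
  nlinarith

omit [NormedSpace ℝ E] in
theorem exp_integral_le_growth (h : IsVelocityField F γ₀ γ₁) {t s : ℝ} (ht : 0 ≤ t)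
    (hs : 0 ≤ s) : Real.exp (∫ τ in t..s, γ₁ τ) ≤ growth γ₀ γ₁ s := by
  have h3 : 0 ≤ ∫ τ in (0 : ℝ)..s, γ₀ τ :=
    intervalIntegral.integral_nonneg hs fun τ _ => h.nonneg₀ τ
  refine (exp_integral_le h ht s).trans ?_
  unfold growth
  exact le_mul_of_one_le_right (Real.exp_pos _).le (by linarith)

/-! ### Admissible trajectories -/

theorem admissible_velocity_mem {x : ℝ → E} {t : ℝ} {ξ : E} (ht : 0 ≤ t)
    (hx : x ∈ admissible F t ξ) : ∀ᵐ s, t ≤ s → velocity x s ∈ F s (x s) := by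
  have h1 := hx.2.1
  rw [ae_restrict_iff' measurableSet_Ici] at h1
  filter_upwards [h1] with s hs hts
  rw [velocity_of_nonneg x (ht.trans hts)]
  exact hs hts

theorem admissible_eq {x : ℝ → E} {t : ℝ} {ξ : E} (ht : 0 ≤ t) (hx : x ∈ admissible F t ξ) {s : ℝ}
    (hs : 0 ≤ s) : x s = ξ + ∫ τ in t..s, velocity x τ := by
  rw [hx.1.eq_add_integral ht hs, hx.2.2]

/-- Velocities obey ‖v‖ ≤ γ₀ + γ₁‖x‖, so the bound is Gronwall's lemma for the norm of the
trajectory. -/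
theorem admissible_norm_le (h : IsVelocityField F γ₀ γ₁) {x : ℝ → E} {t : ℝ} {ξ : E} (ht : 0 ≤ t)
    (hx : x ∈ admissible F t ξ) {s : ℝ} (hs : t ≤ s) : ‖x s‖ ≤ growth γ₀ γ₁ s * (1 + ‖ξ‖) := by
  have hv := hx.1.locInt_velocity
  have hX : Continuous fun s => ξ + ∫ τ in t..s, velocity x τ :=
    continuous_const.add (hv.continuous_primitive t)
  have hg := gronwall_integral h.locInt₁ h.locInt₀ h.nonneg₁ h.nonneg₀ (norm_nonneg ξ) hs hX.norm
    (by
      intro r hr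
      refine (norm_add_le _ _).trans (add_le_add le_rfl ?_)
      refine (intervalIntegral.norm_integral_le_integral_norm hr.1).trans ?_
      refine intervalIntegral.integral_mono_ae_restrict hr.1 (hv t r).norm
        (((h.locInt₁ t r).mul_continuousOn hX.norm.continuousOn).add (h.locInt₀ t r)) ?_
      rw [EventuallyLE, ae_restrict_iff' measurableSet_Icc]
      filter_upwards [admissible_velocity_mem ht hx] with τ hτ hτm
      have h1 := h.norm_le (hτ hτm.1)
      rw [admissible_eq ht hx (ht.trans hτm.1)] at h1
      linarith)
  rw [admissible_eq ht hx (ht.trans hs)]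
  exact hg.trans (exp_integral_mul_le_growth h ht hs (norm_nonneg ξ))

theorem admissible_of_primitive [CompleteSpace E] {u : ℝ → E} (hu : LocInt u) {t : ℝ} (ht : 0 ≤ t)
    {ξ : E} (huF : ∀ s, t ≤ s → u s ∈ F s (ξ + ∫ τ in t..s, u τ)) :
    (fun s => ξ + ∫ τ in t..s, u τ) ∈ admissible F t ξ ∧
      ∀ᵐ s, 0 ≤ s → deriv (fun s => ξ + ∫ τ in t..s, u τ) s = u s := by
  obtain ⟨h1, h2⟩ := isArc_of_primitive hu (y := fun s => ξ + ∫ τ in t..s, u τ) fun s _ => rfl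
  refine ⟨⟨h1, ?_, by simp⟩, (ae_restrict_iff' measurableSet_Ici).1 h2⟩
  have h3 : Ici t ⊆ Ici (0 : ℝ) := Ici_subset_Ici.2 ht
  filter_upwards [ae_restrict_of_ae_restrict_of_subset h3 h2, ae_restrict_mem measurableSet_Ici]
    with s hs hts
  rw [hs]
  exact huF s hts

theorem admissible_restart {x : ℝ → E} {t r : ℝ} {ξ : E} (hx : x ∈ admissible F t ξ) (htr : t ≤ r) :
    x ∈ admissible F r (x r) :=
  ⟨hx.1, ae_restrict_of_ae_restrict_of_subset (Ici_subset_Ici.2 htr) hx.2.1, rfl⟩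

theorem admissible_concat [CompleteSpace E] {x z : ℝ → E} {t r : ℝ} {ξ : E} (ht : 0 ≤ t)
    (htr : t ≤ r) (hx : x ∈ admissible F t ξ) (hz : z ∈ admissible F r (x r)) :
    ∃ w ∈ admissible F t ξ, (∀ᵐ s, 0 ≤ s → s ≤ r → w s = x s ∧ deriv w s = deriv x s) ∧
      ∀ᵐ s, r < s → w s = z s ∧ deriv w s = deriv z s := by
  have hr : 0 ≤ r := ht.trans htr
  obtain ⟨h1, h2⟩ := hx.1.concat hz.1 hr hz.2.2.symm
  rw [ae_restrict_iff' measurableSet_Ici] at h2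
  have hxF := (ae_restrict_iff' measurableSet_Ici).1 hx.2.1
  have hzF := (ae_restrict_iff' measurableSet_Ici).1 hz.2.1
  refine ⟨_, ⟨h1, ?_, ?_⟩, ?_, ?_⟩
  · rw [ae_restrict_iff' measurableSet_Ici]
    filter_upwards [h2, hxF, hzF] with s hs hsx hsz hts
    rw [hs (ht.trans hts)]
    by_cases hsr : s ≤ r
    · simpa only [hsr, if_true] using hsx hts
    · simpa only [hsr, if_false] using hsz (not_le.1 hsr).le
  · simp only [htr, if_true]
    exact hx.2.2
  · filter_upwards [h2] with s hs hs0 hsr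
    rw [hs hs0]
    simp [hsr]
  · filter_upwards [h2] with s hs hsr
    rw [hs (hr.trans hsr.le)]
    simp [not_le.2 hsr]

/-! ### Costs -/

section Costs

variable [CompleteSpace E] [MeasurableSpace E] [BorelSpace E] [SecondCountableTopology E]

/-- An integrable majorant of the running costs. -/
noncomputable def costMajorant (γ₀ γ₁ l₀ l₁ l₂ : ℝ → ℝ) (c s : ℝ) : ℝ :=
  l₀ s + growth γ₀ γ₁ s * (l₁ s + l₂ s * γ₁ s) * (1 + c) + l₂ s * γ₀ s

omit [CompleteSpace E] [MeasurableSpace E] [BorelSpace E] [SecondCountableTopology E] in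
theorem integrableOn_costMajorant (h : IsHorizonProblem F l γ₀ γ₁ l₀ l₁ l₂) (c : ℝ) :
    IntegrableOn (costMajorant γ₀ γ₁ l₀ l₁ l₂ c) (Ici 0) :=
  (h.l₀_integrable.integrableOn.add (h.growth_integrable.mul_const (1 + c))).add h.cost_integrable

-- Linear growth of the velocity and the Gronwall bound of the state reduce the integrand to the
-- quantities in (H7). Hence all admissible costs converge absolutely, uniformly over trajectories
-- from a fixed point.
omit [CompleteSpace E] [MeasurableSpace E] [BorelSpace E] [SecondCountableTopology E] in
theorem abs_cost_le_majorant (h : IsHorizonProblem F l γ₀ γ₁ l₀ l₁ l₂) {x : ℝ → E} {t : ℝ} {ξ : E}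
    (ht : 0 ≤ t) (hx : x ∈ admissible F t ξ) :
    ∀ᵐ s ∂volume.restrict (Ici t), |l s (x s) (deriv x s)| ≤
      costMajorant γ₀ γ₁ l₀ l₁ l₂ ‖ξ‖ s := by
  filter_upwards [hx.2.1, ae_restrict_mem measurableSet_Ici] with s hs hts
  have h1 := h.abs_le s (x s) (deriv x s)
  have h2 := mul_le_mul_of_nonneg_left (h.norm_le hs) (h.l₂_nonneg s)
  have h3 : 0 ≤ l₁ s + l₂ s * γ₁ s :=
    add_nonneg (h.l₁_nonneg s) (mul_nonneg (h.l₂_nonneg s) (h.nonneg₁ s))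
  have h4 := mul_le_mul_of_nonneg_left (admissible_norm_le h.toIsVelocityField ht hx hts) h3
  unfold costMajorant
  linarith

omit [CompleteSpace E] in
theorem aemeasurable_cost_admissible (h : IsCostIntegrand l l₀ l₁ l₂) {x : ℝ → E} (hx : IsArc x) :
    AEMeasurable (fun s => l s (x s) (deriv x s)) (volume.restrict (Ici 0)) :=
  aemeasurable_cost_along h (hx.locallyIntegrable.aestronglyMeasurable.aemeasurable)
    (hx.deriv_locallyIntegrable.aestronglyMeasurable.aemeasurable)

omit [CompleteSpace E] in
theorem integrableOn_cost (h : IsHorizonProblem F l γ₀ γ₁ l₀ l₁ l₂) {x : ℝ → E} {t : ℝ} {ξ : E}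
    (ht : 0 ≤ t) (hx : x ∈ admissible F t ξ) :
    IntegrableOn (fun s => l s (x s) (deriv x s)) (Ici t) := by
  have h3 : Ici t ⊆ Ici (0 : ℝ) := Ici_subset_Ici.2 ht
  refine Integrable.mono' ((integrableOn_costMajorant h ‖ξ‖).mono_set h3) ?_
    (abs_cost_le_majorant h ht hx)
  exact ((aemeasurable_cost_admissible h.toIsCostIntegrand hx.1).mono_measure
    (Measure.restrict_mono_set _ h3)).aestronglyMeasurable

omit [CompleteSpace E] in
theorem intervalIntegrable_cost (h : IsHorizonProblem F l γ₀ γ₁ l₀ l₁ l₂) {x : ℝ → E} {t r s : ℝ}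
    {ξ : E} (ht : 0 ≤ t) (hx : x ∈ admissible F t ξ) (htr : t ≤ r) (hrs : r ≤ s) :
    IntervalIntegrable (fun s => l s (x s) (deriv x s)) volume r s := by
  rw [intervalIntegrable_iff_integrableOn_Ioc_of_le hrs]
  exact (integrableOn_cost h ht hx).mono_set fun τ hτ => htr.trans hτ.1.le

omit [CompleteSpace E] in
theorem cost_split (h : IsHorizonProblem F l γ₀ γ₁ l₀ l₁ l₂) {x : ℝ → E} {t r : ℝ} {ξ : E}
    (ht : 0 ≤ t) (hx : x ∈ admissible F t ξ) (htr : t ≤ r) :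
    cost l t x = (∫ s in t..r, l s (x s) (deriv x s)) + cost l r x := by
  have h1 := (integrableOn_cost h ht hx).mono_set Ioi_subset_Ici_self
  have h2 := (integrableOn_cost h (ht.trans htr) (admissible_restart hx htr)).mono_set
    Ioi_subset_Ici_self
  exact (intervalIntegral.integral_interval_add_Ioi h1 h2).symm

omit [CompleteSpace E] [MeasurableSpace E] [BorelSpace E] [SecondCountableTopology E] in
theorem bddBelow_cost (h : IsHorizonProblem F l γ₀ γ₁ l₀ l₁ l₂) {t : ℝ} (ht : 0 ≤ t) (ξ : E) :
    BddBelow (cost l t '' admissible F t ξ) := by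
  refine ⟨-∫ s in Ioi t, costMajorant γ₀ γ₁ l₀ l₁ l₂ ‖ξ‖ s, ?_⟩
  rintro _ ⟨x, hx, rfl⟩
  refine (abs_le.1 ?_).1
  have h3 : Ioi t ⊆ Ici (0 : ℝ) := fun s hs => ht.trans (le_of_lt hs)
  have h4 : ∀ᵐ s ∂volume.restrict (Ioi t), ‖l s (x s) (deriv x s)‖ ≤
      costMajorant γ₀ γ₁ l₀ l₁ l₂ ‖ξ‖ s :=
    ae_restrict_of_ae_restrict_of_subset Ioi_subset_Ici_self (abs_cost_le_majorant h ht hx)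
  exact norm_integral_le_of_norm_le ((integrableOn_costMajorant h ‖ξ‖).mono_set h3) h4

omit [CompleteSpace E] [MeasurableSpace E] [BorelSpace E] [SecondCountableTopology E] in
theorem realValue_le_cost (h : IsHorizonProblem F l γ₀ γ₁ l₀ l₁ l₂) {t : ℝ} (ht : 0 ≤ t) {ξ : E}
    {x : ℝ → E} (hx : x ∈ admissible F t ξ) : realValue F l t ξ ≤ cost l t x :=
  csInf_le (bddBelow_cost h ht ξ) ⟨x, hx, rfl⟩

omit [CompleteSpace E] [MeasurableSpace E] [BorelSpace E] [SecondCountableTopology E] in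
theorem le_realValue (h : IsHorizonProblem F l γ₀ γ₁ l₀ l₁ l₂) {t : ℝ} (ht : 0 ≤ t) {ξ : E}
    {c : ℝ} (hc : ∀ x ∈ admissible F t ξ, c ≤ cost l t x) : c ≤ realValue F l t ξ := by
  refine le_csInf ((h.exists_admissible t ht ξ).image _) ?_
  rintro _ ⟨x, hx, rfl⟩
  exact hc x hx

/-- The dynamic programming inequality. -/
theorem realValue_le_add (h : IsHorizonProblem F l γ₀ γ₁ l₀ l₁ l₂) {x : ℝ → E} {t r : ℝ} {ξ : E}
    (ht : 0 ≤ t) (hx : x ∈ admissible F t ξ) (htr : t ≤ r) :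
    realValue F l t ξ ≤ (∫ s in t..r, l s (x s) (deriv x s)) + realValue F l r (x r) := by
  have hr := ht.trans htr
  rw [← sub_le_iff_le_add']
  refine le_realValue h hr fun z hz => ?_
  obtain ⟨w, hw, hwx, hwz⟩ := admissible_concat ht htr hx hz
  have h1 := realValue_le_cost h ht hw
  rw [cost_split h ht hw htr] at h1
  have h2 : ∫ s in t..r, l s (w s) (deriv w s) = ∫ s in t..r, l s (x s) (deriv x s) := by
    refine intervalIntegral.integral_congr_ae ?_
    filter_upwards [hwx] with s hs hsm
    rw [uIoc_of_le htr] at hsm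
    obtain ⟨e1, e2⟩ := hs (ht.trans hsm.1.le) hsm.2
    rw [e1, e2]
  have h3 : cost l r w = cost l r z := by
    refine setIntegral_congr_ae measurableSet_Ioi ?_
    filter_upwards [hwz] with s hs hsm
    obtain ⟨e1, e2⟩ := hs hsm
    rw [e1, e2]
  rw [h2, h3] at h1
  linarith

/-- Principle of optimality: a cheaper tail from x(t) would, by the dynamic programming inequality
along x, improve on x at time 0. -/
theorem realValue_eq_cost_of_optimal (h : IsHorizonProblem F l γ₀ γ₁ l₀ l₁ l₂) {x : ℝ → E} {ξ : E}
    (hx : x ∈ admissible F 0 ξ) (hopt : cost l 0 x = realValue F l 0 ξ) {t : ℝ} (ht : 0 ≤ t) :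
    realValue F l t (x t) = cost l t x := by
  refine le_antisymm (realValue_le_cost h ht (admissible_restart hx ht)) ?_
  have h1 := realValue_le_add h le_rfl hx ht
  rw [← hopt, cost_split h le_rfl hx ht] at h1
  linarith

theorem realValue_optimal_split (h : IsHorizonProblem F l γ₀ γ₁ l₀ l₁ l₂) {x : ℝ → E} {ξ : E}
    (hx : x ∈ admissible F 0 ξ) (hopt : cost l 0 x = realValue F l 0 ξ) {t r : ℝ} (ht : 0 ≤ t)
    (htr : t ≤ r) : realValue F l t (x t) =
      (∫ s in t..r, l s (x s) (deriv x s)) + realValue F l r (x r) := by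
  rw [realValue_eq_cost_of_optimal h hx hopt ht,
    realValue_eq_cost_of_optimal h hx hopt (ht.trans htr),
    cost_split h ht (admissible_restart hx ht) htr]

/-! ### Lipschitz continuity of the value function -/

/-- The Lipschitz constant of the value function. -/
noncomputable def lipConst (γ₀ γ₁ l₁ l₂ : ℝ → ℝ) : ℝ :=
  ∫ s in Ici 0, growth γ₀ γ₁ s * (l₁ s + l₂ s * γ₁ s)

omit [CompleteSpace E] [MeasurableSpace E] [BorelSpace E] [SecondCountableTopology E] in
theorem growth_integrand_nonneg (h : IsHorizonProblem F l γ₀ γ₁ l₀ l₁ l₂) {s : ℝ} (hs : 0 ≤ s) :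
    0 ≤ growth γ₀ γ₁ s * (l₁ s + l₂ s * γ₁ s) :=
  mul_nonneg (growth_nonneg h.toIsVelocityField hs)
    (add_nonneg (h.l₁_nonneg s) (mul_nonneg (h.l₂_nonneg s) (h.nonneg₁ s)))

omit [CompleteSpace E] [MeasurableSpace E] [BorelSpace E] [SecondCountableTopology E] in
theorem lipConst_nonneg (h : IsHorizonProblem F l γ₀ γ₁ l₀ l₁ l₂) : 0 ≤ lipConst γ₀ γ₁ l₁ l₂ :=
  setIntegral_nonneg measurableSet_Ici fun _ hs => growth_integrand_nonneg h hs

/-- The reference arc is itself a trajectory, so Filippov's theorem from the new initial point has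
only the tolerance as error. The cost difference is then controlled by the weight of (H7),
integrated over the whole half-line. -/
theorem exists_cost_le (h : IsHorizonProblem F l γ₀ γ₁ l₀ l₁ l₂) {t : ℝ} (ht : 0 ≤ t) {ξ ξ' : E}
    {x : ℝ → E} (hx : x ∈ admissible F t ξ') {η : ℝ} (hη : 0 < η) :
    ∃ y ∈ admissible F t ξ, cost l t y ≤ cost l t x +
      (lipConst γ₀ γ₁ l₁ l₂ * (‖ξ - ξ'‖ + η) + (∫ s in Ici 0, l₂ s) * η) := by
  have hv := hx.1.locInt_velocity
  -- Filippov's theorem is stated for a measurable velocity, so a measurable representative replaces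
  -- the derivative.
  obtain ⟨u₀, hu₀m, hu₀⟩ := hv.locallyIntegrable.aestronglyMeasurable.aemeasurable
  have hu₀L : LocInt u₀ := fun a b => (hv a b).congr_ae (ae_restrict_of_ae hu₀)
  have hint : ∀ s, ∫ τ in t..s, u₀ τ = ∫ τ in t..s, velocity x τ := fun s =>
    intervalIntegral.integral_congr_ae (hu₀.mono fun τ hτ _ => hτ.symm)
  -- A strictly positive tolerance that on [t, ∞) is at most η and has integral at most η.
  set ρ : ℝ → ℝ := fun s => η * Real.exp (-s) with hρ
  have hρc : Continuous ρ := by fun_prop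
  have hρL : LocInt ρ := fun a b => hρc.intervalIntegrable a b
  have hρ0 : ∀ s, 0 < ρ s := fun s => by positivity
  have hρ1 : ∀ s, 0 ≤ s → ρ s ≤ η := fun s hs => by
    have : Real.exp (-s) ≤ 1 := Real.exp_le_one_iff.2 (by linarith)
    simp only [hρ]; nlinarith
  have hρint : ∀ s, t ≤ s → ∫ τ in t..s, ρ τ ≤ η := by
    intro s hs
    have : ∫ τ in t..s, Real.exp (-τ) = Real.exp (-t) - Real.exp (-s) := by
      rw [intervalIntegral.integral_comp_neg (f := Real.exp), integral_exp]
    simp only [hρ]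
    rw [intervalIntegral.integral_const_mul, this]
    have h1 : Real.exp (-t) ≤ 1 := Real.exp_le_one_iff.2 (by linarith)
    have h2 := Real.exp_pos (-s)
    nlinarith
  obtain ⟨u, huL, huF, hub, hud⟩ := h.filippov hu₀L hu₀m t ξ' ξ hρL (fun s => (hρ0 s).le)
    hρc.measurable hρ0 (by
      filter_upwards [hu₀, admissible_velocity_mem ht hx] with s hs hsF hts
      rw [hint, ← admissible_eq ht hx (ht.trans hts), ← hs,
        Metric.infDist_zero_of_mem (hsF hts), zero_add])
  obtain ⟨hy, hyd⟩ := admissible_of_primitive huL ht huF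
  refine ⟨_, hy, ?_⟩
  set y : ℝ → E := fun s => ξ + ∫ τ in t..s, u τ with hydef
  set δ := ‖ξ - ξ'‖ with hδ
  have hδ0 : 0 ≤ δ := norm_nonneg _
  have hsub : Ioi t ⊆ Ici (0 : ℝ) := fun s hs => ht.trans (le_of_lt hs)
  have hIx := (integrableOn_cost h ht hx).mono_set Ioi_subset_Ici_self
  have hIy := (integrableOn_cost h ht hy).mono_set Ioi_subset_Ici_self
  have hI1 : IntegrableOn (fun s => growth γ₀ γ₁ s * (l₁ s + l₂ s * γ₁ s) * (δ + η) + l₂ s * η)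
      (Ici 0) :=
    (h.growth_integrable.mul_const (δ + η)).add (h.l₂_integrable.integrableOn.mul_const η)
  have hle : ∀ᵐ s ∂volume.restrict (Ioi t), l s (y s) (deriv y s) ≤
      l s (x s) (deriv x s) + (growth γ₀ γ₁ s * (l₁ s + l₂ s * γ₁ s) * (δ + η) + l₂ s * η) := by
    rw [ae_restrict_iff' measurableSet_Ioi]
    filter_upwards [hyd, hud, hu₀] with s hs1 hs2 hs3 hs
    have hts : t ≤ s := le_of_lt hs
    have hs0 : 0 ≤ s := ht.trans hts
    have hm : Real.exp (∫ τ in t..s, γ₁ τ) * (δ + ∫ τ in t..s, ρ τ) ≤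
        growth γ₀ γ₁ s * (δ + η) := by
      have h1 := hρint s hts
      have h2 : 0 ≤ ∫ τ in t..s, ρ τ :=
        intervalIntegral.integral_nonneg hts fun τ _ => (hρ0 τ).le
      exact mul_le_mul (exp_integral_le_growth h.toIsVelocityField ht hs0) (by linarith)
        (by positivity) (growth_nonneg h.toIsVelocityField hs0)
    have h1 : ‖y s - x s‖ ≤ growth γ₀ γ₁ s * (δ + η) := by
      have := hub s hts
      rw [hint, ← admissible_eq ht hx hs0] at this
      exact this.trans hm
    have h2 : ‖deriv y s - deriv x s‖ ≤ η + γ₁ s * (growth γ₀ γ₁ s * (δ + η)) := by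
      rw [hs1 hs0, ← velocity_of_nonneg x hs0, hs3]
      exact (hs2 hts).trans (add_le_add (hρ1 s hs0) (mul_le_mul_of_nonneg_left hm (h.nonneg₁ s)))
    have h3 := (abs_le.1 (h.cost_lip s (y s) (deriv y s) (x s) (deriv x s))).2
    have h4 := mul_le_mul_of_nonneg_left h1 (h.l₁_nonneg s)
    have h5 := mul_le_mul_of_nonneg_left h2 (h.l₂_nonneg s)
    linarith
  have hI2 := hI1.mono_set hsub
  calc cost l t y ≤ ∫ s in Ioi t, (l s (x s) (deriv x s) +
        (growth γ₀ γ₁ s * (l₁ s + l₂ s * γ₁ s) * (δ + η) + l₂ s * η)) :=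
        integral_mono_ae hIy (hIx.add hI2) hle
    _ = cost l t x + ∫ s in Ioi t, (growth γ₀ γ₁ s * (l₁ s + l₂ s * γ₁ s) * (δ + η) + l₂ s * η) :=
        integral_add hIx hI2
    _ ≤ cost l t x + ∫ s in Ici 0, (growth γ₀ γ₁ s * (l₁ s + l₂ s * γ₁ s) * (δ + η) + l₂ s * η) := by
        refine add_le_add le_rfl (setIntegral_mono_set hI1 ?_ hsub.eventuallyLE)
        rw [EventuallyLE, ae_restrict_iff' measurableSet_Ici]
        refine Eventually.of_forall fun s hs => ?_
        have h1 := growth_integrand_nonneg h hs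
        have h2 := h.l₂_nonneg s
        simp only [Pi.zero_apply]
        positivity
    _ = _ := by
        rw [integral_add (h.growth_integrable.mul_const (δ + η))
          (h.l₂_integrable.integrableOn.mul_const η), integral_mul_const, integral_mul_const]
        rfl

theorem realValue_le_add_norm (h : IsHorizonProblem F l γ₀ γ₁ l₀ l₁ l₂) {t : ℝ} (ht : 0 ≤ t)
    (ξ ξ' : E) :
    realValue F l t ξ ≤ realValue F l t ξ' + lipConst γ₀ γ₁ l₁ l₂ * ‖ξ - ξ'‖ := by
  rw [← sub_le_iff_le_add]
  refine le_realValue h ht fun x hx => ?_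
  rw [sub_le_iff_le_add]
  have hK := lipConst_nonneg h
  have hK2 : 0 ≤ ∫ s in Ici (0 : ℝ), l₂ s :=
    setIntegral_nonneg measurableSet_Ici fun s _ => h.l₂_nonneg s
  refine le_of_forall_pos_le_add fun ε hε => ?_
  set A : ℝ := lipConst γ₀ γ₁ l₁ l₂ + (∫ s in Ici (0 : ℝ), l₂ s) + 1 with hA
  have hA0 : 0 < A := by positivity
  obtain ⟨y, hy, hle⟩ := exists_cost_le h ht (ξ := ξ) hx (div_pos hε hA0)
  have h1 := realValue_le_cost h ht hy
  have h2 : A * (ε / A) = ε := mul_div_cancel₀ _ hA0.ne'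
  have h3 : 0 < ε / A := div_pos hε hA0
  have h4 : (lipConst γ₀ γ₁ l₁ l₂ + ∫ s in Ici (0 : ℝ), l₂ s) * (ε / A) ≤ A * (ε / A) :=
    mul_le_mul_of_nonneg_right (by linarith) h3.le
  linarith

theorem lipschitzWith_realValue (h : IsHorizonProblem F l γ₀ γ₁ l₀ l₁ l₂) {t : ℝ} (ht : 0 ≤ t) :
    LipschitzWith (lipConst γ₀ γ₁ l₁ l₂).toNNReal (realValue F l t) := by
  refine LipschitzWith.of_le_add_mul _ fun ξ ξ' => ?_
  rw [Real.coe_toNNReal _ (lipConst_nonneg h), dist_eq_norm]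
  exact realValue_le_add_norm h ht ξ ξ'

end Costs

end Value

/-! ### Directional estimate of the value function along an optimal arc -/

section Inequality

variable {E : Type*} [NormedAddCommGroup E] [NormedSpace ℝ E]
  {F : ℝ → E → Set E} {l : ℝ → E → E → ℝ} {γ₀ γ₁ l₀ l₁ l₂ : ℝ → ℝ}

omit [NormedSpace ℝ E] in
theorem locInt_cost_const [MeasurableSpace E] [BorelSpace E] [SecondCountableTopology E]
    (h : IsCostIntegrand l l₀ l₁ l₂) (x y : E) : LocInt fun s => l s x y :=
  locInt_of_abs_le (g := fun s => l₀ s + l₁ s * ‖x‖ + l₂ s * ‖y‖)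
    (h.measurable_cost x y).aestronglyMeasurable
    (fun _ _ => ((h.l₀_integrable.add (h.l₁_integrable.mul_const _)).add
      (h.l₂_integrable.mul_const _)).intervalIntegrable)
    (Eventually.of_forall fun s => h.abs_le s x y)

theorem eventually_norm_sub_le {G : Type*} [NormedAddCommGroup G] [NormedSpace ℝ G] {f : ℝ → G}
    {f' : G} {t : ℝ} (hf : HasDerivAt f f' t) {η : ℝ} (hη : 0 < η) :
    ∀ᶠ θ in 𝓝[>] (0 : ℝ), ‖f (t + θ) - f t - θ • f'‖ ≤ η * θ := by
  have h1 := (hasDerivAt_iff_isLittleO_nhds_zero.1 hf).def hη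
  filter_upwards [nhdsWithin_le_nhds h1, self_mem_nhdsWithin] with θ hθ hpos
  rwa [Real.norm_eq_abs, abs_of_pos hpos] at hθ

theorem eventually_integral_lt {q : ℝ → ℝ} (hq : LocInt q) (t : ℝ) {η : ℝ} (hη : 0 < η) :
    ∀ᶠ θ in 𝓝[>] (0 : ℝ), ∫ s in t..(t + θ), q s < η := by
  have h1 : Continuous fun θ : ℝ => ∫ s in t..(t + θ), q s :=
    (hq.continuous_primitive t).comp (continuous_const.add continuous_id)
  have h2 := h1.tendsto 0
  rw [add_zero, intervalIntegral.integral_same] at h2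
  exact nhdsWithin_le_nhds (h2.eventually (gt_mem_nhds hη))

variable [CompleteSpace E] [MeasurableSpace E] [BorelSpace E] [SecondCountableTopology E]

/-- A trajectory starting at `z` whose velocity is close to `v` on `[t, t + θ]`. -/
theorem exists_admissible_near_line (h : IsVelocityField F γ₀ γ₁) {t : ℝ} (ht : 0 ≤ t) {X z v : E}
    {θ η C : ℝ} (hθ : 0 < θ) (hη : θ ≤ η) (hC : ‖z - X‖ + θ * ‖v‖ ≤ C * θ)
    (hlsc : ∀ s ∈ Icc t (t + θ), Metric.infDist v (F s X) ≤ η)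
    (hg1 : ∫ s in t..(t + θ), γ₁ s ≤ 1 / 2) (hgC : C * ∫ s in t..(t + θ), γ₁ s ≤ η) :
    ∃ y ∈ admissible F t z, ∃ ρ : ℝ → ℝ, LocInt ρ ∧ ∫ s in t..(t + θ), ρ s ≤ 3 * η * θ ∧
      (∀ s ∈ Icc t (t + θ), ‖y s - (z + (s - t) • v)‖ ≤ 6 * η * θ) ∧
      ∀ᵐ s, s ∈ Icc t (t + θ) → ‖deriv y s - v‖ ≤ ρ s + γ₁ s * (6 * η * θ) := by
  -- The reference arc is the line with velocity v. The duration θ doubles as selection tolerance,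
  -- since over the interval it contributes only θ² ≤ ηθ.
  set ρ : ℝ → ℝ := fun s => Metric.infDist v (F s (z + (s - t) • v)) + θ with hρ
  have hline : Continuous fun s : ℝ => z + (s - t) • v := by fun_prop
  have hlineint : ∀ s, ∫ _ in t..s, v = (s - t) • v := fun s => intervalIntegral.integral_const v
  have hγ := h.locInt₁
  have hρm : Measurable ρ := (h.measurable_infDist_along hline.measurable v).add_const θ
  have hρ0 : ∀ s, 0 ≤ ρ s := fun s => add_nonneg Metric.infDist_nonneg hθ.le
  have hρL : LocInt ρ := by
    refine locInt_of_abs_le (g := fun s => ‖v‖ + (γ₀ s + γ₁ s * ‖z + (s - t) • v‖) + θ)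
      hρm.aestronglyMeasurable (fun a b => (intervalIntegrable_const.add
        ((h.locInt₀ a b).add ((hγ a b).mul_continuousOn hline.norm.continuousOn))).add
        intervalIntegrable_const) (Eventually.of_forall fun s => ?_)
    obtain ⟨e, he⟩ := h.nonempty s (z + (s - t) • v)
    have h1 := Metric.infDist_le_dist_of_mem (x := v) he
    have h2 := h.norm_le he
    rw [dist_eq_norm] at h1
    have h3 := norm_sub_le v e
    rw [Real.norm_eq_abs, abs_of_nonneg (hρ0 s)]
    simp only [hρ]
    linarith
  have hρle : ∀ s ∈ Icc t (t + θ), ρ s ≤ η + γ₁ s * (C * θ) + θ := by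
    intro s hs
    have h1 := h.infDist_le s (z + (s - t) • v) X v
    have h2 := hlsc s hs
    have h3 : ‖z + (s - t) • v - X‖ ≤ C * θ := by
      have e : z + (s - t) • v - X = (z - X) + (s - t) • v := by abel
      rw [e]
      refine (norm_add_le _ _).trans (le_trans (add_le_add le_rfl ?_) hC)
      rw [norm_smul, Real.norm_eq_abs, abs_of_nonneg (by linarith [hs.1])]
      exact mul_le_mul_of_nonneg_right (by linarith [hs.2]) (norm_nonneg v)
    have h4 := mul_le_mul_of_nonneg_left h3 (h.nonneg₁ s)
    simp only [hρ]
    linarith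
  have htθ : t ≤ t + θ := by linarith
  -- Each of the three terms (semicontinuity error, displacement from X, tolerance) integrates to at
  -- most ηθ.
  have hR : ∫ s in t..(t + θ), ρ s ≤ 3 * η * θ := by
    have h1 := intervalIntegral.integral_mono_on htθ (hρL t (t + θ))
      ((intervalIntegrable_const.add ((hγ t (t + θ)).mul_const (C * θ))).add
        intervalIntegrable_const) hρle
    rw [intervalIntegral.integral_add (intervalIntegrable_const.add
        ((hγ t (t + θ)).mul_const (C * θ))) intervalIntegrable_const,
      intervalIntegral.integral_add intervalIntegrable_const ((hγ t (t + θ)).mul_const (C * θ)),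
      intervalIntegral.integral_mul_const, intervalIntegral.integral_const,
      intervalIntegral.integral_const, smul_eq_mul, smul_eq_mul, add_sub_cancel_left] at h1
    have h2 := mul_le_mul_of_nonneg_right hgC hθ.le
    nlinarith
  obtain ⟨u, huL, huF, hub, hud⟩ := h.filippov (u₀ := fun _ => v)
    (fun _ _ => intervalIntegrable_const) measurable_const t z z hρL hρ0
    (measurable_const (a := θ)) (fun _ => hθ)
    (Eventually.of_forall fun s _ => by rw [hlineint])
  obtain ⟨hy, hyd⟩ := admissible_of_primitive huL ht huF
  have hm : ∀ s ∈ Icc t (t + θ),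
      Real.exp (∫ τ in t..s, γ₁ τ) * (‖z - z‖ + ∫ τ in t..s, ρ τ) ≤ 6 * η * θ := by
    intro s hs
    have h1 : ∫ τ in t..s, γ₁ τ ≤ 1 / 2 :=
      (monotoneOn_primitive hγ h.nonneg₁ t hs.2).trans hg1
    have h2 : ∫ τ in t..s, ρ τ ≤ 3 * η * θ := (monotoneOn_primitive hρL hρ0 t hs.2).trans hR
    -- From exp(1/2) ≤ 1/(1 - 1/2); this doubles 3ηθ to 6ηθ.
    have h3 : Real.exp (∫ τ in t..s, γ₁ τ) ≤ 2 := by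
      have h4 := Real.exp_bound_div_one_sub_of_interval (x := 1 / 2) (by norm_num) (by norm_num)
      have h5 := Real.exp_le_exp.2 h1
      norm_num at h4
      exact h5.trans h4
    have h6 : 0 ≤ ∫ τ in t..s, ρ τ :=
      intervalIntegral.integral_nonneg hs.1 fun τ _ => hρ0 τ
    rw [sub_self, norm_zero, zero_add]
    calc _ ≤ 2 * (3 * η * θ) := mul_le_mul h3 h2 h6 (by norm_num)
      _ = _ := by ring
  refine ⟨_, hy, ρ, hρL, hR, fun s hs => ?_, ?_⟩
  · have := hub s hs.1
    rw [hlineint] at this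
    exact this.trans (hm s hs)
  · filter_upwards [hyd, hud] with s hs1 hs2 hs
    rw [hs1 (ht.trans hs.1)]
    exact (hs2 hs.1).trans
      (add_le_add le_rfl (mul_le_mul_of_nonneg_left (hm s hs) (h.nonneg₁ s)))

/-- The competitor from x₀(t) + θ(y₀ - v) with velocity near v lands within 7ηθ of x₀(t+θ): 6ηθ from
Filippov's theorem and ηθ from differentiability of x₀. Comparing its dynamic programming inequality
with the equality along x₀ leaves the running costs and the Lipschitz error at time t+θ. Freezing
the competitor's running cost at (x₀(t), v) costs (C + 6)ηθ through l₁ and 6Mηθ through l₂; the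
local bound M on l₂ is what makes the second term small. -/
theorem realValue_sub_le (h : IsHorizonProblem F l γ₀ γ₁ l₀ l₁ l₂) {x₀ : ℝ → E} {ξ₀ : E}
    (hx : x₀ ∈ admissible F 0 ξ₀) (hopt : cost l 0 x₀ = realValue F l 0 ξ₀) {t : ℝ} (ht : 0 ≤ t)
    {y₀ v : E} {θ η C M : ℝ} (hθ : 0 < θ) (hη : θ ≤ η) (hη1 : η ≤ 1) (hC : C = ‖y₀ - v‖ + ‖v‖)
    (hM : ∀ s ∈ Icc t (t + θ), l₂ s ≤ M)
    (hlsc : ∀ s ∈ Icc t (t + θ), Metric.infDist v (F s (x₀ t)) ≤ η)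
    (hg1 : ∫ s in t..(t + θ), γ₁ s ≤ 1 / 2) (hgC : C * ∫ s in t..(t + θ), γ₁ s ≤ η)
    (hl₁ : ∫ s in t..(t + θ), l₁ s ≤ η) (hd : ‖x₀ (t + θ) - x₀ t - θ • y₀‖ ≤ η * θ) :
    realValue F l t (x₀ t + θ • (y₀ - v)) - realValue F l t (x₀ t) ≤
      (∫ s in t..(t + θ), l s (x₀ t) v) - (∫ s in t..(t + θ), l s (x₀ s) (deriv x₀ s)) +
        (C + 6 + 6 * M + 7 * lipConst γ₀ γ₁ l₁ l₂) * (η * θ) := by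
  have htθ : t ≤ t + θ := by linarith
  have hη0 : 0 < η := hθ.trans_le hη
  have hM0 : 0 ≤ M := (h.l₂_nonneg t).trans (hM t ⟨le_rfl, htθ⟩)
  have hK := lipConst_nonneg h
  have hC0 : 0 ≤ C := by rw [hC]; positivity
  obtain ⟨y, hy, ρ, hρL, hR, hyb, hyd⟩ := exists_admissible_near_line h.toIsVelocityField ht
    (X := x₀ t) (z := x₀ t + θ • (y₀ - v)) (v := v) (C := C) hθ hη
    (by rw [add_sub_cancel_left, norm_smul, Real.norm_eq_abs, abs_of_pos hθ, hC]; linarith)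
    hlsc hg1 hgC
  have h1 := realValue_le_add h ht hy htθ
  have h2 := realValue_optimal_split h hx hopt ht htθ
  have h3 : realValue F l (t + θ) (y (t + θ)) ≤ realValue F l (t + θ) (x₀ (t + θ)) +
      lipConst γ₀ γ₁ l₁ l₂ * (7 * (η * θ)) := by
    refine (realValue_le_add_norm h (ht.trans htθ) _ (x₀ (t + θ))).trans
      (add_le_add le_rfl (mul_le_mul_of_nonneg_left ?_ hK))
    have e : y (t + θ) - x₀ (t + θ) =
        (y (t + θ) - (x₀ t + θ • (y₀ - v) + (t + θ - t) • v)) -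
          (x₀ (t + θ) - x₀ t - θ • y₀) := by
      rw [add_sub_cancel_left, smul_sub]; abel
    rw [e]
    refine (norm_sub_le _ _).trans ?_
    have := hyb (t + θ) ⟨htθ, le_rfl⟩
    linarith
  have h4 : ∫ s in t..(t + θ), l s (y s) (deriv y s) ≤
      (∫ s in t..(t + θ), l s (x₀ t) v) + (C + 6 + 6 * M) * (η * θ) := by
    have hi0 := locInt_cost_const h.toIsCostIntegrand (x₀ t) v t (t + θ)
    have hi1 : IntervalIntegrable l₁ volume t (t + θ) := h.l₁_integrable.intervalIntegrable
    have hi2 := hρL t (t + θ)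
    have hi3 := h.locInt₁ t (t + θ)
    have hm : ∫ s in t..(t + θ), l s (y s) (deriv y s) ≤ ∫ s in t..(t + θ), (l s (x₀ t) v +
        l₁ s * ((C + 6) * θ) + M * (ρ s + γ₁ s * (6 * η * θ))) := by
      refine intervalIntegral.integral_mono_ae_restrict htθ
        (intervalIntegrable_cost h ht hy le_rfl htθ)
        ((hi0.add (hi1.mul_const _)).add ((hi2.add (hi3.mul_const _)).const_mul M)) ?_
      rw [EventuallyLE, ae_restrict_iff' measurableSet_Icc]
      filter_upwards [hyd] with s hs hsm
      have k1 := (abs_le.1 (h.cost_lip s (y s) (deriv y s) (x₀ t) v)).2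
      have k2 : ‖y s - x₀ t‖ ≤ (C + 6) * θ := by
        have e : y s - x₀ t = (y s - (x₀ t + θ • (y₀ - v) + (s - t) • v)) +
            (θ • (y₀ - v) + (s - t) • v) := by abel
        rw [e]
        have k3 := hyb s hsm
        have k4 : ‖(s - t) • v‖ ≤ θ * ‖v‖ := by
          rw [norm_smul, Real.norm_eq_abs, abs_of_nonneg (by linarith [hsm.1])]
          exact mul_le_mul_of_nonneg_right (by linarith [hsm.2]) (norm_nonneg v)
        have k5 : ‖θ • (y₀ - v)‖ = θ * ‖y₀ - v‖ := by
          rw [norm_smul, Real.norm_eq_abs, abs_of_pos hθ]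
        have k6 := norm_add_le (y s - (x₀ t + θ • (y₀ - v) + (s - t) • v))
          (θ • (y₀ - v) + (s - t) • v)
        have k7 := norm_add_le (θ • (y₀ - v)) ((s - t) • v)
        have k8 : η * θ ≤ 1 * θ := mul_le_mul_of_nonneg_right hη1 hθ.le
        rw [hC]
        linarith
      have k9 := mul_le_mul_of_nonneg_left k2 (h.l₁_nonneg s)
      have k10 := mul_le_mul (hM s hsm) (hs hsm) (norm_nonneg _) hM0
      linarith
    rw [intervalIntegral.integral_add (hi0.add (hi1.mul_const _))
        ((hi2.add (hi3.mul_const _)).const_mul M),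
      intervalIntegral.integral_add hi0 (hi1.mul_const _), intervalIntegral.integral_mul_const,
      intervalIntegral.integral_const_mul, intervalIntegral.integral_add hi2 (hi3.mul_const _),
      intervalIntegral.integral_mul_const] at hm
    have m1 := mul_le_mul_of_nonneg_right hl₁ (by positivity : 0 ≤ (C + 6) * θ)
    have m2 := mul_le_mul_of_nonneg_right hg1 (by positivity : 0 ≤ 6 * η * θ)
    have m3 := mul_le_mul_of_nonneg_left (add_le_add hR m2) hM0
    linarith
  linarith

/-- The upper bound for difference quotients of the value function along an optimal arc. -/
theorem eventually_quot_realValue_le (h : IsHorizonProblem F l γ₀ γ₁ l₀ l₁ l₂) {x₀ : ℝ → E}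
    {ξ₀ : E} (hx : x₀ ∈ admissible F 0 ξ₀) (hopt : cost l 0 x₀ = realValue F l 0 ξ₀) {t : ℝ}
    (ht : 0 ≤ t) {y₀ v : E} (hd : HasDerivAt x₀ y₀ t)
    (hc₀ : HasDerivAt (fun r => ∫ s in (0 : ℝ)..r, l s (x₀ s) (deriv x₀ s)) (l t (x₀ t) y₀) t)
    (hc : HasDerivAt (fun r => ∫ s in (0 : ℝ)..r, l s (x₀ t) v) (l t (x₀ t) v) t)
    (hlsc : Tendsto (fun s => Metric.infDist v (F s (x₀ t))) (𝓝[≥] t) (𝓝 0))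
    {ε : ℝ} (hε : 0 < ε) : ∀ᶠ θ in 𝓝[>] (0 : ℝ),
      (realValue F l t (x₀ t + θ • (y₀ - v)) - realValue F l t (x₀ t)) / θ ≤
        l t (x₀ t) v - l t (x₀ t) y₀ + ε := by
  obtain ⟨M, hM⟩ := h.l₂_bdd (t + 1)
  have hM0 : 0 ≤ M := (h.l₂_nonneg t).trans (hM t (by linarith))
  have hK := lipConst_nonneg h
  set C : ℝ := ‖y₀ - v‖ + ‖v‖ with hC
  have hC0 : 0 ≤ C := by rw [hC]; positivity
  -- The constant of `realValue_sub_le`, plus 2 for the remainders in differentiating the two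
  -- accumulated costs.
  set A : ℝ := C + 8 + 6 * M + 7 * lipConst γ₀ γ₁ l₁ l₂ with hA
  have hA0 : 0 < A := by positivity
  set η : ℝ := min 1 (ε / A) with hη
  have hη0 : 0 < η := by positivity
  have hη1 : η ≤ 1 := min_le_left _ _
  have hηA : A * η ≤ ε := by
    have := mul_le_mul_of_nonneg_left (min_le_right 1 (ε / A)) hA0.le
    rwa [mul_div_cancel₀ _ hA0.ne'] at this
  have e1 : ∀ᶠ θ in 𝓝[>] (0 : ℝ), θ < η := nhdsWithin_le_nhds (gt_mem_nhds hη0)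
  have e2 : ∀ᶠ θ in 𝓝[>] (0 : ℝ), ∀ s ∈ Icc t (t + θ), Metric.infDist v (F s (x₀ t)) ≤ η := by
    have h1 := hlsc.eventually (gt_mem_nhds hη0)
    obtain ⟨r, hr, hrsub⟩ := mem_nhdsGE_iff_exists_Ico_subset.1 h1
    have hr' : 0 < r - t := sub_pos.2 hr
    filter_upwards [nhdsWithin_le_nhds (gt_mem_nhds hr')] with θ hθ s hs
    exact le_of_lt (hrsub ⟨hs.1, by linarith [hs.2]⟩)
  have e3 := eventually_integral_lt h.locInt₁ t (η := 1 / 2) (by norm_num)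
  have e4 := eventually_integral_lt h.locInt₁ t (η := η / (C + 1)) (by positivity)
  have e5 := eventually_integral_lt (q := l₁) (fun _ _ => h.l₁_integrable.intervalIntegrable) t hη0
  have e6 := eventually_norm_sub_le hd hη0
  have e7 := eventually_norm_sub_le hc₀ hη0
  have e8 := eventually_norm_sub_le hc hη0
  filter_upwards [e1, e2, e3, e4, e5, e6, e7, e8, self_mem_nhdsWithin] with θ f1 f2 f3 f4 f5 f6 f7
    f8 hθ
  have hθ0 : 0 < θ := hθ
  have htθ : t ≤ t + θ := by linarith
  have hgC : C * ∫ s in t..(t + θ), γ₁ s ≤ η := by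
    have h1 : 0 ≤ ∫ s in t..(t + θ), γ₁ s :=
      intervalIntegral.integral_nonneg htθ fun τ _ => h.nonneg₁ τ
    rw [lt_div_iff₀ (by positivity)] at f4
    linarith
  have key := realValue_sub_le h hx hopt ht hθ0 f1.le hη1 hC
    (fun s hs => hM s (by linarith [hs.2])) f2 f3.le hgC f5.le f6
  have g1 : (∫ s in (0 : ℝ)..(t + θ), l s (x₀ s) (deriv x₀ s)) -
      ∫ s in (0 : ℝ)..t, l s (x₀ s) (deriv x₀ s) = ∫ s in t..(t + θ), l s (x₀ s) (deriv x₀ s) := by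
    rw [sub_eq_iff_eq_add', intervalIntegral.integral_add_adjacent_intervals
      (intervalIntegrable_cost h le_rfl hx le_rfl ht) (intervalIntegrable_cost h le_rfl hx ht htθ)]
  have hcL := locInt_cost_const h.toIsCostIntegrand (x₀ t) v
  have g2 : (∫ s in (0 : ℝ)..(t + θ), l s (x₀ t) v) - ∫ s in (0 : ℝ)..t, l s (x₀ t) v =
      ∫ s in t..(t + θ), l s (x₀ t) v := by
    rw [sub_eq_iff_eq_add', intervalIntegral.integral_add_adjacent_intervals
      (hcL 0 t) (hcL t (t + θ))]
  rw [g1, smul_eq_mul, Real.norm_eq_abs] at f7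
  rw [g2, smul_eq_mul, Real.norm_eq_abs] at f8
  have k1 := (abs_le.1 f7).1
  have k2 := (abs_le.1 f8).2
  rw [div_le_iff₀ hθ0]
  have k3 := mul_le_mul_of_nonneg_right hηA hθ0.le
  rw [hA] at k3
  linarith

end Inequality

/-! ### Lebesgue points and reduction to measurable real-valued data -/

section Reduction

variable {E : Type*} [NormedAddCommGroup E] [NormedSpace ℝ E]
  {F : ℝ → E → Set E} {l : ℝ → E → E → ℝ} {γ₀ γ₁ l₀ l₁ l₂ : ℝ → ℝ}

omit [NormedSpace ℝ E] in
/-- Almost every time is a Lebesgue point of all the functions `l · x v`. -/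
theorem ae_hasDerivAt_cost_const [MeasurableSpace E] [BorelSpace E] [SecondCountableTopology E]
    (h : IsCostIntegrand l l₀ l₁ l₂) : ∀ᵐ t, ∀ x v : E,
      HasDerivAt (fun r => ∫ s in (0 : ℝ)..r, l s x v) (l t x v) t := by
  -- One null set must serve all (x, v). Points of a dense sequence are treated first; the others
  -- follow at common Lebesgue points of l₁ + l₂, which controls the variation of the integrand in
  -- (x, v).
  let D : ℕ → E × E := TopologicalSpace.denseSeq (E × E)
  have hL := locInt_cost_const h
  have h12 : LocInt fun s => l₁ s + l₂ s := fun _ _ =>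
    (h.l₁_integrable.add h.l₂_integrable).intervalIntegrable
  have hD : ∀ᵐ t, ∀ n, HasDerivAt (fun r => ∫ s in (0 : ℝ)..r, l s (D n).1 (D n).2)
      (l t (D n).1 (D n).2) t := by
    rw [ae_all_iff]
    intro n
    filter_upwards [_root_.LocallyIntegrable.ae_hasDerivAt_integral
      (hL (D n).1 (D n).2).locallyIntegrable] with t ht using ht 0
  filter_upwards [hD, _root_.LocallyIntegrable.ae_hasDerivAt_integral h12.locallyIntegrable]
    with t ht htm x v
  have htm' := htm 0
  rw [hasDerivAt_iff_isLittleO_nhds_zero, Asymptotics.isLittleO_iff]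
  intro c hc
  set B : ℝ := l₁ t + l₂ t with hB
  have hB0 : 0 ≤ B := add_nonneg (h.l₁_nonneg t) (h.l₂_nonneg t)
  -- Replacing (x, v) by a dense point costs δ(B + 1)|θ| in the integral and δB|θ| in the limit
  -- value; together this is half of the budget c|θ|.
  set δ : ℝ := c / (2 * (2 * B + 1)) with hδ
  have hδ0 : 0 < δ := by positivity
  obtain ⟨n, hn⟩ := (TopologicalSpace.denseRange_denseSeq (E × E)).exists_dist_lt (x, v) hδ0
  have hn1 : ‖x - (D n).1‖ ≤ δ := by
    rw [← dist_eq_norm]; exact (le_max_left _ _).trans hn.le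
  have hn2 : ‖v - (D n).2‖ ≤ δ := by
    rw [← dist_eq_norm]; exact (le_max_right _ _).trans hn.le
  have hlip : ∀ s, |l s x v - l s (D n).1 (D n).2| ≤ δ * (l₁ s + l₂ s) := by
    intro s
    have h1 := h.cost_lip s x v (D n).1 (D n).2
    have h2 := mul_le_mul_of_nonneg_left hn1 (h.l₁_nonneg s)
    have h3 := mul_le_mul_of_nonneg_left hn2 (h.l₂_nonneg s)
    linarith
  filter_upwards [(hasDerivAt_iff_isLittleO_nhds_zero.1 (ht n)).def (half_pos hc),
    (hasDerivAt_iff_isLittleO_nhds_zero.1 htm').def one_pos] with θ h1 h2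
  have e1 : ∀ {q : ℝ → ℝ}, LocInt q → (∫ s in (0 : ℝ)..(t + θ), q s) - ∫ s in (0 : ℝ)..t, q s =
      ∫ s in t..(t + θ), q s := fun hq => by
    rw [sub_eq_iff_eq_add', intervalIntegral.integral_add_adjacent_intervals (hq 0 t)
      (hq t (t + θ))]
  rw [e1 (hL _ _)] at h1 ⊢
  rw [e1 h12] at h2
  have h3 : ‖∫ s in t..(t + θ), (l s x v - l s (D n).1 (D n).2)‖ ≤
      |∫ s in t..(t + θ), δ * (l₁ s + l₂ s)| :=
    intervalIntegral.norm_integral_le_abs_of_norm_le (Eventually.of_forall hlip)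
      ((h12 t (t + θ)).const_mul δ)
  rw [intervalIntegral.integral_sub (hL _ _ t (t + θ)) (hL _ _ t (t + θ)),
    intervalIntegral.integral_const_mul, abs_mul, abs_of_pos hδ0] at h3
  have h4 : |∫ s in t..(t + θ), (l₁ s + l₂ s)| ≤ (B + 1) * |θ| := by
    have := abs_add_le ((∫ s in t..(t + θ), (l₁ s + l₂ s)) - θ • B) (θ • B)
    rw [sub_add_cancel, smul_eq_mul, abs_mul, abs_of_nonneg hB0] at this
    simp only [Real.norm_eq_abs, smul_eq_mul] at h2
    linarith
  have h5 : |θ * (l t (D n).1 (D n).2 - l t x v)| ≤ |θ| * (δ * B) := by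
    rw [abs_mul, abs_sub_comm]
    exact mul_le_mul_of_nonneg_left (hlip t) (abs_nonneg θ)
  have h6 := mul_le_mul_of_nonneg_left h4 hδ0.le
  simp only [Real.norm_eq_abs, smul_eq_mul] at h1 h3 ⊢
  have e2 : (∫ s in t..(t + θ), l s x v) - θ * l t x v =
      ((∫ s in t..(t + θ), l s x v) - ∫ s in t..(t + θ), l s (D n).1 (D n).2) +
      ((∫ s in t..(t + θ), l s (D n).1 (D n).2) - θ * l t (D n).1 (D n).2) +
      θ * (l t (D n).1 (D n).2 - l t x v) := by ring
  rw [e2]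
  refine (abs_add_three _ _ _).trans ?_
  have e3 : δ * (2 * B + 1) = c / 2 := by rw [hδ]; field_simp
  have e4 : δ * (2 * B + 1) * |θ| = c / 2 * |θ| := by rw [e3]
  linarith

/-- The running cost of an optimal arc is the derivative of the accumulated cost. -/
theorem ae_hasDerivAt_cost_admissible [MeasurableSpace E] [BorelSpace E]
    [SecondCountableTopology E] (h : IsHorizonProblem F l γ₀ γ₁ l₀ l₁ l₂) {x : ℝ → E} {ξ : E}
    (hx : x ∈ admissible F 0 ξ) : ∀ᵐ t, 0 < t →
      HasDerivAt (fun r => ∫ s in (0 : ℝ)..r, l s (x s) (deriv x s)) (l t (x t) (deriv x t)) t := by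
  have hL : LocInt ((Ici (0 : ℝ)).indicator fun s => l s (x s) (deriv x s)) :=
    locInt_indicator_Ici (integrableOn_cost h le_rfl hx).locallyIntegrableOn
  filter_upwards [_root_.LocallyIntegrable.ae_hasDerivAt_integral hL.locallyIntegrable]
    with t ht hpos
  have h1 := ht 0
  rw [indicator_of_mem (mem_Ici.2 hpos.le)] at h1
  refine h1.congr_of_eventuallyEq ?_
  filter_upwards [Ioi_mem_nhds hpos] with r hr
  refine intervalIntegral.integral_congr fun s hs => ?_
  rw [uIcc_of_le (le_of_lt hr)] at hs
  exact (indicator_of_mem (mem_Ici.2 hs.1) fun s => l s (x s) (deriv x s)).symm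

/-! ### Extension to negative times -/

open Classical in
/-- A multifunction made trivial at negative times. -/
def extendField (Γ : ℝ → E → Set E) (s : ℝ) (x : E) :
    Set E := if 0 ≤ s then Γ s x else ({0} : Set E)

omit [NormedSpace ℝ E] in
theorem extendField_of_nonneg (Γ : ℝ → E → Set E) {s : ℝ} (hs : 0 ≤ s) :
    extendField Γ s = Γ s := funext fun _ => if_pos hs

omit [NormedSpace ℝ E] in
theorem extendField_of_neg (Γ : ℝ → E → Set E) {s : ℝ} (hs : s < 0) (x : E) :
    extendField Γ s x = {0} := if_neg (not_le.2 hs)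

theorem admissible_extendField (Γ : ℝ → E → Set E) {t : ℝ} (ht : 0 ≤ t) (ξ : E) :
    admissible (extendField Γ) t ξ = admissible Γ t ξ := by
  ext x
  refine and_congr_right fun _ => and_congr_left fun _ => ?_
  rw [ae_restrict_iff' measurableSet_Ici, ae_restrict_iff' measurableSet_Ici]
  have : ∀ s, (s ∈ Ici t → deriv x s ∈ extendField Γ s (x s)) ↔
      (s ∈ Ici t → deriv x s ∈ Γ s (x s)) := fun s =>
    forall_congr' fun hs => by rw [extendField_of_nonneg Γ (ht.trans hs)]
  simp only [this]

omit [NormedSpace ℝ E] in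
theorem infDist_lt_iff_inter_ball {C : Set E} (hC : C.Nonempty) {y : E} {r : ℝ} :
    Metric.infDist y C < r ↔ (C ∩ Metric.ball y r).Nonempty := by
  rw [Metric.infDist_lt_iff hC]
  constructor
  · rintro ⟨z, hz, hd⟩
    exact ⟨z, hz, by rwa [Metric.mem_ball, dist_comm]⟩
  · rintro ⟨z, hz, hd⟩
    exact ⟨z, hz, by rwa [Metric.mem_ball, dist_comm] at hd⟩

-- Lower semicontinuity in time makes the sets where the distance is below r relatively open in [0,
-- ∞). The measurability of Γ required by Filippov's theorem is obtained here from (H5').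
omit [NormedSpace ℝ E] in
theorem measurable_infDist_extendField {Γ : ℝ → E → Set E} {x : E}
    (hne : ∀ s, 0 ≤ s → (Γ s x).Nonempty)
    (hlsc : LowerHemicontinuousOn (fun t => Γ t x) (Ici (0 : ℝ))) (y : E) :
    Measurable fun s => Metric.infDist y (extendField Γ s x) := by
  refine measurable_of_Iio fun r => ?_
  have hopen : IsOpen {s : ℝ | 0 ≤ s → Metric.infDist y (Γ s x) < r} := by
    rw [isOpen_iff_mem_nhds]
    intro s hs
    rcases lt_or_ge s 0 with hs0 | hs0
    · filter_upwards [Iio_mem_nhds hs0] with τ hτ hτ0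
      exact absurd hτ0 (not_le.2 hτ)
    · have h1 := lowerHemicontinuousWithinAt_iff.1 (hlsc s hs0) _ Metric.isOpen_ball
        ((infDist_lt_iff_inter_ball (hne s hs0)).1 (hs hs0))
      filter_upwards [eventually_nhdsWithin_iff.1 h1] with τ hτ hτ0
      exact (infDist_lt_iff_inter_ball (hne τ hτ0)).2 (hτ hτ0)
  have e : (fun s => Metric.infDist y (extendField Γ s x)) ⁻¹' Iio r =
      (Ici 0 ∩ {s : ℝ | 0 ≤ s → Metric.infDist y (Γ s x) < r}) ∪
        (Iio 0 ∩ {_s : ℝ | ‖y‖ < r}) := by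
    ext s
    simp only [mem_preimage, mem_Iio, mem_union, mem_inter_iff, mem_Ici, mem_ofPred_eq]
    rcases lt_or_ge s 0 with hs0 | hs0
    · rw [extendField_of_neg Γ hs0 x, Metric.infDist_singleton, dist_zero_right]
      simp [hs0, not_le.2 hs0]
    · rw [extendField_of_nonneg Γ hs0]
      simp [hs0, not_lt.2 hs0]
  rw [e]
  exact (measurableSet_Ici.inter hopen.measurableSet).union
    (measurableSet_Iio.inter (MeasurableSet.const _))

theorem norm_le_of_mem_smul_ball {c : ℝ} (hc : 0 ≤ c) {z : E}
    (hz : z ∈ c • Metric.ball (0 : E) 1) : ‖z‖ ≤ c := by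
  obtain ⟨b, hb, rfl⟩ := mem_smul_set.1 hz
  rw [mem_ball_zero_iff] at hb
  rw [norm_smul, Real.norm_eq_abs, abs_of_nonneg hc]
  exact mul_le_of_le_one_right hc hb.le

theorem isVelocityField_extendField {Γ : ℝ → E → Set E}
    (hγ₀ : ∀ t : ℝ, 0 ≤ t → 0 ≤ γ₀ t) (hγ₁ : ∀ t : ℝ, 0 ≤ t → 0 ≤ γ₁ t)
    (hval : ∀ t : ℝ, 0 ≤ t → ∀ x : E, (Γ t x).Nonempty ∧ IsClosed (Γ t x))
    (hlsc : ∀ x : E, LowerHemicontinuousOn (fun t => Γ t x) (Ici (0 : ℝ)))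
    (h₀ : LocallyIntegrableOn γ₀ (Ici 0)) (h₁ : LocallyIntegrableOn γ₁ (Ici 0))
    (hbound : ∀ t : ℝ, 0 ≤ t → Γ t 0 ⊆ γ₀ t • Metric.ball (0 : E) 1)
    (hlip : ∀ t : ℝ, 0 ≤ t → ∀ x x' : E,
      Γ t x ⊆ Γ t x' + (γ₁ t * ‖x - x'‖) • Metric.ball (0 : E) 1) :
    IsVelocityField (extendField Γ) ((Ici 0).indicator γ₀) ((Ici 0).indicator γ₁) where
  nonempty s x := by
    rcases lt_or_ge s 0 with hs | hs
    · rw [extendField_of_neg Γ hs]; exact singleton_nonempty _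
    · rw [extendField_of_nonneg Γ hs]; exact (hval s hs x).1
  closed s x := by
    rcases lt_or_ge s 0 with hs | hs
    · rw [extendField_of_neg Γ hs]; exact isClosed_singleton
    · rw [extendField_of_nonneg Γ hs]; exact (hval s hs x).2
  measurable x y := measurable_infDist_extendField (fun s hs => (hval s hs x).1) (hlsc x) y
  nonneg₀ s := indicator_nonneg (fun s hs => hγ₀ s hs) s
  nonneg₁ s := indicator_nonneg (fun s hs => hγ₁ s hs) s
  locInt₀ := locInt_indicator_Ici h₀
  locInt₁ := locInt_indicator_Ici h₁
  bound s v hv := by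
    rcases lt_or_ge s 0 with hs | hs
    · rw [extendField_of_neg Γ hs, mem_singleton_iff] at hv
      rw [hv, norm_zero]
      exact indicator_nonneg (fun s hs => hγ₀ s hs) s
    · rw [extendField_of_nonneg Γ hs] at hv
      rw [indicator_of_mem (mem_Ici.2 hs)]
      exact norm_le_of_mem_smul_ball (hγ₀ s hs) (hbound s hs hv)
  lip s x x' v hv := by
    rcases lt_or_ge s 0 with hs | hs
    · rw [extendField_of_neg Γ hs, mem_singleton_iff] at hv
      rw [extendField_of_neg Γ hs, hv, Metric.infDist_zero_of_mem (mem_singleton _)]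
      exact mul_nonneg (indicator_nonneg (fun s hs => hγ₁ s hs) s) (norm_nonneg _)
    · rw [extendField_of_nonneg Γ hs] at hv ⊢
      rw [indicator_of_mem (mem_Ici.2 hs)]
      obtain ⟨w, hw, z, hz, rfl⟩ := hlip s hs x x' hv
      refine (Metric.infDist_le_dist_of_mem hw).trans ?_
      rw [dist_eq_norm, add_sub_cancel_left]
      exact norm_le_of_mem_smul_ball (mul_nonneg (hγ₁ s hs) (norm_nonneg _)) hz

-- Points of Γ(s, x) appear arbitrarily close to v as s decreases to t. This is valid at every t ≥ 0
-- and every v in Γ(t, x), so it adds no exceptional set.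
omit [NormedSpace ℝ E] in
theorem tendsto_infDist_extendField {Γ : ℝ → E → Set E} {x : E}
    (hne : ∀ s, 0 ≤ s → (Γ s x).Nonempty)
    (hlsc : LowerHemicontinuousOn (fun t => Γ t x) (Ici (0 : ℝ))) {t : ℝ} (ht : 0 ≤ t) {v : E}
    (hv : v ∈ Γ t x) :
    Tendsto (fun s => Metric.infDist v (extendField Γ s x)) (𝓝[≥] t) (𝓝 0) := by
  refine tendsto_order.2 ⟨fun a ha => Eventually.of_forall fun s =>
    ha.trans_le Metric.infDist_nonneg, fun a ha => ?_⟩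
  have h1 := lowerHemicontinuousWithinAt_iff.1 (hlsc t ht) _ Metric.isOpen_ball
    ⟨v, hv, Metric.mem_ball_self ha⟩
  filter_upwards [nhdsWithin_mono t (Ici_subset_Ici.2 ht) h1, self_mem_nhdsWithin] with s hs hts
  have hs0 : 0 ≤ s := ht.trans hts
  rw [extendField_of_nonneg Γ hs0]
  exact (infDist_lt_iff_inter_ball (hne s hs0)).2 hs

/-! ### Real-valued representative of the integrand -/

-- Taking equal arguments makes the right-hand side 0, whereas an infinite value minus itself has
-- infinite absolute value in `EReal`. The Lipschitz bound therefore already forces finiteness.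
omit [NormedSpace ℝ E] in
theorem eq_coe_toReal_of_abs_sub_le {f : E → E → EReal} {a b : ℝ}
    (h : ∀ x y x' y' : E, (f x y - f x' y').abs ≤ ENNReal.ofReal (a * ‖x - x'‖ + b * ‖y - y'‖))
    (x y : E) : f x y = ((f x y).toReal : EReal) := by
  have h1 := h x y x y
  refine (EReal.coe_toReal ?_ ?_).symm <;> intro h2 <;> rw [h2] at h1 <;> simp at h1

omit [NormedSpace ℝ E] in
theorem abs_toReal_sub_le {f : E → E → EReal} {a b : ℝ} (ha : 0 ≤ a) (hb : 0 ≤ b)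
    (h : ∀ x y x' y' : E, (f x y - f x' y').abs ≤ ENNReal.ofReal (a * ‖x - x'‖ + b * ‖y - y'‖))
    (x y x' y' : E) : |(f x y).toReal - (f x' y').toReal| ≤ a * ‖x - x'‖ + b * ‖y - y'‖ := by
  have h1 := h x y x' y'
  rw [eq_coe_toReal_of_abs_sub_le h x y, eq_coe_toReal_of_abs_sub_le h x' y', ← EReal.coe_sub,
    EReal.abs_def, ENNReal.ofReal_le_ofReal_iff (by positivity)] at h1
  exact h1

-- Lebesgue measurability gives, for each (x, y), a measurable version off a null set depending on
-- (x, y). Using a dense sequence and continuity in (x, y), all exceptional sets fit into one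
-- measurable null set N, and setting l = 0 on N makes every hypothesis hold everywhere.
omit [NormedSpace ℝ E] in
theorem exists_isCostIntegrand [SecondCountableTopology E] {L : ℝ → E → E → EReal}
    (hl₁ : ∀ t : ℝ, 0 ≤ t → 0 ≤ l₁ t) (hl₂ : ∀ t : ℝ, 0 ≤ t → 0 ≤ l₂ t)
    (hl₀ : ∀ t : ℝ, 0 ≤ t → 0 ≤ l₀ t)
    (hmeas : ∀ x y : E, AEMeasurable (fun t => L t x y) (volume.restrict (Ici (0 : ℝ))))
    (h₀ : IntegrableOn l₀ (Ici 0)) (h₁ : IntegrableOn l₁ (Ici 0)) (h₂ : IntegrableOn l₂ (Ici 0))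
    (hbdd : ∀ T : ℝ, ∃ M : ℝ, ∀ t ∈ Icc 0 T, l₂ t ≤ M)
    (hbound : ∀ᵐ t ∂volume.restrict (Ici (0 : ℝ)), (L t 0 0).abs ≤ ENNReal.ofReal (l₀ t))
    (hlip : ∀ᵐ t ∂volume.restrict (Ici (0 : ℝ)), ∀ x y x' y' : E,
      (L t x y - L t x' y').abs ≤ ENNReal.ofReal (l₁ t * ‖x - x'‖ + l₂ t * ‖y - y'‖)) :
    ∃ l : ℝ → E → E → ℝ, IsCostIntegrand l ((Ici 0).indicator l₀) ((Ici 0).indicator l₁)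
        ((Ici 0).indicator l₂) ∧
      ∀ᵐ t ∂volume.restrict (Ici (0 : ℝ)), ∀ x y, L t x y = (l t x y : EReal) := by
  classical
  let D : ℕ → E × E := TopologicalSpace.denseSeq (E × E)
  have hm : ∀ n, AEMeasurable (fun t => (L t (D n).1 (D n).2).toReal)
      (volume.restrict (Ici (0 : ℝ))) := fun n => (hmeas _ _).ereal_toReal
  let f : ℕ → ℝ → ℝ := fun n => (hm n).mk
  have hfm : ∀ n, Measurable (f n) := fun n => (hm n).measurable_mk
  have hgood : ∀ᵐ t ∂volume.restrict (Ici (0 : ℝ)), 0 ≤ t ∧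
      (L t 0 0).abs ≤ ENNReal.ofReal (l₀ t) ∧ (∀ x y x' y' : E,
      (L t x y - L t x' y').abs ≤ ENNReal.ofReal (l₁ t * ‖x - x'‖ + l₂ t * ‖y - y'‖)) ∧
      ∀ n, (L t (D n).1 (D n).2).toReal = f n t := by
    filter_upwards [ae_restrict_mem measurableSet_Ici, hbound, hlip,
      ae_all_iff.2 fun n => (hm n).ae_eq_mk] with t k1 k2 k3 k4 using ⟨k1, k2, k3, k4⟩
  obtain ⟨N, hN, hNm, hN0⟩ := exists_measurable_superset_of_null (ae_iff.1 hgood)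
  let l : ℝ → E → E → ℝ := fun s x y => if s ∈ Nᶜ then (L s x y).toReal else 0
  have hS : ∀ s, s ∉ N → 0 ≤ s ∧ (L s 0 0).abs ≤ ENNReal.ofReal (l₀ s) ∧ (∀ x y x' y' : E,
      (L s x y - L s x' y').abs ≤ ENNReal.ofReal (l₁ s * ‖x - x'‖ + l₂ s * ‖y - y'‖)) ∧
      ∀ n, (L s (D n).1 (D n).2).toReal = f n s := by
    intro s hs
    by_contra hcon
    exact hs (hN hcon)
  have hl_in : ∀ s, s ∉ N → ∀ x y, l s x y = (L s x y).toReal := fun s hs x y => if_pos hs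
  have hl_out : ∀ s, s ∈ N → ∀ x y, l s x y = 0 := fun s hs x y => if_neg (not_not.2 hs)
  have hi₁ : ∀ s, 0 ≤ (Ici (0 : ℝ)).indicator l₁ s := indicator_nonneg fun s hs => hl₁ s hs
  have hi₂ : ∀ s, 0 ≤ (Ici (0 : ℝ)).indicator l₂ s := indicator_nonneg fun s hs => hl₂ s hs
  have hllip : ∀ s x y x' y', |l s x y - l s x' y'| ≤
      (Ici (0 : ℝ)).indicator l₁ s * ‖x - x'‖ + (Ici (0 : ℝ)).indicator l₂ s * ‖y - y'‖ := by
    intro s x y x' y'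
    by_cases hs : s ∈ N
    · rw [hl_out s hs, hl_out s hs, sub_zero, abs_zero]
      have k1 := hi₁ s
      have k2 := hi₂ s
      positivity
    · obtain ⟨k1, -, k3, -⟩ := hS s hs
      rw [hl_in s hs, hl_in s hs, indicator_of_mem (mem_Ici.2 k1), indicator_of_mem (mem_Ici.2 k1)]
      exact abs_toReal_sub_le (hl₁ s k1) (hl₂ s k1) k3 x y x' y'
  refine ⟨l, ⟨fun x y => ?_, fun s => ?_, hllip, hi₁, hi₂,
    (integrable_indicator_iff measurableSet_Ici).2 h₀,
    (integrable_indicator_iff measurableSet_Ici).2 h₁,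
    (integrable_indicator_iff measurableSet_Ici).2 h₂, fun T => ?_⟩, ?_⟩
  · have hex : ∀ k : ℕ, ∃ n, dist (x, y) (D n) < 1 / ((k : ℝ) + 1) := fun k =>
      (TopologicalSpace.denseRange_denseSeq (E × E)).exists_dist_lt (x, y) (by positivity)
    choose n hn using hex
    have hlim : Tendsto (fun k => D (n k)) atTop (𝓝 (x, y)) := by
      rw [tendsto_iff_dist_tendsto_zero]
      refine squeeze_zero (fun _ => dist_nonneg) (fun k => ?_) tendsto_one_div_add_atTop_nhds_zero_nat
      rw [dist_comm]
      exact (hn k).le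
    refine measurable_of_tendsto_metrizable (f := fun k s => l s (D (n k)).1 (D (n k)).2)
      (fun k => ?_) (tendsto_pi_nhds.2 fun s => ?_)
    · have : (fun s => l s (D (n k)).1 (D (n k)).2) = Nᶜ.indicator (f (n k)) := by
        ext s
        by_cases hs : s ∈ N
        · rw [hl_out s hs, indicator_of_notMem (not_not.2 hs)]
        · rw [hl_in s hs, indicator_of_mem hs, (hS s hs).2.2.2]
      rw [this]
      exact (hfm _).indicator hNm.compl
    · exact ((continuous_of_abs_sub_le (hllip s)).tendsto (x, y)).comp hlim
  · by_cases hs : s ∈ N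
    · rw [hl_out s hs, abs_zero]
      exact indicator_nonneg (fun s hs => hl₀ s hs) s
    · obtain ⟨k1, k2, k3, -⟩ := hS s hs
      rw [hl_in s hs, indicator_of_mem (mem_Ici.2 k1)]
      rw [eq_coe_toReal_of_abs_sub_le k3 0 0, EReal.abs_def,
        ENNReal.ofReal_le_ofReal_iff (hl₀ s k1)] at k2
      exact k2
  · obtain ⟨M, hM⟩ := hbdd T
    -- The 0 covers negative times, where the extended modulus vanishes.
    refine ⟨max M 0, fun s hs => ?_⟩
    rcases lt_or_ge s 0 with hs0 | hs0
    · rw [indicator_of_notMem (notMem_Ici.2 hs0)]; exact le_max_right _ _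
    · rw [indicator_of_mem (mem_Ici.2 hs0)]
      exact (hM s ⟨hs0, hs⟩).trans (le_max_left _ _)
  · have : ∀ᵐ t ∂volume.restrict (Ici (0 : ℝ)), t ∉ N := measure_eq_zero_iff_ae_notMem.1 hN0
    filter_upwards [this] with t ht x y
    rw [hl_in t ht]
    exact eq_coe_toReal_of_abs_sub_le (hS t ht).2.2.1 x y

end Reduction

/-! ### Extended-real improper integrals -/

section ImproperIntegral

theorem erealIntegral_of_ae_eq_coe {f : ℝ → EReal} {g : ℝ → ℝ} {μ : Measure ℝ}
    (hg : Integrable g μ) (hfg : ∀ᵐ s ∂μ, f s = (g s : EReal)) :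
    HasErealIntegral f μ ∧ erealIntegral f μ = ((∫ s, g s ∂μ : ℝ) : EReal) := by
  have hpos : ∫⁻ s, (f s).toENNReal ∂μ = ∫⁻ s, ENNReal.ofReal (g s) ∂μ := by
    refine lintegral_congr_ae ?_
    filter_upwards [hfg] with s hs
    rw [hs, EReal.real_coe_toENNReal]
  have hneg : ∫⁻ s, (-f s).toENNReal ∂μ = ∫⁻ s, ENNReal.ofReal (-g s) ∂μ := by
    refine lintegral_congr_ae ?_
    filter_upwards [hfg] with s hs
    rw [hs, ← EReal.coe_neg, EReal.real_coe_toENNReal]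
  have hfin : ∫⁻ s, ENNReal.ofReal (g s) ∂μ ≠ ⊤ := hg.lintegral_lt_top.ne
  have hfin' : ∫⁻ s, ENNReal.ofReal (-g s) ∂μ ≠ ⊤ := hg.neg.lintegral_lt_top.ne
  refine ⟨⟨?_, Or.inl (hpos ▸ hfin)⟩, ?_⟩
  · exact hg.aestronglyMeasurable.aemeasurable.coe_real_ereal.congr
      (hfg.mono fun s hs => hs.symm)
  · rw [erealIntegral, hpos, hneg, integral_eq_lintegral_pos_part_sub_lintegral_neg_part hg,
      EReal.coe_sub, EReal.coe_ennreal_toReal hfin, EReal.coe_ennreal_toReal hfin']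

theorem hasImproperIntegral_of_ae_eq_coe {f : ℝ → EReal} {g : ℝ → ℝ} {t : ℝ}
    (hg : IntegrableOn g (Ici t)) (hfg : ∀ᵐ s ∂volume.restrict (Ici t), f s = (g s : EReal)) :
    HasImproperIntegral f t ((∫ s in Ioi t, g s : ℝ) : EReal) := by
  have h1 : ∀ T, HasErealIntegral f (volume.restrict (Icc t T)) ∧
      erealIntegral f (volume.restrict (Icc t T)) = ((∫ s in Icc t T, g s : ℝ) : EReal) := fun T =>
    erealIntegral_of_ae_eq_coe (hg.mono_set Icc_subset_Ici_self)
      (ae_restrict_of_ae_restrict_of_subset Icc_subset_Ici_self hfg)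
  refine ⟨fun T _ => (h1 T).1, ?_⟩
  simp only [fun T => (h1 T).2]
  refine (continuous_coe_real_ereal.tendsto _).comp ?_
  have h2 := intervalIntegral_tendsto_integral_Ioi t (hg.mono_set Ioi_subset_Ici_self) tendsto_id
  refine h2.congr' ?_
  filter_upwards [eventually_ge_atTop t] with T hT
  rw [integral_Icc_eq_integral_Ioc, ← intervalIntegral.integral_of_le hT, id]

theorem HasImproperIntegral.unique {f : ℝ → EReal} {t : ℝ} {I J : EReal}
    (hI : HasImproperIntegral f t I) (hJ : HasImproperIntegral f t J) : I = J :=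
  tendsto_nhds_unique hI.2 hJ.2

end ImproperIntegral

/-! ### Identification with the extended-real value function -/

section Main

variable {E : Type*} [NormedAddCommGroup E] [NormedSpace ℝ E]
  {L : ℝ → E → E → EReal} {F : ℝ → E → Set E} {l : ℝ → E → E → ℝ} {γ₀ γ₁ l₀ l₁ l₂ : ℝ → ℝ}

theorem hasCost_of_admissible [MeasurableSpace E] [BorelSpace E] [SecondCountableTopology E]
    (h : IsHorizonProblem F l γ₀ γ₁ l₀ l₁ l₂)
    (hL : ∀ᵐ s ∂volume.restrict (Ici (0 : ℝ)), ∀ x y, L s x y = (l s x y : EReal)) {t : ℝ}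
    (ht : 0 ≤ t) {ξ : E} {x : ℝ → E} (hx : x ∈ admissible F t ξ) :
    HasCost L x t (cost l t x : EReal) := by
  refine hasImproperIntegral_of_ae_eq_coe (integrableOn_cost h ht hx) ?_
  filter_upwards [ae_restrict_of_ae_restrict_of_subset (Ici_subset_Ici.2 ht) hL] with s hs
    using hs _ _

/-- Every admissible arc has a well-defined finite cost, so the restriction to arcs with a defined
cost excludes nothing and both infima run over the same numbers. -/
theorem valueFn_eq_realValue [MeasurableSpace E] [BorelSpace E] [SecondCountableTopology E]
    (h : IsHorizonProblem F l γ₀ γ₁ l₀ l₁ l₂)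
    (hL : ∀ᵐ s ∂volume.restrict (Ici (0 : ℝ)), ∀ x y, L s x y = (l s x y : EReal)) {t : ℝ}
    (ht : 0 ≤ t) (ξ : E) : valueFn L F t ξ = (realValue F l t ξ : EReal) := by
  refine IsGLB.sInf_eq ⟨?_, fun b hb => ?_⟩
  · rintro I ⟨x, hx, hI⟩
    rw [hI.unique (hasCost_of_admissible h hL ht hx), EReal.coe_le_coe_iff]
    exact realValue_le_cost h ht hx
  · by_contra! hlt
    obtain ⟨c, hc1, hc2⟩ := EReal.lt_iff_exists_real_btwn.1 hlt
    rw [EReal.coe_lt_coe_iff] at hc1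
    refine absurd hc1 (not_lt.2 (le_realValue h ht fun x hx => ?_))
    have := hc2.le.trans (hb ⟨x, hx, hasCost_of_admissible h hL ht hx⟩)
    exact_mod_cast this

/-- The constant direction u = w is one of the approaches allowed in the lower limit, so an eventual
bound along it suffices. -/
theorem lowerDeriv_le_of_eventually {f : E → ℝ} {x w : E} {c : ℝ}
    (h : ∀ ε : ℝ, 0 < ε → ∀ᶠ θ in 𝓝[>] (0 : ℝ), (f (x + θ • w) - f x) / θ ≤ c + ε) :
    lowerDeriv (fun y => (f y : EReal)) x w ≤ c := by
  refine EReal.le_of_forall_lt_iff_le.1 fun z hz => ?_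
  have hz' : c < z := by exact_mod_cast hz
  refine liminf_le_of_frequently_le ?_ (by isBoundedDefault)
  refine (tendsto_base w).frequently (Eventually.frequently ?_)
  filter_upwards [h (z - c) (by linarith)] with θ hθ
  rw [diffQuot_coe, EReal.coe_le_coe_iff]
  linarith

theorem isHorizonProblem_of_hypotheses {Γ : ℝ → E → Set E} {a₀ a₁ a₂ : ℝ → ℝ}
    (hF : IsVelocityField (extendField Γ) ((Ici 0).indicator γ₀) ((Ici 0).indicator γ₁))
    (hl : IsCostIntegrand l ((Ici 0).indicator a₀) ((Ici 0).indicator a₁) ((Ici 0).indicator a₂))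
    (hint : IntegrableOn (fun s : ℝ => Real.exp (∫ τ in (0 : ℝ)..s, γ₁ τ) *
      (1 + ∫ τ in (0 : ℝ)..s, γ₀ τ) * (a₁ s + a₂ s * γ₁ s)) (Ici 0))
    (hint' : IntegrableOn (fun s : ℝ => a₂ s * γ₀ s) (Ici 0))
    (hne : ∀ t : ℝ, 0 ≤ t → ∀ ξ : E, (admissible Γ t ξ).Nonempty) :
    IsHorizonProblem (extendField Γ) l ((Ici 0).indicator γ₀) ((Ici 0).indicator γ₁)
      ((Ici 0).indicator a₀) ((Ici 0).indicator a₁) ((Ici 0).indicator a₂) where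
  toIsVelocityField := hF
  toIsCostIntegrand := hl
  growth_integrable := by
    refine hint.congr_fun (fun s hs => ?_) measurableSet_Ici
    have e : ∀ γ : ℝ → ℝ, ∫ τ in (0 : ℝ)..s, (Ici (0 : ℝ)).indicator γ τ =
        ∫ τ in (0 : ℝ)..s, γ τ := fun γ => by
      refine intervalIntegral.integral_congr fun τ hτ => ?_
      rw [uIcc_of_le hs] at hτ
      exact indicator_of_mem (mem_Ici.2 hτ.1) γ
    simp only [growth, e, indicator_of_mem hs]
  cost_integrable := by
    refine hint'.congr_fun (fun s hs => ?_) measurableSet_Ici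
    simp only [indicator_of_mem hs]
  exists_admissible t ht ξ := by
    rw [admissible_extendField Γ ht]
    exact hne t ht ξ

theorem valueFn_extendField (L : ℝ → E → E → EReal) (Γ : ℝ → E → Set E) {t : ℝ} (ht : 0 ≤ t) :
    valueFn L (extendField Γ) t = valueFn L Γ t := by
  ext ξ
  unfold valueFn
  rw [admissible_extendField Γ ht]

end Main

end InfHorizon

/-! ### The main theorem -/

theorem mainTheorem2 {E : Type*} [NormedAddCommGroup E] [NormedSpace ℝ E] [CompleteSpace E]
    [TopologicalSpace.SeparableSpace E]
    (L : ℝ → E → E → EReal) (Γ : ℝ → E → Set E)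
    (l₀ l₁ l₂ γ₀ γ₁ : ℝ → ℝ) (ξ₀ : E) (x₀ : ℝ → E)
    -- the integrand takes values in `ℝ ∪ {+∞}`, the moduli are nonnegative
    (hL : ∀ t : ℝ, 0 ≤ t → ∀ x y : E, L t x y ≠ ⊥)
    (hl₀ : ∀ t : ℝ, 0 ≤ t → 0 ≤ l₀ t) (hl₁ : ∀ t : ℝ, 0 ≤ t → 0 ≤ l₁ t)
    (hl₂ : ∀ t : ℝ, 0 ≤ t → 0 ≤ l₂ t)
    (hγ₀ : ∀ t : ℝ, 0 ≤ t → 0 ≤ γ₀ t) (hγ₁ : ∀ t : ℝ, 0 ≤ t → 0 ≤ γ₁ t)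
    -- (H1)
    (H1 : ∀ t : ℝ, 0 ≤ t → ∀ ξ : E, (admissible Γ t ξ).Nonempty)
    -- (H2)
    (H2 : ∀ x y : E, AEMeasurable (fun t => L t x y) (volume.restrict (Ici (0 : ℝ))))
    -- (H3)
    (H3_l₀ : IntegrableOn l₀ (Ici 0)) (H3_l₁ : IntegrableOn l₁ (Ici 0))
    (H3_l₂ : IntegrableOn l₂ (Ici 0))
    (H3_l₂_bdd : ∀ T : ℝ, ∃ M : ℝ, ∀ t ∈ Icc 0 T, l₂ t ≤ M)
    (H3_bound : ∀ᵐ t ∂volume.restrict (Ici (0 : ℝ)), (L t 0 0).abs ≤ ENNReal.ofReal (l₀ t))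
    (H3_lip : ∀ᵐ t ∂volume.restrict (Ici (0 : ℝ)), ∀ x y x' y' : E,
      (L t x y - L t x' y').abs ≤ ENNReal.ofReal (l₁ t * ‖x - x'‖ + l₂ t * ‖y - y'‖))
    -- (H4)
    (H4 : ∀ t : ℝ, 0 ≤ t → ∀ x : E, (Γ t x).Nonempty ∧ IsClosed (Γ t x))
    -- (H5')
    (H5' : ∀ x : E, LowerHemicontinuousOn (fun t => Γ t x) (Ici (0 : ℝ)))
    -- (H6)
    (H6_γ₀ : LocallyIntegrableOn γ₀ (Ici 0)) (H6_γ₁ : LocallyIntegrableOn γ₁ (Ici 0))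
    (H6_bound : ∀ t : ℝ, 0 ≤ t → Γ t 0 ⊆ γ₀ t • Metric.ball (0 : E) 1)
    (H6_lip : ∀ t : ℝ, 0 ≤ t → ∀ x x' : E,
      Γ t x ⊆ Γ t x' + (γ₁ t * ‖x - x'‖) • Metric.ball (0 : E) 1)
    -- (H7)
    (H7 : IntegrableOn (fun s : ℝ => Real.exp (∫ τ in (0 : ℝ)..s, γ₁ τ) *
      (1 + ∫ τ in (0 : ℝ)..s, γ₀ τ) * (l₁ s + l₂ s * γ₁ s)) (Ici 0))
    (H7' : IntegrableOn (fun s : ℝ => l₂ s * γ₀ s) (Ici 0))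
    (hx₀ : IsOptimal L Γ 0 ξ₀ x₀) :
    ∀ᵐ t ∂volume.restrict (Ici (0 : ℝ)),
      (∀ v ∈ Γ t (x₀ t),
        lowerDeriv (valueFn L Γ t) (x₀ t) (deriv x₀ t - v) ≤
          L t (x₀ t) v - L t (x₀ t) (deriv x₀ t)) ∧
      -gateauxSubdiff (valueFn L Γ t) (x₀ t) ⊆
        clarkeSubdiff (L t (x₀ t)) (deriv x₀ t) +
          clarkeNormalCone (Γ t (x₀ t)) (deriv x₀ t) ∧
      (∀ g : StrongDual ℝ E, HasGateauxDeriv (L t (x₀ t)) g (deriv x₀ t) →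
        -gateauxSubdiff (valueFn L Γ t) (x₀ t) ⊆
          {g} + clarkeNormalCone (Γ t (x₀ t)) (deriv x₀ t) ∧
        ((gateauxSubdiff (valueFn L Γ t) (x₀ t)).Nonempty →
          clarkeNormalCone (Γ t (x₀ t)) (deriv x₀ t) = {0} →
            -gateauxSubdiff (valueFn L Γ t) (x₀ t) = {g} ∧
            (∃ p, gateauxSubdiff (valueFn L Γ t) (x₀ t) = {p}) ∧
            (IsRegularAt (valueFn L Γ t) (x₀ t) →
              ∃ p, HasStrictDeriv (valueFn L Γ t) p (x₀ t)))) ∧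
      (FiniteDimensional ℝ E →
        (clarkeNormalCone (Γ t (x₀ t)) (deriv x₀ t) = {0} ↔
          deriv x₀ t ∈ interior (Γ t (x₀ t)))) ∧
      (IsConvexFun (valueFn L Γ t) → IsRegularAt (valueFn L Γ t) (x₀ t)) := by
  borelize E
  have : SecondCountableTopology E := UniformSpace.secondCountable_of_separable E
  obtain ⟨l, hl, hLl⟩ := exists_isCostIntegrand hl₁ hl₂ hl₀ H2 H3_l₀ H3_l₁ H3_l₂ H3_l₂_bdd
    H3_bound H3_lip
  have hF := isVelocityField_extendField hγ₀ hγ₁ H4 H5' H6_γ₀ H6_γ₁ H6_bound H6_lip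
  have h := isHorizonProblem_of_hypotheses hF hl H7 H7' H1
  have hV : ∀ t, 0 ≤ t → valueFn L Γ t = fun ξ => (realValue (extendField Γ) l t ξ : EReal) := by
    intro t ht
    rw [← valueFn_extendField L Γ ht]
    exact funext (valueFn_eq_realValue h hLl ht)
  obtain ⟨hadm, -, -, hcost⟩ := hx₀
  rw [← admissible_extendField Γ le_rfl] at hadm
  have hopt : cost l 0 x₀ = realValue (extendField Γ) l 0 ξ₀ := by
    have h1 := hcost.unique (hasCost_of_admissible h hLl le_rfl hadm)
    rw [hV 0 le_rfl] at h1
    exact (EReal.coe_injective h1).symm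
  have hdiff : ∀ᵐ t ∂volume.restrict (Ici (0 : ℝ)), DifferentiableAt ℝ x₀ t := by
    rw [← restrict_Ioi_eq_restrict_Ici]
    exact hadm.1.differentiable
  have hpos : ∀ᵐ t ∂volume.restrict (Ici (0 : ℝ)), 0 < t := by
    rw [← restrict_Ioi_eq_restrict_Ici]
    exact ae_restrict_mem measurableSet_Ioi
  -- All exceptional times are discarded here, before v is introduced, so the inequality holds for
  -- every v in Γ(t, x₀(t)) at once.
  filter_upwards [hpos, hdiff, hadm.2.1, hLl, ae_restrict_of_ae (ae_hasDerivAt_cost_const hl),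
    ae_restrict_of_ae (ae_hasDerivAt_cost_admissible h hadm)] with t ht0 hd hvel hLt hc hc₀
  have ht : 0 ≤ t := ht0.le
  rw [extendField_of_nonneg Γ ht] at hvel
  have hlow : ∀ v ∈ Γ t (x₀ t), lowerDeriv (valueFn L Γ t) (x₀ t) (deriv x₀ t - v) ≤
      (l t (x₀ t) v : EReal) - (l t (x₀ t) (deriv x₀ t) : EReal) := by
    intro v hv
    rw [hV t ht, ← EReal.coe_sub]
    exact lowerDeriv_le_of_eventually fun ε hε =>
      eventually_quot_realValue_le h hadm hopt ht hd.hasDerivAt (hc₀ ht0) (hc (x₀ t) v)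
        (tendsto_infDist_extendField (fun s hs => (H4 s hs _).1) (H5' _) ht hv) hε
  have hLy : L t (x₀ t) = fun y => (l t (x₀ t) y : EReal) := funext (hLt (x₀ t))
  have hlip : LipschitzWith ((Ici (0 : ℝ)).indicator l₂ t).toNNReal (l t (x₀ t)) := by
    refine LipschitzWith.of_dist_le_mul fun y y' => ?_
    have h1 := hl.cost_lip t (x₀ t) y (x₀ t) y'
    rw [sub_self, norm_zero, mul_zero, zero_add] at h1
    rwa [Real.coe_toNNReal _ (hl.l₂_nonneg t), Real.dist_eq, dist_eq_norm]
  refine ⟨fun v hv => ?_, ?_⟩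
  · rw [hLy]
    exact hlow v hv
  · rw [hV t ht] at hlow ⊢
    rw [hLy]
    exact subdiff_of_lowerDeriv_le (lipschitzWith_realValue h ht) hlip (H4 t ht _).2 hvel hlow
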